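/- Let $2\le k\le n$ be integers, and let $\Omega\subset\mathbb C^n=\mathbb R^{2n}$ be a bounded $C^4$ strictly convex domain, that is, a bounded convex domain with $C^4$ boundary all of whose principal curvatures are positive. Let $\nu$ be the outer unit normal vector of $\partial\Omega$, let $\alpha_0,\dots,\alpha_{k-1}\in C^2(\overline\Omega)$ be real functions that are positive on $\overline\Omega$, let $\varphi\in C^3(\partial\Omega)$ be real valued, and let $0<\varepsilon<1$. For a real function $u$ let $\partial\bar\partial u=\big(\frac{\partial^2u}{\partial z_i\partial\overline{z_j}}\big)_{1\le i,j\le n}$ be its complex Hessian and let $\sigma_m(\partial\bar\partial u)$ be the $m$-th elementary symmetric function of the eigenvalues of $\partial\bar\partial u$, with $\sigma_0=1$. Let $u\in C^4(\Omega)\cap C^3(\overline\Omega)$ be $k$-admissible, that is, $\sigma_i(\partial\bar\partial u)>0$ in $\Omega$ for $1\le i\le k$, and suppose that $$\sigma_k(\partial\bar\partial u)=\sum_{l=0}^{k-1}\alpha_l(z)\,\sigma_l(\partial\bar\partial u)\ \text{ in }\Omega,\qquad D_\nu u=-\varepsilon u+\varphi\ \text{ on }\partial\Omega .$$ Then $$\sup_\Omega|u|\le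 C_0,\qquad \sup_\Omega|Du|\le C_1,\qquad \sup_\Omega|D^2u|\le C_2\Big(1+\max_{\partial\Omega}|D_{\nu\nu}u|\Big),$$ where $Du$ and $D^2u$ are the real gradient and the real Hessian of $u$ on $\mathbb R^{2n}$ and $D_{\nu\nu}u=D^2u(\nu,\nu)$. Here $C_0$ depends only on $n$, $k$, $\varepsilon$ and on upper bounds for $\operatorname{diam}(\Omega)$, $\max_{\partial\Omega}|\varphi|$ and $\sum_{l=0}^{k-1}\sup_\Omega\alpha_l$; $C_1$ depends only on $n$, $k$, $\Omega$, an upper bound for $|\varphi|_{C^2(\partial\Omega)}$, a positive lower bound for the $\inf_\Omega\alpha_l$ and an upper bound for the $|\alpha_l|_{C^1(\overline\Omega)}$; and $C_2$ depends only on $n$, $k$, $\Omega$, an upper bound for $|\varphi|_{C^3(\partial\Omega)}$, a positive lower bound for the $\inf_\Omega\alpha_l$ and an upper bound for the $|\alpha_l|_{C^2(\overline\Omega)}$. In particular $C_1$ and $C_2$ do not depend on $\varepsilon$. -/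

import Mathlib

/-- `ℂⁿ` with its Euclidean norm, also regarded as the real Euclidean space `ℝ²ⁿ`. -/
abbrev CSpace (n : ℕ) : Type := EuclideanSpace ℂ (Fin n)

/-- The coordinate vector `e_j` of `ℂⁿ`. -/
noncomputable def coordVec {n : ℕ} (j : Fin n) : CSpace n := EuclideanSpace.single j 1

/-- The Wirtinger derivative `∂f/∂z_j = (1/2) (∂f/∂x_j - √-1 ∂f/∂y_j)`, where `z_j = x_j + √-1 y_j`. -/
noncomputable def wirtinger {n : ℕ} (j : Fin n) (f : CSpace n → ℂ) (z : CSpace n) : ℂ :=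
  (1 / 2) * (fderiv ℝ f z (coordVec j) - Complex.I * fderiv ℝ f z (Complex.I • coordVec j))

/-- The Wirtinger derivative `∂f/∂z̄_j = (1/2) (∂f/∂x_j + √-1 ∂f/∂y_j)`. -/
noncomputable def wirtingerBar {n : ℕ} (j : Fin n) (f : CSpace n → ℂ) (z : CSpace n) : ℂ :=
  (1 / 2) * (fderiv ℝ f z (coordVec j) + Complex.I * fderiv ℝ f z (Complex.I • coordVec j))

/-- The complex Hessian matrix `∂∂̄u = (∂²u / ∂z_i ∂z̄_j)_{i,j}` of a real valued function. -/
noncomputable def complexHessian {n : ℕ} (u : CSpace n → ℝ) (z : CSpace n) :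
    Matrix (Fin n) (Fin n) ℂ :=
  Matrix.of fun i j => wirtinger i (wirtingerBar j fun w => (u w : ℂ)) z

/-- The eigenvalues `λ(∂∂̄u)`, with multiplicity. Where `u` is `C²` the matrix is Hermitian, so that
all its eigenvalues are real and taking real parts only changes their type. -/
noncomputable def hessianEigenvalues {n : ℕ} (u : CSpace n → ℝ) (z : CSpace n) : Multiset ℝ :=
  (complexHessian u z).charpoly.roots.map Complex.re

/-- `σ_m(∂∂̄u)`, the `m`-th elementary symmetric function of the eigenvalues; `σ_0 = 1`. -/
noncomputable def hessianSigma {n : ℕ} (m : ℕ) (u : CSpace n → ℝ) (z : CSpace n) : ℝ :=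
  (hessianEigenvalues u z).esymm m

/-- `u` is `k`-admissible in `Ω`: `λ(∂∂̄u)` lies in the Gårding cone `Γ_k` at each point of `Ω`. -/
def IsAdmissible {n : ℕ} (k : ℕ) (Ω : Set (CSpace n)) (u : CSpace n → ℝ) : Prop :=
  ∀ z ∈ Ω, ∀ i : ℕ, 1 ≤ i → i ≤ k → 0 < hessianSigma i u z

/-- `Ω` is a bounded `C⁴` strictly convex domain: it has a `C⁴` defining function `r` whose gradient
does not vanish on `∂Ω`, and all principal curvatures of `∂Ω` are positive, that is, `D²r` is
positive definite on the tangent space `ker Dr(z)` at each boundary point `z`. -/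
structure IsC4StrictlyConvexDomain {n : ℕ} (Ω : Set (CSpace n)) : Prop where
  nonempty : Ω.Nonempty
  isOpen : IsOpen Ω
  isBounded : Bornology.IsBounded Ω
  convex : Convex ℝ Ω
  exists_defining : ∃ r : CSpace n → ℝ, ContDiff ℝ 4 r ∧ Ω = {z | r z < 0} ∧
    (∀ z ∈ frontier Ω, fderiv ℝ r z ≠ 0) ∧
    (∀ z ∈ frontier Ω, ∀ ξ : CSpace n, ξ ≠ 0 → fderiv ℝ r z ξ = 0 →
      0 < iteratedFDeriv ℝ 2 r z ![ξ, ξ])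

/-- `v` is the outer unit normal vector at the boundary point `z` of the convex set `Ω`: the unit
vector of the normal cone of `Ω` at `z`, which is a single ray if `∂Ω` is `C¹`. The inner product is
the real one of `ℝ²ⁿ`. -/
def IsOuterUnitNormal {n : ℕ} (Ω : Set (CSpace n)) (z v : CSpace n) : Prop :=
  ‖v‖ = 1 ∧ ∀ w ∈ Ω, inner ℝ (w - z) v ≤ 0

/-- The norm of `C^m(Ω̄)`: the sum of the suprema over `Ω̄` of the norms of the derivatives of order
at most `m`. -/
noncomputable def closureCNorm {n : ℕ} (Ω : Set (CSpace n)) (m : ℕ) (f : CSpace n → ℝ) : ℝ :=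
  ∑ j ∈ Finset.range (m + 1),
    sSup ((fun z => ‖iteratedFDerivWithin ℝ j f (closure Ω) z‖) '' closure Ω)

/-- `Φ ∈ C^m(Ω̄)` is an extension of the function `φ` on `∂Ω`. -/
def IsBoundaryExtension {n : ℕ} (Ω : Set (CSpace n)) (m : ℕ) (φ Φ : CSpace n → ℝ) : Prop :=
  ContDiffOn ℝ m Φ (closure Ω) ∧ Set.EqOn Φ φ (frontier Ω)

/-- The norm of `C^m(∂Ω)`: the infimum of the `C^m(Ω̄)` norms of the extensions. -/
noncomputable def boundaryCNorm {n : ℕ} (Ω : Set (CSpace n)) (m : ℕ) (φ : CSpace n → ℝ) : ℝ :=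
  sInf {b | ∃ Φ, IsBoundaryExtension Ω m φ Φ ∧ b = closureCNorm Ω m Φ}

/-- The data of the Neumann problem: a `C⁴` strictly convex domain `Ω` with outer unit normal field
`ν`, positive coefficients `α_l ∈ C²(Ω̄)` for `0 ≤ l ≤ k - 1`, and `φ ∈ C³(∂Ω)` (of `ν` and `φ` only
the values on `∂Ω` are used). -/
structure IsNeumannData {n : ℕ} (k : ℕ) (Ω : Set (CSpace n)) (ν : CSpace n → CSpace n)
    (α : Fin k → CSpace n → ℝ) (φ : CSpace n → ℝ) : Prop where
  domain : IsC4StrictlyConvexDomain Ω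
  normal : ∀ z ∈ frontier Ω, IsOuterUnitNormal Ω z (ν z)
  coeff_contDiffOn : ∀ l, ContDiffOn ℝ 2 (α l) (closure Ω)
  coeff_pos : ∀ l, ∀ z ∈ closure Ω, 0 < α l z
  boundary_contDiff : ∃ Φ, IsBoundaryExtension Ω 3 φ Φ

/-- `u ∈ C⁴(Ω) ∩ C³(Ω̄)` is a `k`-admissible solution of `σ_k(∂∂̄u) = ∑_{l<k} α_l σ_l(∂∂̄u)` in `Ω`,
`D_ν u = - ε u + φ` on `∂Ω`. Derivatives at boundary points are taken within `Ω̄`. -/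
structure IsAdmissibleSolution {n : ℕ} (k : ℕ) (Ω : Set (CSpace n)) (ν : CSpace n → CSpace n)
    (α : Fin k → CSpace n → ℝ) (φ : CSpace n → ℝ) (ε : ℝ) (u : CSpace n → ℝ) : Prop where
  contDiffOn : ContDiffOn ℝ 4 u Ω
  contDiffOn_closure : ContDiffOn ℝ 3 u (closure Ω)
  admissible : IsAdmissible k Ω u
  equation : ∀ z ∈ Ω, hessianSigma k u z = ∑ l : Fin k, α l z * hessianSigma (l : ℕ) u z
  boundary : ∀ z ∈ frontier Ω, fderivWithin ℝ u (closure Ω) z (ν z) = -ε * u z + φ z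

/-- `max_{∂Ω} |D_{νν} u|`, where `D_{νν} u = D²u(ν, ν)`. -/
noncomputable def maxDoubleNormal {n : ℕ} (Ω : Set (CSpace n)) (ν : CSpace n → CSpace n)
    (u : CSpace n → ℝ) : ℝ :=
  sSup ((fun z => |iteratedFDerivWithin ℝ 2 u (closure Ω) z ![ν z, ν z]|) '' frontier Ω)

open Filter Topology

/-! The engine is a substitute for differentiating the fully nonlinear equation. On the Gårding cone
each quotient σ_{j+1}/σ_j lies below linear functionals with nonnegative coefficients that touch it
at a prescribed point. For eigenvalues this is an induction on j (`exists_elemSymm_supergradient`);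
Birkhoff's theorem carries it to Hermitian matrices, with one orthonormal basis that serves all j at
once.

Divide the equation by σ_{k-1}, so that it reads σ_k/σ_{k-1} = Σ α_l σ_l/σ_{k-1}, and fix z₀. The
left side lies below a linear functional of the complex Hessian. Each σ_l/σ_{k-1} is a product of
reciprocals of quotients and lies above a multiple of the exponential of a linear functional. The
difference R of these two bounds is a nonnegative function on Ω with R(z₀) = 0. Its first
derivatives at z₀ vanish and its second derivatives are nonnegative. This gives an operator L, a
nonnegative combination of Levi forms in unit directions with total weight at least 1/n, such that
Lu and L(∂_ξ u) are bounded and L(∂_ξ∂_ξ u) is bounded below (`exists_linearization`). The proof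
uses no further ellipticity.

What remains is the maximum principle on the compact closure of Ω. For the supremum, u is
subharmonic, so its maximum lies on the boundary, where D_ν u ≥ 0. Subtracting a large multiple of
|z|² also moves the minimum to the boundary, because the equation always leaves some Levi value
under control. This bounds εu in terms of diam Ω, max |φ| and the coefficients, and dividing by ε
gives C₀.

For the gradient, let N extend the outer normal and Φ extend φ. The function D_ξ u - ⟨ξ,N⟩(-εu + Φ)
+ (ε²/2)u² + K|x|² is maximised over all unit ξ and all x. For large K, L excludes an interior
maximum. At a boundary maximum ξ can be taken along the tangential gradient; the normal derivative
is nonnegative there, the tangential derivative of the Neumann condition is known, and the positive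
curvature κ then bounds the tangential gradient. Only εu enters, never u itself, so C₁ is free of ε.

For the Hessian, the analogous function is D²u(ξ,ξ) - 2⟨ξ,N⟩Z + |Du|² + K|x|², where Z is a first
order expression that equals the mixed tangential-normal derivative on the boundary. At a boundary
maximum either the double normal derivative dominates, or ξ can be taken tangential and the twice
differentiated Neumann condition gives a bound through κ. This is an upper bound on D²u(ξ,ξ) only;
since tr D²u = 4σ_1 > 0, it controls the whole Hessian. -/

open Finset in
/-- The elementary symmetric polynomial of degree `j` in the variables `x i`, `i ∈ s`. -/
noncomputable def elemSymm {ι : Type*} (s : Finset ι) (x : ι → ℝ) (j : ℕ) : ℝ :=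
  ∑ t ∈ s.powersetCard j, ∏ i ∈ t, x i

/-! ### Newton's inequality and supporting functionals of σ_{j+1}/σ_j. -/

section ElemSymm

variable {ι : Type*}

theorem elemSymm_eq_esymm (s : Finset ι) (x : ι → ℝ) (j : ℕ) :
    elemSymm s x j = (s.val.map x).esymm j :=
  (Finset.esymm_map_val x s j).symm

@[simp] theorem elemSymm_zero (s : Finset ι) (x : ι → ℝ) : elemSymm s x 0 = 1 := by
  simp [elemSymm]

theorem elemSymm_one (s : Finset ι) (x : ι → ℝ) : elemSymm s x 1 = ∑ i ∈ s, x i := by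
  simp [elemSymm, Finset.powersetCard_one]

theorem elemSymm_insert [DecidableEq ι] {s : Finset ι} {a : ι} (ha : a ∉ s) (x : ι → ℝ) (j : ℕ) :
    elemSymm (insert a s) x (j + 1) = elemSymm s x (j + 1) + x a * elemSymm s x j := by
  unfold elemSymm
  rw [Finset.powersetCard_succ_insert ha, Finset.sum_union, Finset.sum_image, Finset.mul_sum]
  · congr 1
    refine Finset.sum_congr rfl fun t ht => ?_
    rw [Finset.prod_insert fun h => ha ((Finset.mem_powersetCard.1 ht).1 h)]
  · intro t ht t' ht' h
    have h1 : a ∉ t := fun h => ha ((Finset.mem_powersetCard.1 ht).1 h)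
    have h2 : a ∉ t' := fun h => ha ((Finset.mem_powersetCard.1 ht').1 h)
    rw [← Finset.erase_insert h1, ← Finset.erase_insert h2, h]
  · rw [Finset.disjoint_left]
    intro t ht ht'
    obtain ⟨t', -, rfl⟩ := Finset.mem_image.1 ht'
    exact ha ((Finset.mem_powersetCard.1 ht).1 (Finset.mem_insert_self _ _))

theorem elemSymm_eq_erase [DecidableEq ι] {s : Finset ι} {a : ι} (ha : a ∈ s) (x : ι → ℝ) (j : ℕ) :
    elemSymm s x (j + 1) = elemSymm (s.erase a) x (j + 1) + x a * elemSymm (s.erase a) x j := by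
  conv_lhs => rw [← Finset.insert_erase ha]
  exact elemSymm_insert (Finset.notMem_erase _ _) x j

/-- Euler's identity: σ_j of the variables other than x_i is the partial derivative of σ_{j+1} in
x_i. -/
theorem sum_mul_elemSymm_erase [DecidableEq ι] (s : Finset ι) (x : ι → ℝ) (j : ℕ) :
    ∑ i ∈ s, x i * elemSymm (s.erase i) x j = (j + 1) * elemSymm s x (j + 1) := by
  induction s using Finset.induction_on generalizing j with
  | empty =>
    have : Finset.powersetCard (j + 1) (∅ : Finset ι) = ∅ :=
      Finset.powersetCard_eq_empty.2 (by simp)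
    simp [elemSymm, this]
  | insert a s ha ih =>
    rw [Finset.sum_insert ha, Finset.erase_insert ha, elemSymm_insert ha]
    have h1 : ∀ i ∈ s, (insert a s).erase i = insert a (s.erase i) := fun i hi =>
      Finset.erase_insert_of_ne fun h => ha (h ▸ hi)
    rw [Finset.sum_congr rfl fun i hi => by rw [h1 i hi]]
    cases j with
    | zero =>
      have := ih 0
      simp only [elemSymm_zero, mul_one, Nat.cast_zero, zero_add] at this ⊢
      rw [this]; ring
    | succ j =>
      have h2 : ∀ i ∈ s, x i * elemSymm (insert a (s.erase i)) x (j + 1) =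
          x i * elemSymm (s.erase i) x (j + 1) + x a * (x i * elemSymm (s.erase i) x j) := by
        intro i hi
        rw [elemSymm_insert fun h => ha (Finset.mem_of_mem_erase h)]; ring
      rw [Finset.sum_congr rfl h2, Finset.sum_add_distrib, ← Finset.mul_sum, ih, ih]
      push_cast; ring

-- Rolle's theorem: passing to the derivative loses at most one root counted with multiplicity, and
-- also one degree.
open Polynomial in
theorem splits_derivative_of_splits {p : ℝ[X]} (hp : p.Splits) : (derivative p).Splits := by
  by_cases h0 : derivative p = 0
  · rw [h0]; exact Splits.zero
  have h1 := card_roots_le_derivative p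
  rw [splits_iff_card_roots] at hp ⊢
  have h2 := natDegree_derivative_le p
  have h3 := card_roots' (derivative p)
  by_cases h4 : p.natDegree = 0
  · rw [natDegree_eq_zero_iff_degree_le_zero, ] at h4
    rw [eq_C_of_degree_le_zero h4] at h0
    simp at h0
  · omega

-- For a product of factors X - a, the defect c₁² - 2c₀c₂ is multiplied by a² and increased by c₀²
-- when a factor is added, so it stays nonnegative.
open Polynomial in
theorem two_mul_coeff_zero_mul_coeff_two_le {p : ℝ[X]} (hp : p.Splits) :
    2 * (p.coeff 0 * p.coeff 2) ≤ p.coeff 1 ^ 2 := by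
  have key : ∀ m : Multiset ℝ, 2 * ((m.map fun a => X - C a).prod.coeff 0 *
      (m.map fun a => X - C a).prod.coeff 2) ≤ (m.map fun a => X - C a).prod.coeff 1 ^ 2 := by
    intro m
    induction m using Multiset.induction_on with
    | empty => simp [coeff_one]
    | cons a m ih =>
      set P := (m.map fun a => X - C a).prod
      simp only [Multiset.map_cons, Multiset.prod_cons, sub_mul, coeff_sub, coeff_X_mul,
        coeff_C_mul, coeff_X_mul_zero]
      have := mul_nonneg (sq_nonneg a) (sub_nonneg.2 ih)
      nlinarith [sq_nonneg (P.coeff 0)]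
  rw [hp.eq_prod_roots]
  simp only [coeff_C_mul]
  have := mul_nonneg (sq_nonneg p.leadingCoeff) (sub_nonneg.2 (key p.roots))
  linarith

-- The m-th derivative still splits, and its three lowest coefficients are those of index m, m + 1,
-- m + 2 up to factorials. The resulting factor m!(m+2)! is at least ((m+1)!)² and can be dropped.
open Polynomial in
theorem coeff_mul_coeff_le_sq {p : ℝ[X]} (hp : p.Splits) (m : ℕ) :
    p.coeff m * p.coeff (m + 2) ≤ p.coeff (m + 1) ^ 2 := by
  have hs : ∀ m, (derivative^[m] p).Splits := by
    intro m
    induction m with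
    | zero => exact hp
    | succ m ih => rw [Function.iterate_succ_apply']; exact splits_derivative_of_splits ih
  have h := two_mul_coeff_zero_mul_coeff_two_le (hs m)
  simp only [coeff_iterate_derivative, zero_add, Nat.descFactorial_self, nsmul_eq_mul] at h
  have e1 : (1 + m).descFactorial m = (m + 1).factorial := by
    have := Nat.factorial_mul_descFactorial (n := 1 + m) (k := m) (by omega)
    rw [Nat.add_sub_cancel] at this
    rw [add_comm m 1]; simpa using this
  have e2 : 2 * (2 + m).descFactorial m = (m + 2).factorial := by
    have := Nat.factorial_mul_descFactorial (n := 2 + m) (k := m) (by omega)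
    rw [Nat.add_sub_cancel] at this
    rw [add_comm m 2]; simpa using this
  rw [e1, add_comm 1 m, add_comm 2 m] at h
  have e2' : (2 : ℝ) * ((m + 2).descFactorial m : ℝ) = (m + 2).factorial := by
    rw [add_comm m 2] at e2 ⊢; exact_mod_cast e2
  have h' : (m.factorial : ℝ) * (m + 2).factorial * (p.coeff m * p.coeff (m + 2)) ≤
      (((m + 1).factorial : ℝ) * p.coeff (m + 1)) ^ 2 := by
    rw [← e2']; linarith
  rcases le_or_gt (p.coeff m * p.coeff (m + 2)) 0 with h0 | h0
  · exact h0.trans (sq_nonneg _)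
  have e3 : ((m + 1).factorial : ℝ) ^ 2 ≤ (m.factorial : ℝ) * (m + 2).factorial := by
    rw [Nat.factorial_succ (m + 1), Nat.factorial_succ m]
    push_cast
    have : (0 : ℝ) ≤ m.factorial := by positivity
    nlinarith [mul_nonneg this this]
  have e4 : (0 : ℝ) < ((m + 1).factorial : ℝ) ^ 2 := by positivity
  have := mul_le_mul_of_nonneg_right e3 h0.le
  have h5 : ((m + 1).factorial : ℝ) ^ 2 * (p.coeff m * p.coeff (m + 2)) ≤
      ((m + 1).factorial : ℝ) ^ 2 * p.coeff (m + 1) ^ 2 := by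
    rw [← mul_pow]; linarith
  exact le_of_mul_le_mul_left h5 e4

/-- Newton's inequality, with a non-optimal constant, for arbitrary real numbers. -/
theorem elemSymm_mul_elemSymm_le_sq (s : Finset ι) (x : ι → ℝ) (j : ℕ) :
    elemSymm s x j * elemSymm s x (j + 2) ≤ elemSymm s x (j + 1) ^ 2 := by
  rcases lt_or_ge s.card (j + 2) with h | h
  · have : elemSymm s x (j + 2) = 0 := by
      simp [elemSymm, Finset.powersetCard_eq_empty.2 h]
    rw [this, mul_zero]; positivity
  obtain ⟨m, hm⟩ := Nat.exists_eq_add_of_le h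
  set p : Polynomial ℝ := ((s.val.map x).map fun r => Polynomial.X + Polynomial.C r).prod with hp
  have hsp : p.Splits := by
    refine Polynomial.Splits.multisetProd fun f hf => ?_
    obtain ⟨r, -, rfl⟩ := Multiset.mem_map.1 hf
    exact Polynomial.Splits.X_add_C r
  have hc : ∀ i, i ≤ s.card → p.coeff i = elemSymm s x (s.card - i) := by
    intro i hi
    rw [hp, Multiset.prod_X_add_C_coeff _ (by simpa using hi), elemSymm_eq_esymm]
    simp
  have := coeff_mul_coeff_le_sq hsp m
  rw [hc m (by omega), hc (m + 1) (by omega), hc (m + 2) (by omega)] at this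
  rw [show s.card - m = j + 2 by omega, show s.card - (m + 1) = j + 1 by omega,
    show s.card - (m + 2) = j by omega] at this
  linarith

/-- Write a, b, c for σ_m, σ_{m+1}, σ_{m+2} without x_i. If a > 0 and b ≤ 0, then a(c + x_i b) > 0
and -b(b + x_i a) ≥ 0 add up to ac > b², against Newton. -/
theorem elemSymm_erase_pos [DecidableEq ι] {s : Finset ι} {x : ι → ℝ} {j : ℕ}
    (hx : ∀ m ≤ j + 1, 0 < elemSymm s x m) {i : ι} (hi : i ∈ s) :
    ∀ m ≤ j, 0 < elemSymm (s.erase i) x m := by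
  intro m
  induction m with
  | zero => intro _; simp
  | succ m ih =>
    intro hm
    have h0 := ih (by omega)
    have h1 := hx (m + 1) (by omega)
    have h2 := hx (m + 2) (by omega)
    rw [elemSymm_eq_erase hi] at h1 h2
    have hN := elemSymm_mul_elemSymm_le_sq (s.erase i) x m
    set a := elemSymm (s.erase i) x m
    set b := elemSymm (s.erase i) x (m + 1)
    set c := elemSymm (s.erase i) x (m + 2)
    by_contra hb
    push Not at hb
    nlinarith [mul_pos h0 h2, mul_nonneg (neg_nonneg.2 hb) h1.le]

/-- The quotient `σ_{j+1} / σ_j` has linear supporting functionals with nonnegative coefficients on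
the Gårding cone `Γ_j`. -/
theorem exists_elemSymm_supergradient [DecidableEq ι] (j : ℕ) :
    ∀ (s : Finset ι) (x : ι → ℝ), (∀ m ≤ j, 0 < elemSymm s x m) →
      ∃ p : ι → ℝ, (∀ i, 0 ≤ p i) ∧
        (∀ y : ι → ℝ, (∀ m ≤ j, 0 < elemSymm s y m) →
          elemSymm s y (j + 1) ≤ elemSymm s y j * ∑ i ∈ s, p i * y i) ∧
        elemSymm s x (j + 1) = elemSymm s x j * ∑ i ∈ s, p i * x i := by
  induction j with
  | zero =>
    intro s x _
    exact ⟨fun _ => 1, fun _ => zero_le_one, by simp [elemSymm_one], by simp [elemSymm_one]⟩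
  | succ j ih =>
    intro s x hx
    have hex : ∀ i : ι, ∃ p : ι → ℝ, (∀ i, 0 ≤ p i) ∧ (i ∈ s →
        (∀ y : ι → ℝ, (∀ m ≤ j, 0 < elemSymm (s.erase i) y m) →
          elemSymm (s.erase i) y (j + 1) ≤
            elemSymm (s.erase i) y j * ∑ l ∈ s.erase i, p l * y l) ∧
        elemSymm (s.erase i) x (j + 1) =
          elemSymm (s.erase i) x j * ∑ l ∈ s.erase i, p l * x l) := by
      intro i
      by_cases hi : i ∈ s
      · obtain ⟨p, h0, h1, h2⟩ := ih (s.erase i) x (elemSymm_erase_pos hx hi)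
        exact ⟨p, h0, fun _ => ⟨h1, h2⟩⟩
      · exact ⟨fun _ => 0, fun _ => le_rfl, fun h => absurd h hi⟩
    choose p hp0 hp using hex
    -- With s = y_i and t = σ_{j+1}/σ_j of the other variables, the i-th term of Euler's identity
    -- divided by σ_{j+1} is the parallel sum st/(s+t). For s + t > 0 this is the minimum over c of
    -- (1-c)²s + c²t, attained at c = s/(s+t). Freezing c at its optimum for x, and bounding t by
    -- induction, gives a linear bound that is sharp at x.
    set c : ι → ℝ := fun i => x i * elemSymm (s.erase i) x j / elemSymm s x (j + 1) with hc
    set P : ι → ℝ := fun l => (1 / (j + 2 : ℝ)) *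
      ((1 - c l) ^ 2 + ∑ i ∈ s.erase l, c i ^ 2 * p i l) with hP
    have hlin : ∀ y : ι → ℝ, ∑ l ∈ s, P l * y l = (1 / (j + 2 : ℝ)) *
        ∑ i ∈ s, ((1 - c i) ^ 2 * y i + c i ^ 2 * ∑ l ∈ s.erase i, p i l * y l) := by
      intro y
      rw [Finset.sum_add_distrib]
      have hsw : ∑ i ∈ s, c i ^ 2 * ∑ l ∈ s.erase i, p i l * y l =
          ∑ l ∈ s, ∑ i ∈ s.erase l, c i ^ 2 * p i l * y l := by
        simp_rw [Finset.mul_sum]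
        rw [Finset.sum_comm' (t' := s) (s' := fun l => s.erase l)]
        · simp only [mul_assoc]
        · intro a b; simp only [Finset.mem_erase]; tauto
      rw [hsw, ← Finset.sum_add_distrib, Finset.mul_sum]
      refine Finset.sum_congr rfl fun l _ => ?_
      rw [hP]
      simp only [add_mul, mul_assoc, Finset.sum_mul]
    have heuler : ∀ y : ι → ℝ, elemSymm s y (j + 2) = (1 / (j + 2 : ℝ)) *
        ∑ i ∈ s, y i * elemSymm (s.erase i) y (j + 1) := by
      intro y
      rw [sum_mul_elemSymm_erase]
      push_cast
      have : (j + 2 : ℝ) ≠ 0 := by positivity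
      field_simp
      ring
    refine ⟨P, ?_, ?_, ?_⟩
    · intro l
      have : 0 ≤ ∑ i ∈ s.erase l, c i ^ 2 * p i l :=
        Finset.sum_nonneg fun i _ => mul_nonneg (sq_nonneg _) (hp0 i l)
      simp only [hP]
      positivity
    · intro y hy
      rw [heuler, hlin, mul_left_comm]
      refine mul_le_mul_of_nonneg_left ?_ (by positivity)
      rw [Finset.mul_sum]
      refine Finset.sum_le_sum fun i hi => ?_
      have ha := elemSymm_erase_pos hy hi j le_rfl
      have hT := hy (j + 1) le_rfl
      have hb := (hp i hi).1 y (elemSymm_erase_pos hy hi)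
      have hTe := elemSymm_eq_erase hi y j
      set a := elemSymm (s.erase i) y j
      set b := elemSymm (s.erase i) y (j + 1)
      set T := elemSymm s y (j + 1)
      set ℓ := ∑ l ∈ s.erase i, p i l * y l
      -- The difference of the two sides is the square ((1-c_i) y_i a - c_i b)².
      have h1 : a * (y i * b) ≤ T * ((1 - c i) ^ 2 * (y i * a) + c i ^ 2 * b) := by
        rw [hTe]; nlinarith [sq_nonneg ((1 - c i) * (y i * a) - c i * b)]
      have h2 : T * ((1 - c i) ^ 2 * (y i * a) + c i ^ 2 * b) ≤
          a * (T * ((1 - c i) ^ 2 * y i + c i ^ 2 * ℓ)) := by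
        have := mul_le_mul_of_nonneg_left hb (mul_nonneg hT.le (sq_nonneg (c i)))
        linarith
      exact le_of_mul_le_mul_left (h1.trans h2) ha
    · rw [heuler, hlin, mul_left_comm]
      congr 1
      rw [Finset.mul_sum]
      refine Finset.sum_congr rfl fun i hi => ?_
      have ha := elemSymm_erase_pos hx hi j le_rfl
      have hT := hx (j + 1) le_rfl
      have hb := (hp i hi).2
      have hTe := elemSymm_eq_erase hi x j
      have hci : c i * elemSymm s x (j + 1) = x i * elemSymm (s.erase i) x j := by
        simp only [hc]; field_simp
      set a := elemSymm (s.erase i) x j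
      set b := elemSymm (s.erase i) x (j + 1)
      set T := elemSymm s x (j + 1)
      set ℓ := ∑ l ∈ s.erase i, p i l * x l
      have h3 : (1 - c i) * T = b := by linarith
      have h4 : T * a * (T * ((1 - c i) ^ 2 * x i + c i ^ 2 * ℓ)) = T * a * (x i * b) := by
        have : T * a * (T * ((1 - c i) ^ 2 * x i + c i ^ 2 * ℓ)) =
          ((1 - c i) * T) ^ 2 * (x i * a) + (c i * T) ^ 2 * (a * ℓ) := by ring
        rw [this, h3, hci, ← hb, hTe]; ring
      exact (mul_left_cancel₀ (mul_pos hT ha).ne' h4).symm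

end ElemSymm

/-! ### From eigenvalues to Hermitian matrices. -/

section HermitianSigma

variable {n : ℕ}

/-- The lower bound on the total weight is the supporting inequality at the all-ones vector, where
σ_{j+1}/σ_j = (n-j)/(j+1) ≥ 1/n. -/
theorem exists_elemSymm_supergradient_univ {j : ℕ} (hj : j < n) {x : Fin n → ℝ}
    (hx : ∀ m ≤ j, 0 < elemSymm Finset.univ x m) :
    ∃ p : Fin n → ℝ, (∀ i, 0 ≤ p i) ∧ 1 / (n : ℝ) ≤ ∑ i, p i ∧
      (∀ y : Fin n → ℝ, (∀ m ≤ j, 0 < elemSymm Finset.univ y m) →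
        elemSymm Finset.univ y (j + 1) ≤ elemSymm Finset.univ y j * ∑ i, p i * y i) ∧
      elemSymm Finset.univ x (j + 1) = elemSymm Finset.univ x j * ∑ i, p i * x i := by
  obtain ⟨p, hp0, hp1, hp2⟩ := exists_elemSymm_supergradient j Finset.univ x hx
  refine ⟨p, hp0, ?_, hp1, hp2⟩
  have hone : ∀ m, elemSymm (Finset.univ : Finset (Fin n)) (fun _ => 1) m = n.choose m := by
    intro m; simp [elemSymm]
  have h := hp1 (fun _ => 1) fun m hm => by
    rw [hone]; exact_mod_cast Nat.choose_pos (by omega)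
  simp only [hone, mul_one] at h
  have hc : (0 : ℝ) < n.choose j := by exact_mod_cast Nat.choose_pos hj.le
  have h1 : (n.choose (j + 1) : ℝ) * (j + 1) = n.choose j * ((n : ℝ) - j) := by
    have := Nat.choose_succ_right_eq n j
    rw [← Nat.cast_sub hj.le]; exact_mod_cast this
  have hjn : (j : ℝ) + 1 ≤ n := by exact_mod_cast hj
  have h2 : (n : ℝ) - j ≤ (j + 1) * ∑ i, p i := by
    have : (n.choose j : ℝ) * ((n : ℝ) - j) ≤ n.choose j * ((j + 1) * ∑ i, p i) := by
      rw [← h1]; nlinarith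
    exact le_of_mul_le_mul_left this hc
  have hs : 0 ≤ ∑ i, p i := Finset.sum_nonneg fun i _ => hp0 i
  have hn : (0 : ℝ) < n := by exact_mod_cast (by omega : 0 < n)
  rw [div_le_iff₀ hn]
  nlinarith

theorem esymm_roots_charpoly_eq {A : Matrix (Fin n) (Fin n) ℂ} (hA : A.IsHermitian) (m : ℕ) :
    (A.charpoly.roots.map Complex.re).esymm m = elemSymm Finset.univ hA.eigenvalues m := by
  rw [hA.roots_charpoly_eq_eigenvalues, elemSymm_eq_esymm, Multiset.map_map]
  congr 1

theorem elemSymm_comp_perm (x : Fin n → ℝ) (τ : Equiv.Perm (Fin n)) (m : ℕ) :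
    elemSymm Finset.univ (x ∘ τ) m = elemSymm Finset.univ x m := by
  rw [elemSymm_eq_esymm, elemSymm_eq_esymm, ← Multiset.map_map]
  congr 2
  simp

/-- The Hermitian form of a matrix, as a real number. -/
noncomputable def hermForm (A : Matrix (Fin n) (Fin n) ℂ) (v : CSpace n) : ℝ :=
  (inner ℂ v (A.toEuclideanLin v)).re

theorem hermForm_eq_sum {A : Matrix (Fin n) (Fin n) ℂ} (hA : A.IsHermitian) (v : CSpace n) :
    hermForm A v = ∑ l, ‖inner ℂ (hA.eigenvectorBasis l) v‖ ^ 2 * hA.eigenvalues l := by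
  have hsym := Matrix.isSymmetric_toEuclideanLin_iff.mpr hA
  have he : ∀ l, A.toEuclideanLin (hA.eigenvectorBasis l) =
      (hA.eigenvalues l : ℂ) • hA.eigenvectorBasis l := by
    intro l
    have := hA.mulVec_eigenvectorBasis l
    ext i
    simpa [Matrix.toLpLin_apply] using congrFun this i
  unfold hermForm
  rw [← hA.eigenvectorBasis.sum_inner_mul_inner, Complex.re_sum]
  refine Finset.sum_congr rfl fun l _ => ?_
  rw [← hsym, he, inner_smul_left, Complex.conj_ofReal, mul_left_comm, Complex.re_ofReal_mul]
  have := inner_mul_symm_re_eq_norm (𝕜 := ℂ) v (hA.eigenvectorBasis l)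
  simp only [RCLike.re_to_complex] at this
  rw [this, norm_mul, norm_inner_symm]
  ring

/-- In an eigenbasis of A₀ the diagonal of any Hermitian A is a doubly stochastic matrix applied to
its eigenvalues, hence by Birkhoff an average of permutations of them. The eigenvalue inequality
holds for each permutation, since σ_j is symmetric, and survives averaging. The basis is chosen
before j, so functionals for different j can later be added. -/
theorem exists_hermForm_supergradient {k : ℕ} (hk : k ≤ n) {A₀ : Matrix (Fin n) (Fin n) ℂ}
    (hA₀ : A₀.IsHermitian)
    (h₀ : ∀ m ≤ k, 0 < (A₀.charpoly.roots.map Complex.re).esymm m) :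
    ∃ b : OrthonormalBasis (Fin n) ℂ (CSpace n), ∀ j < k, ∃ p : Fin n → ℝ,
      (∀ i, 0 ≤ p i) ∧ 1 / (n : ℝ) ≤ ∑ i, p i ∧
      (∀ A : Matrix (Fin n) (Fin n) ℂ, A.IsHermitian →
        (∀ m ≤ k, 0 < (A.charpoly.roots.map Complex.re).esymm m) →
        (A.charpoly.roots.map Complex.re).esymm (j + 1) ≤
          (A.charpoly.roots.map Complex.re).esymm j * ∑ i, p i * hermForm A (b i)) ∧
      (A₀.charpoly.roots.map Complex.re).esymm (j + 1) =
          (A₀.charpoly.roots.map Complex.re).esymm j * ∑ i, p i * hermForm A₀ (b i) := by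
  refine ⟨hA₀.eigenvectorBasis, fun j hj => ?_⟩
  simp only [esymm_roots_charpoly_eq hA₀] at h₀ ⊢
  obtain ⟨p, hp0, hpn, hp1, hp2⟩ := exists_elemSymm_supergradient_univ (n := n) (j := j)
    (by omega) (x := hA₀.eigenvalues) fun m hm => h₀ m (by omega)
  refine ⟨p, hp0, hpn, ?_, ?_⟩
  · intro A hA hpos
    simp only [esymm_roots_charpoly_eq hA] at hpos ⊢
    set D : Matrix (Fin n) (Fin n) ℝ := Matrix.of fun i l =>
      ‖inner ℂ (hA.eigenvectorBasis l) (hA₀.eigenvectorBasis i)‖ ^ 2 with hD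
    have hDs : D ∈ doublyStochastic ℝ (Fin n) := by
      rw [mem_doublyStochastic_iff_sum]
      refine ⟨fun i l => sq_nonneg _, fun i => ?_, fun l => ?_⟩
      · simp only [hD, Matrix.of_apply]
        rw [OrthonormalBasis.sum_sq_norm_inner_right]; simp
      · simp only [hD, Matrix.of_apply]
        rw [OrthonormalBasis.sum_sq_norm_inner_left]; simp
    obtain ⟨w, hw0, hw1, hw⟩ := exists_eq_sum_perm_of_mem_doublyStochastic hDs
    have hform : ∀ i, hermForm A (hA₀.eigenvectorBasis i) =
        ∑ τ, w τ * hA.eigenvalues (τ i) := by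
      intro i
      rw [hermForm_eq_sum hA]
      have : ∀ l, ‖inner ℂ (hA.eigenvectorBasis l) (hA₀.eigenvectorBasis i)‖ ^ 2 =
          ∑ τ : Equiv.Perm (Fin n), w τ * (if τ i = l then 1 else 0) := by
        intro l
        have h := congrFun (congrFun hw i) l
        simp only [hD, Matrix.of_apply, Matrix.sum_apply, Matrix.smul_apply, smul_eq_mul] at h
        rw [← h]
        refine Finset.sum_congr rfl fun τ _ => ?_
        simp [Equiv.toPEquiv_apply, eq_comm]
      simp only [this, Finset.sum_mul]
      rw [Finset.sum_comm]
      refine Finset.sum_congr rfl fun τ _ => ?_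
      simp
    have hpt : ∀ τ : Equiv.Perm (Fin n), elemSymm Finset.univ hA.eigenvalues (j + 1) ≤
        elemSymm Finset.univ hA.eigenvalues j * ∑ i, p i * hA.eigenvalues (τ i) := by
      intro τ
      have := hp1 (hA.eigenvalues ∘ τ) fun m hm => by
        rw [elemSymm_comp_perm]; exact hpos m (by omega)
      simpa only [elemSymm_comp_perm, Function.comp_apply] using this
    calc elemSymm Finset.univ hA.eigenvalues (j + 1)
        = ∑ τ, w τ * elemSymm Finset.univ hA.eigenvalues (j + 1) := by
          rw [← Finset.sum_mul, hw1, one_mul]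
      _ ≤ ∑ τ, w τ * (elemSymm Finset.univ hA.eigenvalues j *
            ∑ i, p i * hA.eigenvalues (τ i)) :=
          Finset.sum_le_sum fun τ _ => mul_le_mul_of_nonneg_left (hpt τ) (hw0 τ)
      _ = _ := by
          simp only [hform, Finset.mul_sum]
          rw [Finset.sum_comm]
          refine Finset.sum_congr rfl fun i _ => Finset.sum_congr rfl fun τ _ => ?_
          ring
  · rw [hp2]
    congr 1
    refine Finset.sum_congr rfl fun i _ => ?_
    rw [hermForm_eq_sum hA₀, Finset.sum_eq_single i]
    · simp
    · intro l _ hl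
      simp [hl]
    · simp

end HermitianSigma

/-! ### Iterated directional derivatives. -/

/-- The directional derivative of `f` in the direction `e`, as a function. -/
noncomputable def dirD {E : Type*} [NormedAddCommGroup E] [NormedSpace ℝ E] (e : E) (f : E → ℝ) :
    E → ℝ := fun x => fderiv ℝ f x e

section DirD

variable {E : Type*} [NormedAddCommGroup E] [NormedSpace ℝ E] {Ω : Set E} {f g : E → ℝ}

theorem ContDiffOn.dirD {m : WithTop ℕ∞} {k : WithTop ℕ∞} (hf : ContDiffOn ℝ k f Ω)
    (hΩ : IsOpen Ω) (hmk : m + 1 ≤ k) (e : E) : ContDiffOn ℝ m (dirD e f) Ω :=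
  (hf.fderiv_of_isOpen hΩ hmk).clm_apply contDiffOn_const

theorem Set.EqOn.dirD (h : Set.EqOn f g Ω) (hΩ : IsOpen Ω) (e : E) :
    Set.EqOn (dirD e f) (dirD e g) Ω := fun x hx => by
  unfold _root_.dirD
  rw [(h.eventuallyEq_of_mem (hΩ.mem_nhds hx)).fderiv_eq]

theorem dirD_eq_iterated {x : E} (hf : ContDiffOn ℝ 2 f Ω) (hΩ : IsOpen Ω) (hx : x ∈ Ω) (a b : E) :
    dirD a (dirD b f) x = fderiv ℝ (fderiv ℝ f) x a b := by
  have h1 : DifferentiableAt ℝ (fderiv ℝ f) x :=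
    ((hf.fderiv_of_isOpen hΩ (m := 1) (by norm_num)).differentiableOn (by norm_num)).differentiableAt
      (hΩ.mem_nhds hx)
  unfold dirD
  rw [fderiv_clm_apply h1 (differentiableAt_const b)]
  simp

theorem dirD_comm (hf : ContDiffOn ℝ 2 f Ω) (hΩ : IsOpen Ω) (a b : E) :
    Set.EqOn (dirD a (dirD b f)) (dirD b (dirD a f)) Ω := by
  intro x hx
  rw [dirD_eq_iterated hf hΩ hx, dirD_eq_iterated hf hΩ hx]
  exact ((hf.contDiffAt (hΩ.mem_nhds hx)).isSymmSndFDerivAt (by simp)) a b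

end DirD

/-! ### The complex Hessian through real second derivatives. -/

section ComplexHessian

variable {n : ℕ} {Ω : Set (CSpace n)} {u : CSpace n → ℝ}

theorem hasFDerivAt_ofReal_comp {f : CSpace n → ℝ} {x : CSpace n} (hf : DifferentiableAt ℝ f x) :
    HasFDerivAt (fun y => (f y : ℂ)) (Complex.ofRealCLM.comp (fderiv ℝ f x)) x :=
  Complex.ofRealCLM.hasFDerivAt.comp x hf.hasFDerivAt

theorem complexHessian_apply (hΩ : IsOpen Ω) (hu : ContDiffOn ℝ 2 u Ω) {z : CSpace n} (hz : z ∈ Ω)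
    (a b : Fin n) :
    complexHessian u z a b = (1 / 4) *
      ((dirD (coordVec a) (dirD (coordVec b) u) z +
        dirD (Complex.I • coordVec a) (dirD (Complex.I • coordVec b) u) z : ℝ) +
       Complex.I * (dirD (coordVec a) (dirD (Complex.I • coordVec b) u) z -
        dirD (Complex.I • coordVec a) (dirD (coordVec b) u) z : ℝ)) := by
  have hd : ∀ e : CSpace n, ∀ y ∈ Ω, DifferentiableAt ℝ (dirD e u) y := fun e y hy =>
    ((hu.dirD hΩ (m := 1) (by norm_num) e).differentiableOn (by norm_num)).differentiableAt
      (hΩ.mem_nhds hy)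
  have hbar : (wirtingerBar b fun w => (u w : ℂ)) =ᶠ[nhds z] fun y =>
      (1 / 2 : ℂ) • ((dirD (coordVec b) u y : ℂ) +
        Complex.I • (dirD (Complex.I • coordVec b) u y : ℂ)) := by
    filter_upwards [hΩ.mem_nhds hz] with y hy
    have := (hasFDerivAt_ofReal_comp
      ((hu.differentiableOn (by norm_num)).differentiableAt (hΩ.mem_nhds hy))).fderiv
    simp [wirtingerBar, this, dirD]
  have hder := (((hasFDerivAt_ofReal_comp (hd (coordVec b) z hz)).add
    ((hasFDerivAt_ofReal_comp (hd (Complex.I • coordVec b) z hz)).const_smul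
      Complex.I)).const_smul (1 / 2 : ℂ))
  have hfd := (hder.congr_of_eventuallyEq hbar).fderiv
  simp only [complexHessian, Matrix.of_apply, wirtinger, hfd]
  have hdd : ∀ (f : CSpace n → ℝ) (e : CSpace n), fderiv ℝ f z e = dirD e f z := fun _ _ => rfl
  simp only [_root_.add_apply, _root_.smul_apply, ContinuousLinearMap.comp_apply,
    Complex.ofRealCLM_apply, smul_eq_mul, hdd, Complex.ofReal_add, Complex.ofReal_sub]
  linear_combination (-1 / 4 : ℂ) * (dirD (Complex.I • coordVec a)
    (dirD (Complex.I • coordVec b) u) z) * Complex.I_mul_I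

theorem complexHessian_isHermitian (hΩ : IsOpen Ω) (hu : ContDiffOn ℝ 2 u Ω) {z : CSpace n}
    (hz : z ∈ Ω) : (complexHessian u z).IsHermitian := by
  ext a b
  rw [Matrix.conjTranspose_apply, complexHessian_apply hΩ hu hz, complexHessian_apply hΩ hu hz,
    dirD_comm hu hΩ (coordVec b) (coordVec a) hz,
    dirD_comm hu hΩ (Complex.I • coordVec b) (Complex.I • coordVec a) hz,
    dirD_comm hu hΩ (coordVec b) (Complex.I • coordVec a) hz,
    dirD_comm hu hΩ (Complex.I • coordVec b) (coordVec a) hz]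
  simp only [Complex.ofReal_add, Complex.ofReal_sub, RCLike.star_def, map_mul, map_add, map_sub,
    Complex.conj_ofReal, Complex.conj_I, map_div₀, map_one, map_ofNat]
  ring

/-- The sesquilinear form `H(v, w)` that is complex linear in `v`, conjugate linear in `w` and
satisfies `H(v, v) = B(v, v) + B(√-1 v, √-1 v)` if `B` is symmetric. -/
noncomputable def leviForm (B : CSpace n →L[ℝ] CSpace n →L[ℝ] ℝ) (v w : CSpace n) : ℂ :=
  (B v w + B (Complex.I • v) (Complex.I • w) : ℝ) +
    Complex.I * (B v (Complex.I • w) - B (Complex.I • v) w : ℝ)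

theorem complex_smul_eq (c : ℂ) (v : CSpace n) : c • v = c.re • v + c.im • (Complex.I • v) := by
  conv_lhs => rw [← Complex.re_add_im c, add_smul, mul_smul, Complex.coe_smul, Complex.coe_smul]

theorem I_smul_I_smul (v : CSpace n) : Complex.I • (Complex.I • v) = -v := by
  rw [smul_smul, Complex.I_mul_I, neg_one_smul]

theorem leviForm_sum_left (B : CSpace n →L[ℝ] CSpace n →L[ℝ] ℝ) (c : Fin n → ℂ)
    (e : Fin n → CSpace n) (w : CSpace n) :
    leviForm B (∑ a, c a • e a) w = ∑ a, c a * leviForm B (e a) w := by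
  let H : CSpace n →ₗ[ℂ] ℂ :=
    { toFun := fun v => leviForm B v w
      map_add' := by
        intro v v'
        simp only [leviForm, smul_add, map_add, _root_.add_apply]
        push_cast; ring
      map_smul' := by
        intro c v
        simp only [leviForm, RingHom.id_apply, smul_eq_mul]
        rw [smul_comm Complex.I c v, complex_smul_eq c v, complex_smul_eq c (Complex.I • v),
          I_smul_I_smul]
        simp only [map_add, map_smul, map_neg, smul_neg, _root_.add_apply,
          _root_.smul_apply, _root_.neg_apply, smul_eq_mul]
        conv_rhs => rw [← Complex.re_add_im c]
        push_cast
        linear_combination (-(c.im : ℂ) * (B v (Complex.I • w) - B (Complex.I • v) w)) *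
          Complex.I_mul_I }
  have := map_sum H (fun a => c a • e a) Finset.univ
  simp only [map_smul, smul_eq_mul] at this
  exact this

theorem leviForm_conj (B : CSpace n →L[ℝ] CSpace n →L[ℝ] ℝ) (hB : ∀ v w, B v w = B w v)
    (v w : CSpace n) : leviForm B w v = (starRingEnd ℂ) (leviForm B v w) := by
  simp only [leviForm, map_add, map_mul, Complex.conj_ofReal, Complex.conj_I]
  rw [hB w v, hB (Complex.I • w), hB w, hB (Complex.I • w)]
  push_cast; ring

theorem leviForm_self (B : CSpace n →L[ℝ] CSpace n →L[ℝ] ℝ) (hB : ∀ v w, B v w = B w v)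
    (v : CSpace n) :
    leviForm B v v = (B v v + B (Complex.I • v) (Complex.I • v) : ℝ) := by
  rw [leviForm, hB v (Complex.I • v), sub_self]; simp

theorem leviForm_sum_sum (B : CSpace n →L[ℝ] CSpace n →L[ℝ] ℝ) (hB : ∀ v w, B v w = B w v)
    (c : Fin n → ℂ) (e : Fin n → CSpace n) :
    leviForm B (∑ a, c a • e a) (∑ a, c a • e a) =
      ∑ a, ∑ b, c a * (starRingEnd ℂ) (c b) * leviForm B (e a) (e b) := by
  rw [leviForm_sum_left]
  refine Finset.sum_congr rfl fun a _ => ?_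
  rw [leviForm_conj B hB, leviForm_sum_left, map_sum, Finset.mul_sum]
  refine Finset.sum_congr rfl fun b _ => ?_
  rw [map_mul, ← leviForm_conj B hB]; ring

/-- The vector with conjugate coordinates. -/
noncomputable def conjVec (v : CSpace n) : CSpace n :=
  WithLp.toLp 2 fun a => (starRingEnd ℂ) (v a)

theorem norm_conjVec (v : CSpace n) : ‖conjVec v‖ = ‖v‖ := by
  simp [EuclideanSpace.norm_eq, conjVec]

theorem sum_smul_coordVec (v : CSpace n) : ∑ a, v a • coordVec a = v := by
  ext b
  simp [coordVec, Pi.single_apply]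

/-- `1/4 (D²u(w, w) + D²u(√-1 w, √-1 w))`, the value of the Levi form of `u` in the direction `w`. -/
noncomputable def leviD (u : CSpace n → ℝ) (w : CSpace n) (z : CSpace n) : ℝ :=
  (1 / 4) * (dirD w (dirD w u) z + dirD (Complex.I • w) (dirD (Complex.I • w) u) z)

/-- The entry (a, b) is ∂_a ∂̄_b u, linear in the first index, whereas the Hermitian form v*Av
conjugates the first factor. This is why the direction is conjugated. -/
theorem hermForm_complexHessian (hΩ : IsOpen Ω) (hu : ContDiffOn ℝ 2 u Ω) {z : CSpace n}
    (hz : z ∈ Ω) (v : CSpace n) :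
    hermForm (complexHessian u z) v = leviD u (conjVec v) z := by
  set B := fderiv ℝ (fderiv ℝ u) z with hBdef
  have hB : ∀ v w, B v w = B w v := fun v w => by
    rw [hBdef, ← dirD_eq_iterated hu hΩ hz, ← dirD_eq_iterated hu hΩ hz, dirD_comm hu hΩ v w hz]
  have hent : ∀ a b, complexHessian u z a b = (1 / 4) * leviForm B (coordVec a) (coordVec b) := by
    intro a b
    rw [complexHessian_apply hΩ hu hz]
    simp only [dirD_eq_iterated hu hΩ hz, leviForm, hBdef]
  have h1 : leviForm B (conjVec v) (conjVec v) =
      ∑ a, ∑ b, conjVec v a * (starRingEnd ℂ) (conjVec v b) *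
        leviForm B (coordVec a) (coordVec b) := by
    rw [← leviForm_sum_sum B hB, sum_smul_coordVec]
  have h2 : inner ℂ v ((complexHessian u z).toEuclideanLin v) =
      (1 / 4) * leviForm B (conjVec v) (conjVec v) := by
    rw [h1, PiLp.inner_apply, Finset.mul_sum]
    refine Finset.sum_congr rfl fun a _ => ?_
    simp only [Matrix.toLpLin_apply, Matrix.mulVec, dotProduct, RCLike.inner_apply, hent, conjVec,
      Complex.conj_conj, Finset.mul_sum, Finset.sum_mul]
    refine Finset.sum_congr rfl fun b _ => ?_
    ring
  rw [hermForm, h2, leviForm_self B hB, leviD, dirD_eq_iterated hu hΩ hz,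
    dirD_eq_iterated hu hΩ hz]
  have : (1 / 4 : ℂ) = ((1 / 4 : ℝ) : ℂ) := by push_cast; rfl
  rw [this, ← Complex.ofReal_mul, Complex.ofReal_re]

theorem hessianSigma_zero (u : CSpace n → ℝ) (z : CSpace n) : hessianSigma 0 u z = 1 := by
  simp [hessianSigma, Multiset.esymm]

theorem hessianSigma_pos {k : ℕ} (hadm : IsAdmissible k Ω u) {z : CSpace n} (hz : z ∈ Ω) :
    ∀ m ≤ k, 0 < hessianSigma m u z := by
  intro m hm
  rcases Nat.eq_zero_or_pos m with rfl | h
  · rw [hessianSigma_zero]; exact one_pos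
  · exact hadm z hz m h hm

theorem hessianSigma_newton (hΩ : IsOpen Ω) (hu : ContDiffOn ℝ 2 u Ω) {z : CSpace n}
    (hz : z ∈ Ω) (j : ℕ) :
    hessianSigma j u z * hessianSigma (j + 2) u z ≤ hessianSigma (j + 1) u z ^ 2 := by
  have hA := complexHessian_isHermitian hΩ hu hz
  simp only [hessianSigma, hessianEigenvalues, esymm_roots_charpoly_eq hA]
  exact elemSymm_mul_elemSymm_le_sq _ _ _

theorem hessianSigma_one (hΩ : IsOpen Ω) (hu : ContDiffOn ℝ 2 u Ω) {z : CSpace n}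
    (hz : z ∈ Ω) : hessianSigma 1 u z = ∑ a, leviD u (coordVec a) z := by
  have hA := complexHessian_isHermitian hΩ hu hz
  simp only [hessianSigma, hessianEigenvalues, esymm_roots_charpoly_eq hA, elemSymm_one]
  have h := hA.trace_eq_sum_eigenvalues
  rw [Matrix.trace] at h
  have h' := congrArg Complex.re h
  rw [Complex.re_sum, Complex.re_sum] at h'
  simp only [Complex.coe_algebraMap, Complex.ofReal_re] at h'
  rw [← h']
  refine Finset.sum_congr rfl fun a _ => ?_
  rw [Matrix.diag_apply, complexHessian_apply hΩ hu hz,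
    dirD_comm hu hΩ (coordVec a) (Complex.I • coordVec a) hz, sub_self, leviD]
  have : (1 / 4 : ℂ) = ((1 / 4 : ℝ) : ℂ) := by push_cast; rfl
  rw [this, Complex.ofReal_zero, mul_zero, add_zero, ← Complex.ofReal_mul, Complex.ofReal_re]

/-- The directions depend on z₀ alone, not on j, and the inequality holds at every point of Ω with
coefficients frozen at z₀. Both sides can therefore be compared as functions of z. -/
theorem exists_leviD_supergradient {k : ℕ} (hk : k ≤ n) (hΩ : IsOpen Ω) (hu : ContDiffOn ℝ 2 u Ω)
    (hadm : IsAdmissible k Ω u) {z₀ : CSpace n} (hz₀ : z₀ ∈ Ω) :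
    ∃ w : Fin n → CSpace n, (∀ i, ‖w i‖ = 1) ∧ ∃ p : ℕ → Fin n → ℝ, ∀ j < k,
      (∀ i, 0 ≤ p j i) ∧ 1 / (n : ℝ) ≤ ∑ i, p j i ∧
      (∀ z ∈ Ω, hessianSigma (j + 1) u z ≤ hessianSigma j u z * ∑ i, p j i * leviD u (w i) z) ∧
      hessianSigma (j + 1) u z₀ = hessianSigma j u z₀ * ∑ i, p j i * leviD u (w i) z₀ := by
  obtain ⟨b, hb⟩ := exists_hermForm_supergradient hk (complexHessian_isHermitian hΩ hu hz₀)
    (hessianSigma_pos hadm hz₀)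
  refine ⟨fun i => conjVec (b i), fun i => by rw [norm_conjVec]; simp, ?_⟩
  have hb' : ∀ j, ∃ p : Fin n → ℝ, j < k → (∀ i, 0 ≤ p i) ∧ 1 / (n : ℝ) ≤ ∑ i, p i ∧
      (∀ z ∈ Ω, hessianSigma (j + 1) u z ≤
        hessianSigma j u z * ∑ i, p i * leviD u (conjVec (b i)) z) ∧
      hessianSigma (j + 1) u z₀ =
        hessianSigma j u z₀ * ∑ i, p i * leviD u (conjVec (b i)) z₀ := by
    intro j
    by_cases hj : j < k
    · obtain ⟨p, h0, h1, h2, h3⟩ := hb j hj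
      refine ⟨p, fun _ => ⟨h0, h1, fun z hz => ?_, ?_⟩⟩
      · have := h2 _ (complexHessian_isHermitian hΩ hu hz) (hessianSigma_pos hadm hz)
        simp only [hermForm_complexHessian hΩ hu hz] at this
        exact this
      · simp only [hermForm_complexHessian hΩ hu hz₀] at h3
        exact h3
    · exact ⟨fun _ => 0, fun h => absurd h hj⟩
  choose p hp using hb'
  exact ⟨p, hp⟩

end ComplexHessian

/-! ### Second-order jets and derivative tests along lines. -/

/-- `g` has first derivative `a` and second derivative `b` at `0`. -/
def HasJet (g : ℝ → ℝ) (a b : ℝ) : Prop :=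
  ∃ g' : ℝ → ℝ, (∀ᶠ t in 𝓝 0, HasDerivAt g (g' t) t) ∧ g' 0 = a ∧ HasDerivAt g' b 0

namespace HasJet

variable {f g : ℝ → ℝ} {a b a' b' : ℝ}

theorem const (c : ℝ) : HasJet (fun _ => c) 0 0 :=
  ⟨fun _ => 0, Eventually.of_forall fun t => hasDerivAt_const t c, rfl, hasDerivAt_const 0 0⟩

theorem id : HasJet (fun t => t) 1 0 :=
  ⟨fun _ => 1, Eventually.of_forall fun t => hasDerivAt_id t, rfl, hasDerivAt_const 0 1⟩

theorem add (hf : HasJet f a b) (hg : HasJet g a' b') :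
    HasJet (fun t => f t + g t) (a + a') (b + b') := by
  obtain ⟨f', hf1, hf2, hf3⟩ := hf
  obtain ⟨g', hg1, hg2, hg3⟩ := hg
  refine ⟨fun t => f' t + g' t, ?_, by simp [hf2, hg2], hf3.add hg3⟩
  filter_upwards [hf1, hg1] with t h1 h2 using h1.add h2

theorem mul (hf : HasJet f a b) (hg : HasJet g a' b') :
    HasJet (fun t => f t * g t) (a * g 0 + f 0 * a') (b * g 0 + 2 * (a * a') + f 0 * b') := by
  obtain ⟨f', hf1, hf2, hf3⟩ := hf
  obtain ⟨g', hg1, hg2, hg3⟩ := hg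
  refine ⟨fun t => f' t * g t + f t * g' t, ?_, by simp [hf2, hg2], ?_⟩
  · filter_upwards [hf1, hg1] with t h1 h2 using h1.mul h2
  · convert! (hf3.mul hg1.self_of_nhds).add (hf1.self_of_nhds.mul hg3) using 1
    rw [hf2, hg2]; ring

theorem congr_val (hf : HasJet f a b) (ha : a = a') (hb : b = b') : HasJet f a' b' := by
  rwa [← ha, ← hb]

theorem const_mul (c : ℝ) (hf : HasJet f a b) : HasJet (fun t => c * f t) (c * a) (c * b) :=
  ((const c).mul hf).congr_val (by ring) (by ring)

theorem neg (hf : HasJet f a b) : HasJet (fun t => -f t) (-a) (-b) := by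
  have := hf.const_mul (-1)
  simpa using this

theorem sub (hf : HasJet f a b) (hg : HasJet g a' b') :
    HasJet (fun t => f t - g t) (a - a') (b - b') := by
  have := hf.add hg.neg
  simpa [sub_eq_add_neg] using this

theorem sum {ι : Type*} {s : Finset ι} {F : ι → ℝ → ℝ} {A B : ι → ℝ}
    (h : ∀ i ∈ s, HasJet (F i) (A i) (B i)) :
    HasJet (fun t => ∑ i ∈ s, F i t) (∑ i ∈ s, A i) (∑ i ∈ s, B i) := by
  classical
  induction s using Finset.induction_on with
  | empty => simpa using const 0
  | insert i s hi ih =>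
    simp only [Finset.sum_insert hi]
    exact (h i (Finset.mem_insert_self _ _)).add
      (ih fun j hj => h j (Finset.mem_insert_of_mem hj))

theorem exp (hf : HasJet f a b) :
    HasJet (fun t => Real.exp (f t)) (Real.exp (f 0) * a) (Real.exp (f 0) * (a ^ 2 + b)) := by
  obtain ⟨f', hf1, hf2, hf3⟩ := hf
  refine ⟨fun t => Real.exp (f t) * f' t, ?_, by simp [hf2], ?_⟩
  · filter_upwards [hf1] with t h1 using h1.exp
  · convert! hf1.self_of_nhds.exp.mul hf3 using 1
    rw [hf2]; ring

theorem congr (hf : HasJet f a b) (h : g =ᶠ[𝓝 0] f) : HasJet g a b := by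
  obtain ⟨f', hf1, hf2, hf3⟩ := hf
  refine ⟨f', ?_, hf2, hf3⟩
  filter_upwards [hf1, h.eventuallyEq_nhds] with t h1 h2 using h1.congr_of_eventuallyEq h2

theorem of_isLocalMin (hf : HasJet f a b) (h : IsLocalMin f 0) : a = 0 ∧ 0 ≤ b := by
  obtain ⟨f', hf1, hf2, hf3⟩ := hf
  have ha : a = 0 := by rw [← hf2]; exact h.hasDerivAt_eq_zero hf1.self_of_nhds
  refine ⟨ha, ?_⟩
  by_contra! hb
  -- If the second derivative were negative, the first would be negative just to the right of 0, and
  -- the mean value theorem would contradict minimality.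
  have hlt : ∀ᶠ t in 𝓝[>] (0 : ℝ), f' t < 0 := by
    have h1 := (hasDerivAt_iff_tendsto_slope.1 hf3).mono_left
      (nhdsWithin_mono 0 (fun t (ht : 0 < t) => ht.ne'))
    filter_upwards [h1.eventually (gt_mem_nhds hb), self_mem_nhdsWithin] with t ht htp
    rw [slope_def_field, hf2, ha, sub_zero, sub_zero] at ht
    have htp' : (0 : ℝ) < t := htp
    by_contra! hc
    exact absurd ht (not_lt.2 (div_nonneg hc htp'.le))
  obtain ⟨r, hr, hr'⟩ := mem_nhdsGT_iff_exists_Ioo_subset.1 hlt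
  obtain ⟨δ, hδ, hδ'⟩ := Metric.eventually_nhds_iff.1 (hf1.and h)
  set s := min r δ / 2 with hs
  have hr0 : (0 : ℝ) < r := hr
  have hs0 : 0 < s := by positivity
  have hsr : s < r := by have := min_le_left r δ; linarith
  have hsδ : s < δ := by have := min_le_right r δ; linarith
  have hd : ∀ t ∈ Set.Icc 0 s, HasDerivAt f (f' t) t := fun t ht => (hδ' (by
    rw [Real.dist_eq, sub_zero, abs_of_nonneg ht.1]; linarith [ht.2])).1
  obtain ⟨c, hc, hc'⟩ := exists_hasDerivAt_eq_slope f f' hs0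
    (fun t ht => (hd t ht).continuousAt.continuousWithinAt)
    (fun t ht => hd t ⟨ht.1.le, ht.2.le⟩)
  have h1 : f' c < 0 := hr' ⟨hc.1, hc.2.trans hsr⟩
  have h2 : f 0 ≤ f s := (hδ' (by
    rw [Real.dist_eq, sub_zero, abs_of_nonneg hs0.le]; exact hsδ)).2
  rw [hc'] at h1
  exact absurd h1 (not_lt.2 (div_nonneg (by linarith) (by linarith)))

theorem of_isLocalMax (hf : HasJet f a b) (h : IsLocalMax f 0) : a = 0 ∧ b ≤ 0 := by
  have := hf.neg.of_isLocalMin h.neg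
  constructor <;> linarith [this.1, this.2]

end HasJet

section HasJetDirD

variable {E : Type*} [NormedAddCommGroup E] [NormedSpace ℝ E] {Ω : Set E} {f : E → ℝ}

theorem hasDerivAt_line (x e : E) (t : ℝ) : HasDerivAt (fun t : ℝ => x + t • e) e t := by
  simpa using ((hasDerivAt_id t).smul_const e).const_add x

theorem hasJet_of_contDiffOn (hΩ : IsOpen Ω) (hf : ContDiffOn ℝ 2 f Ω) {x : E} (hx : x ∈ Ω)
    (e : E) :
    HasJet (fun t => f (x + t • e)) (dirD e f x) (dirD e (dirD e f) x) := by
  have hline : ∀ g : E → ℝ, DifferentiableOn ℝ g Ω → ∀ t : ℝ, x + t • e ∈ Ω →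
      HasDerivAt (fun t : ℝ => g (x + t • e)) (dirD e g (x + t • e)) t := fun g hg t ht =>
    ((hg.differentiableAt (hΩ.mem_nhds ht)).hasFDerivAt).comp_hasDerivAt t (hasDerivAt_line x e t)
  have hmem : ∀ᶠ t : ℝ in 𝓝 0, x + t • e ∈ Ω := by
    have : Tendsto (fun t : ℝ => x + t • e) (𝓝 0) (𝓝 x) := by
      have := (hasDerivAt_line x e 0).continuousAt.tendsto
      simpa using this
    exact this.eventually (hΩ.mem_nhds hx)
  refine ⟨fun t => dirD e f (x + t • e), ?_, by simp, ?_⟩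
  · filter_upwards [hmem] with t ht using hline f (hf.differentiableOn (by norm_num)) t ht
  · have := hline (dirD e f) ((hf.dirD hΩ (m := 1) (by norm_num) e).differentiableOn
      (by norm_num)) 0 (by simpa using hx)
    simpa using this

theorem isLocalMin_line {x : E} (h : IsLocalMin f x) (e : E) :
    IsLocalMin (fun t : ℝ => f (x + t • e)) 0 := by
  have hc : ContinuousAt (fun t : ℝ => x + t • e) 0 := (hasDerivAt_line x e 0).continuousAt
  have h' : IsLocalMin f ((fun t : ℝ => x + t • e) 0) := by simpa using h
  exact h'.comp_continuous (g := fun t : ℝ => x + t • e) (b := (0 : ℝ)) hc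

theorem isLocalMax_line {x : E} (h : IsLocalMax f x) (e : E) :
    IsLocalMax (fun t : ℝ => f (x + t • e)) 0 := by
  have hc : ContinuousAt (fun t : ℝ => x + t • e) 0 := (hasDerivAt_line x e 0).continuousAt
  have h' : IsLocalMax f ((fun t : ℝ => x + t • e) 0) := by simpa using h
  exact h'.comp_continuous (g := fun t : ℝ => x + t • e) (b := (0 : ℝ)) hc

end HasJetDirD

/-! ### The linearized equation, obtained from a touching function. -/

section Linearization

variable {n k : ℕ} {Ω : Set (CSpace n)} {u : CSpace n → ℝ} {α : Fin k → CSpace n → ℝ}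

theorem leviD_contDiffOn (hΩ : IsOpen Ω) (hu : ContDiffOn ℝ 4 u Ω) (w : CSpace n) :
    ContDiffOn ℝ 2 (leviD u w) Ω := by
  have h : ∀ e : CSpace n, ContDiffOn ℝ 2 (dirD e (dirD e u)) Ω := fun e =>
    (hu.dirD hΩ (m := 3) (by norm_num) e).dirD hΩ (by norm_num) e
  exact contDiffOn_const.mul ((h w).add (h _))

theorem dirD_leviD (hΩ : IsOpen Ω) (hu : ContDiffOn ℝ 3 u Ω) (w ξ : CSpace n) :
    Set.EqOn (dirD ξ (leviD u w)) (leviD (dirD ξ u) w) Ω := by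
  have hd2 : ∀ e : CSpace n, ContDiffOn ℝ 1 (dirD e (dirD e u)) Ω := fun e =>
    (hu.dirD hΩ (m := 2) (by norm_num) e).dirD hΩ (by norm_num) e
  have hcomm : ∀ e : CSpace n, Set.EqOn (dirD ξ (dirD e (dirD e u))) (dirD e (dirD e (dirD ξ u))) Ω :=
    fun e => (dirD_comm (hu.dirD hΩ (m := 2) (by norm_num) e) hΩ ξ e).trans
      ((dirD_comm (hu.of_le (by norm_num)) hΩ ξ e).dirD hΩ e)
  intro z hz
  have hdiff : ∀ e : CSpace n, DifferentiableAt ℝ (dirD e (dirD e u)) z := fun e =>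
    ((hd2 e).differentiableOn (by norm_num)).differentiableAt (hΩ.mem_nhds hz)
  have h1 : dirD ξ (leviD u w) z = (1 / 4) * (dirD ξ (dirD w (dirD w u)) z +
      dirD ξ (dirD (Complex.I • w) (dirD (Complex.I • w) u)) z) := by
    have := (((hdiff w).hasFDerivAt.add (hdiff (Complex.I • w)).hasFDerivAt).const_mul
      (1 / 4 : ℝ)).fderiv
    have h2 := congrArg (fun T : CSpace n →L[ℝ] ℝ => T ξ) this
    refine h2.trans ?_
    simp only [_root_.smul_apply, _root_.add_apply, smul_eq_mul, dirD]
  rw [h1, hcomm w hz, hcomm (Complex.I • w) hz, leviD]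

/-- Telescoping: σ_{l+d}/σ_l is a product of d quotients, and x ≤ exp(x - 1) is applied to each
supporting functional divided by its value at z₀. Read as a lower bound for σ_l/σ_{l+d}, this is an
equality at z₀. -/
theorem hessianSigma_le_exp {z z₀ : CSpace n} {p : ℕ → Fin n → ℝ} {w : Fin n → CSpace n}
    (hz : ∀ m ≤ k, 0 < hessianSigma m u z) (hz₀ : ∀ m ≤ k, 0 < hessianSigma m u z₀)
    (h : ∀ j < k, hessianSigma (j + 1) u z ≤ hessianSigma j u z * ∑ i, p j i * leviD u (w i) z)
    (l : ℕ) : ∀ d, l + d ≤ k →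
    hessianSigma (l + d) u z ≤ hessianSigma l u z *
      (hessianSigma (l + d) u z₀ / hessianSigma l u z₀) *
      Real.exp (∑ j ∈ Finset.Ico l (l + d), ((∑ i, p j i * leviD u (w i) z) /
        (hessianSigma (j + 1) u z₀ / hessianSigma j u z₀) - 1)) := by
  intro d
  induction d with
  | zero =>
    intro hl
    have := (hz₀ l (by omega)).ne'
    simp [div_self this]
  | succ d ih =>
    intro hl
    have h1 := ih (by omega)
    have h2 := h (l + d) (by omega)
    have hs0 := hz₀ (l + d) (by omega)
    have hs1 := hz₀ (l + d + 1) (by omega)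
    have hl0 := hz₀ l (by omega)
    have hsz := hz (l + d) (by omega)
    set S := ∑ i, p (l + d) i * leviD u (w i) z
    set q := hessianSigma (l + d + 1) u z₀ / hessianSigma (l + d) u z₀ with hq
    have hq0 : 0 < q := div_pos hs1 hs0
    have h3 : S ≤ q * Real.exp (S / q - 1) := by
      have := Real.add_one_le_exp (S / q - 1)
      have h4 : S = q * (S / q - 1 + 1) := by field_simp; ring
      calc S = q * (S / q - 1 + 1) := h4
        _ ≤ _ := mul_le_mul_of_nonneg_left this hq0.le
    rw [← add_assoc, Finset.sum_Ico_succ_top (by omega), Real.exp_add]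
    set X := Real.exp (∑ j ∈ Finset.Ico l (l + d), ((∑ i, p j i * leviD u (w i) z) /
        (hessianSigma (j + 1) u z₀ / hessianSigma j u z₀) - 1))
    calc hessianSigma (l + d + 1) u z ≤ hessianSigma (l + d) u z * S := h2
      _ ≤ hessianSigma (l + d) u z * (q * Real.exp (S / q - 1)) :=
          mul_le_mul_of_nonneg_left h3 hsz.le
      _ ≤ (hessianSigma l u z * (hessianSigma (l + d) u z₀ / hessianSigma l u z₀) * X) *
          (q * Real.exp (S / q - 1)) :=
          mul_le_mul_of_nonneg_right h1 (by positivity)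
      _ = _ := by
          rw [hq]; field_simp; rfl

/-- If σ_k ≤ σ_{k-1}, each single term α_l σ_l of the equation is at most σ_{k-1}. Otherwise
σ_k/σ_{k-1} > 1; by Newton the successive quotients do not increase with the index, so all earlier
ones exceed 1 too, and σ_l ≤ σ_{k-1}. -/
theorem sigma_quotient_le_max {z : CSpace n} (hΩ : IsOpen Ω) (hu : ContDiffOn ℝ 2 u Ω)
    (hadm : IsAdmissible k Ω u) (hz : z ∈ Ω) {a : ℝ} (ha : 0 < a) (hα : ∀ l, a ≤ α l z)
    (heq : hessianSigma k u z = ∑ l : Fin k, α l z * hessianSigma (l : ℕ) u z) (l : Fin k) :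
    hessianSigma l u z / hessianSigma (k - 1) u z ≤ max 1 (1 / a) := by
  have hpos := hessianSigma_pos hadm hz
  have hl := l.2
  have hk1 := hpos (k - 1) (by omega)
  rcases le_or_gt (hessianSigma k u z) (hessianSigma (k - 1) u z) with h | h
  · refine le_max_of_le_right ?_
    rw [div_le_div_iff₀ hk1 ha, one_mul]
    have h1 : α l z * hessianSigma (l : ℕ) u z ≤ hessianSigma k u z := by
      rw [heq]
      exact Finset.single_le_sum (f := fun l : Fin k => α l z * hessianSigma (l : ℕ) u z)
        (fun i _ => mul_nonneg (ha.le.trans (hα i)) (hpos _ i.2.le).le) (Finset.mem_univ l)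
    have h2 := mul_le_mul_of_nonneg_right (hα l) (hpos l (by omega)).le
    linarith
  · refine le_max_of_le_left ?_
    rw [div_le_one hk1]
    have hmono : ∀ d, d < k → hessianSigma (k - 1 - d) u z < hessianSigma (k - d) u z := by
      intro d
      induction d with
      | zero => intro _; simpa using h
      | succ d ih =>
        intro hd
        have h1 := ih (by omega)
        have h2 := hessianSigma_newton hΩ hu hz (k - 1 - (d + 1))
        rw [show k - 1 - (d + 1) + 2 = k - d by omega,
          show k - 1 - (d + 1) + 1 = k - 1 - d by omega] at h2
        rw [show k - (d + 1) = k - 1 - d by omega]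
        have p0 := hpos (k - 1 - (d + 1)) (by omega)
        have p1 := hpos (k - 1 - d) (by omega)
        by_contra! hc
        nlinarith
    have hle : ∀ d, d < k → hessianSigma (k - 1 - d) u z ≤ hessianSigma (k - 1) u z := by
      intro d
      induction d with
      | zero => intro _; simp
      | succ d ih =>
        intro hd
        have h1 := hmono (d + 1) hd
        rw [show k - (d + 1) = k - 1 - d by omega] at h1
        exact h1.le.trans (ih (by omega))
    have := hle (k - 1 - l) (by omega)
    rwa [show k - 1 - (k - 1 - (l : ℕ)) = l by omega] at this

/-- At each point, some value of the Levi form of a solution is controlled by the coefficients. -/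
theorem exists_leviD_le (hk : 1 ≤ k) (hkn : k ≤ n) (hΩ : IsOpen Ω) (hu : ContDiffOn ℝ 2 u Ω)
    (hadm : IsAdmissible k Ω u) {z : CSpace n} (hz : z ∈ Ω) (hα : ∀ l, 0 ≤ α l z)
    (heq : hessianSigma k u z = ∑ l : Fin k, α l z * hessianSigma (l : ℕ) u z) :
    ∃ w : CSpace n, ‖w‖ = 1 ∧ leviD u w z ≤ n * max 1 (∑ l, α l z) := by
  by_contra! hcon
  obtain ⟨w, hw, p, hp⟩ := exists_leviD_supergradient hkn hΩ hu hadm hz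
  have hpos := hessianSigma_pos hadm hz
  set K := max 1 (∑ l, α l z)
  have hK : 1 ≤ K := le_max_left _ _
  have hn : (0 : ℝ) < n := by exact_mod_cast (by omega : 0 < n)
  -- If all Levi values exceed nK, the weights, of sum at least 1/n, make every quotient σ_{j+1}/σ_j
  -- exceed K ≥ 1. Then the σ_l increase with l < k, and σ_k > Kσ_{k-1} ≥ Σ α_l σ_l contradicts the
  -- equation.
  have hq : ∀ j < k, K * hessianSigma j u z < hessianSigma (j + 1) u z := by
    intro j hj
    obtain ⟨h0, h1, -, h3⟩ := hp j hj
    rw [h3, mul_comm]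
    refine mul_lt_mul_of_pos_left ?_ (hpos j hj.le)
    have hs : 0 < ∑ i, p j i := lt_of_lt_of_le (by positivity) h1
    obtain ⟨i₀, -, hi₀⟩ := Finset.exists_lt_of_sum_lt (s := Finset.univ) (f := fun _ => (0 : ℝ))
      (g := p j) (by simpa using hs)
    calc K = (n * K) * (1 / n) := by field_simp
      _ ≤ (n * K) * ∑ i, p j i := mul_le_mul_of_nonneg_left h1 (by positivity)
      _ = ∑ i, p j i * (n * K) := by rw [Finset.mul_sum]; simp only [mul_comm]
      _ < _ := Finset.sum_lt_sum
          (fun i _ => mul_le_mul_of_nonneg_left (hcon _ (hw i)).le (h0 i))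
          ⟨i₀, Finset.mem_univ _, mul_lt_mul_of_pos_left (hcon _ (hw i₀)) hi₀⟩
  have hmono : ∀ d l, l + d ≤ k → hessianSigma l u z ≤ hessianSigma (l + d) u z := by
    intro d
    induction d with
    | zero => intro l _; simp
    | succ d ih =>
      intro l hl
      have h1 := hq (l + d) (by omega)
      have h2 := hpos (l + d) (by omega)
      rw [← add_assoc]
      have := ih l (by omega)
      nlinarith
  have h1 := hq (k - 1) (by omega)
  rw [show k - 1 + 1 = k by omega, heq] at h1
  have h2 : ∑ l : Fin k, α l z * hessianSigma (l : ℕ) u z ≤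
      ∑ l : Fin k, α l z * hessianSigma (k - 1) u z := by
    refine Finset.sum_le_sum fun l _ => mul_le_mul_of_nonneg_left ?_ (hα l)
    have hl := l.2
    have := hmono (k - 1 - l) l (by omega)
    rwa [show (l : ℕ) + (k - 1 - l) = k - 1 by omega] at this
  rw [← Finset.sum_mul] at h2
  have h3 : ∑ l, α l z ≤ K := le_max_right _ _
  have := mul_le_mul_of_nonneg_right h3 (hpos (k - 1) (by omega)).le
  linarith

/-- The weights g are the derivatives at z₀ of the touching function R with respect to the Levi
values. Since R has a minimum at z₀, its first-order condition is the differentiated equation, and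
its second-order condition replaces the concavity argument for the twice differentiated equation. -/
theorem exists_linearization (hk : 1 ≤ k) (hkn : k ≤ n) (hΩ : IsOpen Ω)
    (hu : ContDiffOn ℝ 4 u Ω) (hadm : IsAdmissible k Ω u) (hα : ∀ l, ContDiffOn ℝ 2 (α l) Ω)
    (hα0 : ∀ l, ∀ z ∈ Ω, 0 ≤ α l z)
    (heq : ∀ z ∈ Ω, hessianSigma k u z = ∑ l : Fin k, α l z * hessianSigma (l : ℕ) u z)
    {z₀ : CSpace n} (hz₀ : z₀ ∈ Ω) {a A : ℝ} (ha : 0 < a) (hαa : ∀ l, a ≤ α l z₀)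
    (hαA : ∀ l, α l z₀ ≤ A) (hαD : ∀ l ξ, |dirD ξ (α l) z₀| ≤ A * ‖ξ‖) :
    ∃ (w : Fin n → CSpace n) (g : Fin n → ℝ), (∀ i, ‖w i‖ = 1) ∧ (∀ i, 0 ≤ g i) ∧
      1 / (n : ℝ) ≤ ∑ i, g i ∧
      0 ≤ ∑ i, g i * leviD u (w i) z₀ ∧
      ∑ i, g i * leviD u (w i) z₀ ≤ (k + 1) * (k * A * max 1 (1 / a)) ∧
      (∀ ξ, |∑ i, g i * leviD (dirD ξ u) (w i) z₀| ≤ k * A * max 1 (1 / a) * ‖ξ‖) ∧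
      (∀ ξ A₂, (∀ l, |dirD ξ (dirD ξ (α l)) z₀| ≤ A₂) →
        -(k * (max 1 (1 / a) * (A₂ + A ^ 2 * ‖ξ‖ ^ 2 / a))) ≤
          ∑ i, g i * leviD (dirD ξ (dirD ξ u)) (w i) z₀) := by
  have hu2 : ContDiffOn ℝ 2 u Ω := hu.of_le (by norm_num)
  have hu3 : ContDiffOn ℝ 3 u Ω := hu.of_le (by norm_num)
  obtain ⟨w, hw, p, hp⟩ := exists_leviD_supergradient hkn hΩ hu2 hadm hz₀
  have hpos0 := hessianSigma_pos hadm hz₀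
  have hk1 : k - 1 < k := by omega
  have hk1' : k - 1 + 1 = k := by omega
  set H := max 1 (1 / a) with hH
  have hH0 : 0 < H := lt_of_lt_of_le one_pos (le_max_left _ _)
  set F : Fin n → CSpace n → ℝ := fun i => leviD u (w i) with hF
  set h : Fin k → ℝ := fun l => hessianSigma l u z₀ / hessianSigma (k - 1) u z₀ with hh
  have hh0 : ∀ l, 0 < h l := fun l => div_pos (hpos0 l l.2.le) (hpos0 _ hk1.le)
  have hhH : ∀ l, h l ≤ H := fun l =>
    sigma_quotient_le_max hΩ hu2 hadm hz₀ ha hαa (heq z₀ hz₀) l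
  set q : ℕ → ℝ := fun j => hessianSigma (j + 1) u z₀ / hessianSigma j u z₀ with hq
  have hq0 : ∀ j < k, 0 < q j := fun j hj => div_pos (hpos0 _ hj) (hpos0 _ hj.le)
  have hqF : ∀ j < k, ∑ i, p j i * F i z₀ = q j := by
    intro j hj
    have h3 := (hp j hj).2.2.2
    rw [hq]; simp only
    rw [h3, mul_div_cancel_left₀ _ (hpos0 j hj.le).ne']
  -- The linear functional in the exponential bound for σ_{k-1}/σ_l: each factor of index l ≤ j < k
  -- - 1 contributes its supporting functional divided by its value at z₀. Its value at z₀ is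
  -- therefore the number k - 1 - l of factors.
  set m : Fin k → Fin n → ℝ := fun l i => ∑ j ∈ Finset.Ico (l : ℕ) (k - 1), p j i / q j with hm
  have hm0 : ∀ l i, 0 ≤ m l i := fun l i => Finset.sum_nonneg fun j hj => by
    have hj' : j < k := by have := (Finset.mem_Ico.1 hj).2; omega
    exact div_nonneg ((hp j hj').1 i) (hq0 j hj').le
  have hmF : ∀ l z, ∑ i, m l i * F i z = ∑ j ∈ Finset.Ico (l : ℕ) (k - 1),
      (∑ i, p j i * F i z) / q j := by
    intro l z
    simp only [hm, Finset.sum_mul, Finset.sum_div]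
    rw [Finset.sum_comm]
    exact Finset.sum_congr rfl fun j _ => Finset.sum_congr rfl fun i _ => by ring
  have hmF0 : ∀ l, ∑ i, m l i * F i z₀ = ((k - 1 - l : ℕ) : ℝ) := by
    intro l
    rw [hmF, Finset.sum_congr rfl (g := fun _ => (1 : ℝ))]
    · simp
    · intro j hj
      have hj' : j < k := by have := (Finset.mem_Ico.1 hj).2; omega
      rw [hqF j hj', div_self (hq0 j hj').ne']
  -- After multiplication by σ_{k-1}(z) > 0, the first sum dominates σ_k(z) and the second is
  -- dominated by Σ α_l σ_l(z). The equation makes the product nonnegative.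
  set R : CSpace n → ℝ := fun z => ∑ i, p (k - 1) i * F i z -
    ∑ l, h l * (α l z * Real.exp (∑ i, m l i * F i z₀ - ∑ i, m l i * F i z)) with hR
  have hR0 : R z₀ = 0 := by
    simp only [hR, sub_self, Real.exp_zero, mul_one]
    rw [hqF _ hk1, hq]
    simp only
    rw [hk1', heq z₀ hz₀, Finset.sum_div, sub_eq_zero]
    exact Finset.sum_congr rfl fun l _ => by rw [hh]; ring
  have hRnn : ∀ z ∈ Ω, 0 ≤ R z := by
    intro z hz
    have hpos := hessianSigma_pos hadm hz
    have hs := hpos _ hk1.le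
    have h1 := (hp _ hk1).2.2.1 z hz
    rw [hk1', heq z hz] at h1
    have h2 : ∀ l : Fin k, hessianSigma (k - 1) u z * (h l * (α l z * Real.exp
        (∑ i, m l i * F i z₀ - ∑ i, m l i * F i z))) ≤ α l z * hessianSigma (l : ℕ) u z := by
      intro l
      have hl := l.2
      have h3 := hessianSigma_le_exp hpos hpos0 (fun j hj => (hp j hj).2.2.1 z hz) l
        (k - 1 - l) (by omega)
      rw [show (l : ℕ) + (k - 1 - l) = k - 1 by omega] at h3
      have h4 : ∑ j ∈ Finset.Ico (l : ℕ) (k - 1), ((∑ i, p j i * leviD u (w i) z) /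
        (hessianSigma (j + 1) u z₀ / hessianSigma j u z₀) - 1) =
          ∑ i, m l i * F i z - ∑ i, m l i * F i z₀ := by
        rw [Finset.sum_sub_distrib, hmF, hmF0]
        simp [hq, hF]
      rw [h4] at h3
      set T := ∑ i, m l i * F i z - ∑ i, m l i * F i z₀ with hT
      rw [show ∑ i, m l i * F i z₀ - ∑ i, m l i * F i z = -T by rw [hT]; ring]
      have h5 : h l * (hessianSigma (k - 1) u z₀ / hessianSigma l u z₀) = 1 := by
        have e1 := (hpos0 l hl.le).ne'
        have e2 := (hpos0 _ hk1.le).ne'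
        simp only [hh]; field_simp
      have h6 : Real.exp T * Real.exp (-T) = 1 := by rw [← Real.exp_add]; simp
      calc hessianSigma (k - 1) u z * (h l * (α l z * Real.exp (-T)))
          ≤ (hessianSigma l u z * (hessianSigma (k - 1) u z₀ / hessianSigma l u z₀) *
            Real.exp T) * (h l * (α l z * Real.exp (-T))) := by
            refine mul_le_mul_of_nonneg_right h3 ?_
            exact mul_nonneg (hh0 l).le (mul_nonneg (hα0 l z hz) (Real.exp_pos _).le)
        _ = (h l * (hessianSigma (k - 1) u z₀ / hessianSigma l u z₀)) *
            (Real.exp T * Real.exp (-T)) * (α l z * hessianSigma l u z) := by ring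
        _ = _ := by rw [h5, h6]; ring
    have h7 := Finset.sum_le_sum fun l (_ : l ∈ Finset.univ) => h2 l
    rw [← Finset.mul_sum] at h7
    have h8 : 0 ≤ hessianSigma (k - 1) u z * R z := by
      simp only [hR, mul_sub]; linarith
    exact nonneg_of_mul_nonneg_right h8 hs
  have hRmin : IsLocalMin R z₀ := by
    filter_upwards [hΩ.mem_nhds hz₀] with z hz
    rw [hR0]; exact hRnn z hz
  set g : Fin n → ℝ := fun i => p (k - 1) i + ∑ l, h l * α l z₀ * m l i with hg
  have hgs : ∀ X : Fin n → ℝ, ∑ i, g i * X i =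
      ∑ i, p (k - 1) i * X i + ∑ l, h l * (α l z₀ * ∑ i, m l i * X i) := by
    intro X
    simp only [hg, add_mul, Finset.sum_add_distrib, Finset.sum_mul, Finset.mul_sum]
    congr 1
    rw [Finset.sum_comm]
    exact Finset.sum_congr rfl fun l _ => Finset.sum_congr rfl fun i _ => by ring
  have hjet : ∀ ξ : CSpace n,
      ∑ i, g i * dirD ξ (F i) z₀ = ∑ l, h l * dirD ξ (α l) z₀ ∧
      ∑ l, h l * (α l z₀ * (∑ i, m l i * dirD ξ (F i) z₀) ^ 2 -
        2 * (dirD ξ (α l) z₀ * ∑ i, m l i * dirD ξ (F i) z₀) + dirD ξ (dirD ξ (α l)) z₀) ≤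
        ∑ i, g i * dirD ξ (dirD ξ (F i)) z₀ := by
    intro ξ
    have jF : ∀ i, HasJet (fun t => F i (z₀ + t • ξ)) (dirD ξ (F i) z₀)
        (dirD ξ (dirD ξ (F i)) z₀) := fun i =>
      hasJet_of_contDiffOn hΩ (leviD_contDiffOn hΩ hu (w i)) hz₀ ξ
    have jα : ∀ l, HasJet (fun t => α l (z₀ + t • ξ)) (dirD ξ (α l) z₀)
        (dirD ξ (dirD ξ (α l)) z₀) := fun l => hasJet_of_contDiffOn hΩ (hα l) hz₀ ξ
    have jR := (HasJet.sum (s := Finset.univ) fun i _ => (jF i).const_mul (p (k - 1) i)).sub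
      (HasJet.sum (s := Finset.univ) fun l _ => ((jα l).mul
        ((HasJet.const (∑ i, m l i * F i z₀)).sub
          (HasJet.sum (s := Finset.univ) fun i _ => (jF i).const_mul (m l i))).exp).const_mul (h l))
    have := jR.of_isLocalMin (isLocalMin_line hRmin ξ)
    simp only [zero_smul, add_zero, sub_self, Real.exp_zero, mul_one, one_mul, zero_sub] at this
    obtain ⟨j1, j2⟩ := this
    constructor
    · rw [hgs, ← sub_eq_zero, ← j1, sub_eq_add_neg, sub_eq_add_neg, add_assoc,
        ← Finset.sum_neg_distrib, ← Finset.sum_neg_distrib, ← Finset.sum_add_distrib]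
      congr 1
      exact Finset.sum_congr rfl fun l _ => by ring
    · rw [hgs, ← sub_nonneg]
      refine j2.trans (le_of_eq ?_)
      rw [sub_eq_add_neg, sub_eq_add_neg, add_assoc,
        ← Finset.sum_neg_distrib, ← Finset.sum_neg_distrib, ← Finset.sum_add_distrib]
      congr 1
      exact Finset.sum_congr rfl fun l _ => by ring
  have hA0 : 0 ≤ A := by
    have hl := hαA ⟨0, hk⟩
    linarith [hαa ⟨0, hk⟩]
  have hdF : ∀ ξ i, dirD ξ (F i) z₀ = leviD (dirD ξ u) (w i) z₀ := fun ξ i =>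
    dirD_leviD hΩ hu3 (w i) ξ hz₀
  have hddF : ∀ ξ i, dirD ξ (dirD ξ (F i)) z₀ = leviD (dirD ξ (dirD ξ u)) (w i) z₀ := by
    intro ξ i
    rw [(dirD_leviD hΩ hu3 (w i) ξ).dirD hΩ ξ hz₀]
    exact dirD_leviD hΩ (hu.dirD hΩ (by norm_num) ξ) (w i) ξ hz₀
  have hαh : ∀ l, 0 ≤ h l * α l z₀ ∧ h l * α l z₀ ≤ A * H := fun l =>
    ⟨mul_nonneg (hh0 l).le (hα0 l z₀ hz₀), by
      rw [mul_comm A]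
      exact mul_le_mul (hhH l) (hαA l) (hα0 l z₀ hz₀) hH0.le⟩
  have hsumh : ∑ l, h l * α l z₀ ≤ k * A * H := by
    have := Finset.sum_le_sum fun l (_ : l ∈ Finset.univ) => (hαh l).2
    simp only [Finset.sum_const, Finset.card_univ, Fintype.card_fin, nsmul_eq_mul] at this
    linarith
  have hsumh0 : 0 ≤ ∑ l, h l * α l z₀ := Finset.sum_nonneg fun l _ => (hαh l).1
  have hqk : q (k - 1) = ∑ l, h l * α l z₀ := by
    simp only [hR, sub_self, Real.exp_zero, mul_one] at hR0
    rw [hqF _ hk1] at hR0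
    linarith
  refine ⟨w, g, hw, ?_, ?_, ?_, ?_, ?_, ?_⟩
  · intro i
    exact add_nonneg ((hp _ hk1).1 i)
      (Finset.sum_nonneg fun l _ => mul_nonneg (hαh l).1 (hm0 l i))
  · refine (hp _ hk1).2.1.trans (Finset.sum_le_sum fun i _ => ?_)
    exact le_add_of_nonneg_right (Finset.sum_nonneg fun l _ => mul_nonneg (hαh l).1 (hm0 l i))
  · have := hgs fun i => F i z₀
    rw [this, hqF _ hk1]
    refine add_nonneg (hq0 _ hk1).le (Finset.sum_nonneg fun l _ => ?_)
    rw [hmF0, ← mul_assoc]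
    exact mul_nonneg (hαh l).1 (Nat.cast_nonneg _)
  · have := hgs fun i => F i z₀
    rw [this, hqF _ hk1, hqk, add_mul, one_mul, add_comm]
    refine add_le_add ?_ hsumh
    calc ∑ l, h l * (α l z₀ * ∑ i, m l i * F i z₀) ≤ ∑ l, (k : ℝ) * (h l * α l z₀) := by
          refine Finset.sum_le_sum fun l _ => ?_
          rw [hmF0, ← mul_assoc, mul_comm]
          refine mul_le_mul_of_nonneg_right ?_ (hαh l).1
          exact_mod_cast (by omega : k - 1 - (l : ℕ) ≤ k)
      _ = k * ∑ l, h l * α l z₀ := by rw [Finset.mul_sum]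
      _ ≤ _ := mul_le_mul_of_nonneg_left hsumh (Nat.cast_nonneg _)
  · intro ξ
    have h1 := (hjet ξ).1
    simp only [hdF] at h1
    rw [h1]
    calc |∑ l, h l * dirD ξ (α l) z₀| ≤ ∑ l, |h l * dirD ξ (α l) z₀| :=
          Finset.abs_sum_le_sum_abs _ _
      _ ≤ ∑ _l : Fin k, H * (A * ‖ξ‖) := Finset.sum_le_sum fun l _ => by
          rw [abs_mul, abs_of_pos (hh0 l)]
          exact mul_le_mul (hhH l) (hαD l ξ) (abs_nonneg _) hH0.le
      _ = _ := by simp; ring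
  · intro ξ A₂ hA₂
    have h2 := (hjet ξ).2
    simp only [hddF] at h2
    refine le_trans ?_ h2
    have : -(k * (H * (A₂ + A ^ 2 * ‖ξ‖ ^ 2 / a))) =
        ∑ _l : Fin k, -(H * (A₂ + A ^ 2 * ‖ξ‖ ^ 2 / a)) := by simp
    rw [this]
    refine Finset.sum_le_sum fun l _ => ?_
    set M := ∑ i, m l i * dirD ξ (F i) z₀
    set d := dirD ξ (α l) z₀
    set d2 := dirD ξ (dirD ξ (α l)) z₀
    have e1 : d ^ 2 ≤ A ^ 2 * ‖ξ‖ ^ 2 := by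
      rw [← mul_pow]; exact sq_le_sq' (by linarith [neg_abs_le d, hαD l ξ]) ((le_abs_self d).trans (hαD l ξ))
    have e2 : d ^ 2 / a ≤ A ^ 2 * ‖ξ‖ ^ 2 / a := div_le_div_of_nonneg_right e1 ha.le
    -- The square of the unknown third-order quantity M has a positive coefficient, thanks to the
    -- lower bound a on α_l, so completing the square absorbs the cross term with the derivative of
    -- α_l.
    have e3 : -(d ^ 2 / a) ≤ α l z₀ * M ^ 2 - 2 * (d * M) := by
      have e4 : a * M ^ 2 ≤ α l z₀ * M ^ 2 := mul_le_mul_of_nonneg_right (hαa l) (sq_nonneg _)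
      have e5 : a * M ^ 2 - 2 * (d * M) + d ^ 2 / a = (a * M - d) ^ 2 / a := by field_simp; ring
      have e6 : 0 ≤ (a * M - d) ^ 2 / a := by positivity
      linarith
    have e7 : -A₂ ≤ d2 := (abs_le.1 (hA₂ l)).1
    have e8 : 0 ≤ A₂ + A ^ 2 * ‖ξ‖ ^ 2 / a := by
      have := (abs_nonneg _).trans (hA₂ l)
      positivity
    have e9 : h l * -(A₂ + A ^ 2 * ‖ξ‖ ^ 2 / a) ≤
        h l * (α l z₀ * M ^ 2 - 2 * (d * M) + d2) :=
      mul_le_mul_of_nonneg_left (by linarith) (hh0 l).le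
    have e10 := mul_le_mul_of_nonneg_right (hhH l) e8
    linarith

end Linearization

/-! ### Gradient vectors and the normal field of a strictly convex domain. -/

section Gradient

variable {E : Type*} [NormedAddCommGroup E] [InnerProductSpace ℝ E] [FiniteDimensional ℝ E]

/-- The vector that represents the linear functional `T`. -/
noncomputable def rieszVec (T : E →L[ℝ] ℝ) : E :=
  ∑ i, T (stdOrthonormalBasis ℝ E i) • stdOrthonormalBasis ℝ E i

theorem inner_rieszVec (T : E →L[ℝ] ℝ) (v : E) : inner ℝ v (rieszVec T) = T v := by
  conv_rhs => rw [← (stdOrthonormalBasis ℝ E).sum_repr' v]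
  rw [rieszVec, inner_sum, map_sum]
  refine Finset.sum_congr rfl fun i _ => ?_
  rw [inner_smul_right, map_smul, smul_eq_mul, real_inner_comm]; ring

theorem contDiff_rieszVec {m : WithTop ℕ∞} : ContDiff ℝ m (rieszVec (E := E)) :=
  ContDiff.sum fun _ _ => (contDiff_id.clm_apply contDiff_const).smul contDiff_const

theorem rieszVec_eq_zero_iff {T : E →L[ℝ] ℝ} : rieszVec T = 0 ↔ T = 0 := by
  constructor
  · intro h; ext v; rw [← inner_rieszVec, h]; simp
  · rintro rfl; simp [rieszVec]

end Gradient

/-- A set missing the frontier is covered by two disjoint open sets, the interior and the complement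
of the closure. The lemma serves to locate boundary points on short segments. -/
theorem inter_frontier_nonempty_of_isPreconnected {X : Type*} [TopologicalSpace X] {s t : Set X}
    (ht : IsPreconnected t) (h1 : (t ∩ s).Nonempty) (h2 : (t ∩ sᶜ).Nonempty) :
    (t ∩ frontier s).Nonempty := by
  by_contra! h
  have hcov : t ⊆ interior s ∪ (closure s)ᶜ := by
    intro x hx
    by_contra hc
    rw [Set.mem_union, not_or, Set.mem_compl_iff, not_not] at hc
    exact (Set.eq_empty_iff_forall_notMem.1 h x) ⟨hx, hc.2, hc.1⟩
  obtain ⟨x, hx, hxs⟩ := h1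
  obtain ⟨y, hy, hys⟩ := h2
  obtain ⟨z, -, hz1, hz2⟩ := ht _ _ isOpen_interior isClosed_closure.isOpen_compl hcov
    ⟨x, hx, (hcov hx).resolve_right fun hc => hc (subset_closure hxs)⟩
    ⟨y, hy, (hcov hy).resolve_left fun hc => hys (interior_subset hc)⟩
  exact hz2 (subset_closure (interior_subset hz1))

section NormalField

variable {E : Type*} [NormedAddCommGroup E] [InnerProductSpace ℝ E]

/-- `N` is a `C³` extension to `Ω̄` of the outer unit normal field of the convex domain `Ω`, and the
principal curvatures of `∂Ω` are at least `κ > 0`. -/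
structure IsNormalField (Ω : Set E) (N : E → E) (κ : ℝ) : Prop where
  isOpen : IsOpen Ω
  convex : Convex ℝ Ω
  nonempty : Ω.Nonempty
  isBounded : Bornology.IsBounded Ω
  contDiffOn : ContDiffOn ℝ 3 N (closure Ω)
  norm_eq : ∀ x ∈ frontier Ω, ‖N x‖ = 1
  unique : ∀ x ∈ frontier Ω, ∀ v : E, ‖v‖ = 1 → (∀ w ∈ Ω, inner ℝ (w - x) v ≤ 0) → v = N x
  inward : ∀ x ∈ frontier Ω, ∀ᶠ t : ℝ in 𝓝[>] 0, x - t • N x ∈ Ω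
  tangent : ∀ x ∈ frontier Ω, ∀ τ : E, inner ℝ τ (N x) = 0 → τ ∈ tangentConeAt ℝ (frontier Ω) x
  pos : 0 < κ
  curvature : ∀ x ∈ frontier Ω, ∀ τ : E, inner ℝ τ (N x) = 0 →
    κ * ‖τ‖ ^ 2 ≤ inner ℝ τ (fderivWithin ℝ N (closure Ω) x τ)

theorem uniqueDiffOn_closure {Ω : Set E} (ho : IsOpen Ω) (hc : Convex ℝ Ω) (hne : Ω.Nonempty) :
    UniqueDiffOn ℝ (closure Ω) :=
  uniqueDiffOn_convex hc.closure (hne.mono (ho.subset_interior_iff.2 subset_closure))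

theorem eventually_add_smul_mem {r : E → ℝ} {Ω : Set E} (hΩ : Ω = {z | r z < 0}) {x : E}
    (hr : DifferentiableAt ℝ r x) (hx : r x = 0) {ξ : E} (hξ : fderiv ℝ r x ξ < 0) :
    ∀ᶠ t : ℝ in 𝓝[>] 0, x + t • ξ ∈ Ω := by
  have hx' : x = x + (0 : ℝ) • ξ := by simp
  have hd : HasDerivAt (fun t : ℝ => r (x + t • ξ)) (fderiv ℝ r x ξ) 0 := by
    have h1 : HasFDerivAt r (fderiv ℝ r x) (x + (0 : ℝ) • ξ) := by
      rw [← hx']; exact hr.hasFDerivAt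
    exact h1.comp_hasDerivAt 0 (hasDerivAt_line x ξ 0)
  have h1 := (hasDerivAt_iff_tendsto_slope.1 hd).mono_left
    (nhdsWithin_mono 0 (fun t (ht : 0 < t) => ht.ne'))
  filter_upwards [h1.eventually (gt_mem_nhds hξ), self_mem_nhdsWithin] with t ht htp
  rw [slope_def_field] at ht
  simp only [zero_smul, add_zero, hx, sub_zero] at ht
  have htp' : (0 : ℝ) < t := htp
  rw [hΩ]
  by_contra hc
  exact absurd ht (not_lt.2 (div_nonneg (not_lt.1 hc) htp'.le))

variable [FiniteDimensional ℝ E]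

/-- With r the defining function, N = ∇r/√(|∇r|² + r²). The term r² keeps the denominator positive
at interior critical points and vanishes on the boundary, so N is C³ on the closure and of unit
length on the boundary. On tangent vectors ⟨τ, DN τ⟩ is a positive multiple of D²r(τ, τ);
compactness of the unit tangent bundle provides κ. -/
theorem exists_isNormalField {Ω : Set E} (ho : IsOpen Ω) (hc : Convex ℝ Ω) (hne : Ω.Nonempty)
    (hb : Bornology.IsBounded Ω) {r : E → ℝ} (hr : ContDiff ℝ 4 r) (hΩ : Ω = {z | r z < 0})
    (hr1 : ∀ z ∈ frontier Ω, fderiv ℝ r z ≠ 0)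
    (hr2 : ∀ z ∈ frontier Ω, ∀ ξ : E, ξ ≠ 0 → fderiv ℝ r z ξ = 0 →
      0 < fderiv ℝ (fderiv ℝ r) z ξ ξ) :
    ∃ N κ, IsNormalField Ω N κ := by
  have hud := uniqueDiffOn_closure ho hc hne
  have hScomp : IsCompact (closure Ω) := hb.isCompact_closure
  have hfS : frontier Ω ⊆ closure Ω := frontier_subset_closure
  have hrle : ∀ x ∈ closure Ω, r x ≤ 0 := by
    intro x hx
    have : closure Ω ⊆ {z | r z ≤ 0} := closure_minimal (by
      rw [hΩ]; exact fun z (hz : r z < 0) => hz.le) (isClosed_le hr.continuous continuous_const)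
    exact this hx
  have hr0 : ∀ x ∈ frontier Ω, r x = 0 := by
    intro x hx
    refine le_antisymm (hrle x (hfS hx)) ?_
    have : x ∉ Ω := by rw [ho.frontier_eq] at hx; exact hx.2
    rw [hΩ] at this
    exact not_lt.1 this
  set G : E → E := fun x => rieszVec (fderiv ℝ r x) with hG
  have hGi : ∀ x v, inner ℝ v (G x) = fderiv ℝ r x v := fun x v => inner_rieszVec _ v
  have hGc : ContDiff ℝ 3 G := contDiff_rieszVec.comp (hr.fderiv_right (by norm_num))
  set ρ : E → ℝ := fun x => ‖G x‖ ^ 2 + r x ^ 2 with hρ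
  have hρpos : ∀ x ∈ closure Ω, 0 < ρ x := by
    intro x hx
    by_cases h : x ∈ Ω
    · have h' : r x < 0 := by rw [hΩ] at h; exact h
      have : 0 < r x ^ 2 := sq_pos_iff.2 h'.ne
      simp only [hρ]; positivity
    · have hxf : x ∈ frontier Ω := by rw [ho.frontier_eq]; exact ⟨hx, h⟩
      have : G x ≠ 0 := fun h0 => hr1 x hxf (rieszVec_eq_zero_iff.1 h0)
      have : 0 < ‖G x‖ := norm_pos_iff.2 this
      simp only [hρ]; positivity
  have hρc : ContDiff ℝ 3 ρ := (hGc.norm_sq ℝ).add ((hr.of_le (by norm_num)).pow 2)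
  set c : E → ℝ := fun x => (Real.sqrt (ρ x))⁻¹ with hcdef
  have hcC : ∀ x ∈ closure Ω, ContDiffAt ℝ 3 c x := fun x hx =>
    (hρc.contDiffAt.sqrt (hρpos x hx).ne').inv (Real.sqrt_pos.2 (hρpos x hx)).ne'
  set N : E → E := fun x => c x • G x with hN
  have hNC : ∀ x ∈ closure Ω, ContDiffAt ℝ 3 N x := fun x hx =>
    (hcC x hx).smul hGc.contDiffAt
  have hcpos : ∀ x ∈ closure Ω, 0 < c x := fun x hx => inv_pos.2 (Real.sqrt_pos.2 (hρpos x hx))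
  have hcf : ∀ x ∈ frontier Ω, c x = ‖G x‖⁻¹ := by
    intro x hx
    simp [hcdef, hρ, hr0 x hx]
  have hGne : ∀ x ∈ frontier Ω, ‖G x‖ ≠ 0 := fun x hx h0 =>
    hr1 x hx (rieszVec_eq_zero_iff.1 (norm_eq_zero.1 h0))
  have hN1 : ∀ x ∈ frontier Ω, ‖N x‖ = 1 := by
    intro x hx
    simp only [hN, norm_smul, hcf x hx, norm_inv, norm_norm]
    exact inv_mul_cancel₀ (hGne x hx)
  have hNr : ∀ x v, inner ℝ v (N x) = c x * fderiv ℝ r x v := by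
    intro x v; simp only [hN, inner_smul_right, hGi]
  have hrd : ∀ x, DifferentiableAt ℝ r x := fun x => (hr.differentiable (by norm_num)) x
  have hmove : ∀ x ∈ frontier Ω, ∀ ξ, inner ℝ ξ (N x) < 0 →
      ∀ᶠ t : ℝ in 𝓝[>] 0, x + t • ξ ∈ Ω := by
    intro x hx ξ hξ
    rw [hNr] at hξ
    exact eventually_add_smul_mem hΩ (hrd x) (hr0 x hx)
      (neg_of_mul_neg_right hξ (hcpos x (hfS hx)).le)
  have hsupp : ∀ x ∈ frontier Ω, ∀ w ∈ Ω, inner ℝ (w - x) (N x) ≤ 0 := by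
    intro x hx w hw
    by_contra! hpos
    have h1 : inner ℝ (-(w - x)) (N x) < 0 := by rw [inner_neg_left]; linarith
    have hd : HasDerivAt (fun t : ℝ => r (x + t • (w - x))) (fderiv ℝ r x (w - x)) 0 := by
      have h1 : HasFDerivAt r (fderiv ℝ r x) (x + (0 : ℝ) • (w - x)) := by
        rw [zero_smul, add_zero]; exact (hrd x).hasFDerivAt
      exact h1.comp_hasDerivAt 0 (hasDerivAt_line x (w - x) 0)
    have hpos' : 0 < fderiv ℝ r x (w - x) := by
      rw [hNr] at hpos
      exact pos_of_mul_pos_right hpos (hcpos x (hfS hx)).le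
    have h2 : Tendsto (slope (fun t : ℝ => r (x + t • (w - x))) 0) (𝓝[>] 0)
        (𝓝 (fderiv ℝ r x (w - x))) := (hasDerivAt_iff_tendsto_slope.1 hd).mono_left
      (nhdsWithin_mono 0 (fun t (ht : 0 < t) => ht.ne'))
    have h3 : ∀ᶠ t : ℝ in 𝓝[>] 0, t ∈ Set.Ioc (0 : ℝ) 1 :=
      Ioc_mem_nhdsGT one_pos
    obtain ⟨t, ht1, ht2⟩ := ((h2.eventually (lt_mem_nhds hpos')).and h3).exists
    have h4 : x + t • (w - x) ∈ Ω := by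
      have := hc.add_smul_sub_mem_interior' (hfS hx) (by rwa [ho.interior_eq]) ht2
      rwa [ho.interior_eq] at this
    rw [slope_def_field] at ht1
    simp only [zero_smul, add_zero, hr0 x hx, sub_zero] at ht1
    rw [hΩ] at h4
    exact absurd ht1 (not_lt.2 (div_nonpos_of_nonpos_of_nonneg (le_of_lt h4) ht2.1.le))
  have htan : ∀ x ∈ frontier Ω, ∀ τ : E, inner ℝ τ (N x) = 0 →
      τ ∈ tangentConeAt ℝ (frontier Ω) x := by
    intro x hx τ hτ
    have hNN : inner ℝ (N x) (N x) = (1 : ℝ) := by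
      rw [real_inner_self_eq_norm_sq, hN1 x hx]; norm_num
    have hout : ∀ t : ℝ, x + t • τ ∉ Ω := by
      intro t ht
      have hcont : Tendsto (fun η : ℝ => x + t • τ + η • N x) (𝓝[>] 0) (𝓝 (x + t • τ)) := by
        have := (hasDerivAt_line (x + t • τ) (N x) 0).continuousAt.tendsto
        simp only [zero_smul, add_zero] at this
        exact this.mono_left nhdsWithin_le_nhds
      obtain ⟨η, h1, h2⟩ := ((hcont.eventually (ho.mem_nhds ht)).and self_mem_nhdsWithin).exists
      have h3 := hsupp x hx _ h1
      have h2' : (0 : ℝ) < η := h2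
      rw [show x + t • τ + η • N x - x = t • τ + η • N x by abel, inner_add_left,
        real_inner_smul_left, real_inner_smul_left, hτ, hNN] at h3
      linarith
    -- The supporting hyperplane keeps x + tτ outside Ω, while the inward tilt x + t(τ - δN) is
    -- inside for small t. Some intermediate tilt s ∈ [0, δ] meets the frontier; as δ tends to 0
    -- these boundary points realise τ as a tangent direction.
    have hex : ∀ m : ℕ, ∃ t s : ℝ, 0 < t ∧ t < 1 / ((m : ℝ) + 1) ∧ 0 ≤ s ∧
        s ≤ 1 / ((m : ℝ) + 1) ∧ x + t • (τ - s • N x) ∈ frontier Ω := by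
      intro m
      set δ : ℝ := 1 / ((m : ℝ) + 1)
      have hδ : 0 < δ := by positivity
      have h1 : inner ℝ (τ - δ • N x) (N x) < 0 := by
        rw [inner_sub_left, real_inner_smul_left, hτ, hNN]; linarith
      have h2 : ∀ᶠ t : ℝ in 𝓝[>] 0, t ∈ Set.Ioo (0 : ℝ) δ := Ioo_mem_nhdsGT hδ
      obtain ⟨t, ht1, ht2⟩ := ((hmove x hx _ h1).and h2).exists
      have hpre : IsPreconnected ((fun s : ℝ => x + t • (τ - s • N x)) '' Set.Icc 0 δ) :=
        isPreconnected_Icc.image _ (by fun_prop)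
      obtain ⟨y, ⟨s, hs, rfl⟩, hy⟩ := inter_frontier_nonempty_of_isPreconnected hpre
        ⟨_, ⟨δ, ⟨hδ.le, le_rfl⟩, rfl⟩, ht1⟩
        ⟨_, ⟨0, ⟨le_rfl, hδ.le⟩, rfl⟩, by simpa using hout t⟩
      exact ⟨t, s, ht2.1, ht2.2, hs.1, hs.2, hy⟩
    choose t s ht0 ht1 hs0 hs1 hmem using hex
    have hlim : Tendsto (fun m : ℕ => 1 / ((m : ℝ) + 1)) atTop (𝓝 0) :=
      tendsto_one_div_add_atTop_nhds_zero_nat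
    have hs : Tendsto s atTop (𝓝 0) := squeeze_zero hs0 hs1 hlim
    have ht : Tendsto t atTop (𝓝 0) := squeeze_zero (fun m => (ht0 m).le) (fun m => (ht1 m).le) hlim
    have hv : Tendsto (fun m => τ - s m • N x) atTop (𝓝 τ) := by
      simpa using tendsto_const_nhds.sub (hs.smul_const (N x))
    refine mem_tangentConeAt_of_seq atTop (fun m => (t m)⁻¹) (fun m => t m • (τ - s m • N x))
      ?_ (Eventually.of_forall hmem) ?_
    · simpa using ht.smul hv
    · simpa [smul_smul, inv_mul_cancel₀ (ht0 _).ne'] using hv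
  have hNon : ContDiffOn ℝ 3 N (closure Ω) := fun x hx => (hNC x hx).contDiffWithinAt
  have hcurv : ∀ x ∈ frontier Ω, ∀ τ : E, inner ℝ τ (N x) = 0 → τ ≠ 0 →
      0 < inner ℝ τ (fderivWithin ℝ N (closure Ω) x τ) := by
    intro x hx τ hτ hτ0
    have hxS := hfS hx
    have hcd : DifferentiableAt ℝ c x := (hcC x hxS).differentiableAt (by norm_num)
    have hGd : DifferentiableAt ℝ G x := hGc.contDiffAt.differentiableAt (by norm_num)
    have hNd : DifferentiableAt ℝ N x := (hNC x hxS).differentiableAt (by norm_num)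
    rw [hNd.fderivWithin (hud x hxS)]
    have h1 : fderiv ℝ N x τ = c x • fderiv ℝ G x τ + (fderiv ℝ c x τ) • G x := by
      have := (hcd.hasFDerivAt.smul hGd.hasFDerivAt).fderiv
      have h2 := congrArg (fun T : E →L[ℝ] E => T τ) this
      refine h2.trans ?_
      simp
    have hrτ : fderiv ℝ r x τ = 0 := by
      rw [hNr] at hτ
      exact (mul_eq_zero.1 hτ).resolve_left (hcpos x hxS).ne'
    have h2 : inner ℝ τ (fderiv ℝ G x τ) = fderiv ℝ (fderiv ℝ r) x τ τ := by
      have hd1 : HasFDerivAt (fun y => inner ℝ τ (G y))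
          ((innerSL ℝ τ).comp (fderiv ℝ G x)) x :=
        (innerSL ℝ τ).hasFDerivAt.comp x hGd.hasFDerivAt
      have hd2 : HasFDerivAt (fun y => fderiv ℝ r y τ)
          ((fderiv ℝ (fderiv ℝ r) x).flip τ) x := by
        have : DifferentiableAt ℝ (fderiv ℝ r) x :=
          (hr.fderiv_right (m := 3) (by norm_num)).contDiffAt.differentiableAt (by norm_num)
        simpa using this.hasFDerivAt.clm_apply (hasFDerivAt_const τ x)
      simp only [hGi] at hd1
      have := congrArg (fun T : E →L[ℝ] ℝ => T τ) (hd1.unique hd2)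
      simpa using this
    -- The derivative of the normalising factor c multiplies ⟨τ, ∇r⟩ = 0, so only c D²r(τ, τ)
    -- remains.
    rw [h1, inner_add_right, inner_smul_right, inner_smul_right, hGi, hrτ, mul_zero, add_zero, h2]
    exact mul_pos (hcpos x hxS) (hr2 x hx τ hτ0 hrτ)
  have hκ : ∃ κ : ℝ, 0 < κ ∧ ∀ x ∈ frontier Ω, ∀ τ : E, ‖τ‖ = 1 → inner ℝ τ (N x) = 0 →
      κ ≤ inner ℝ τ (fderivWithin ℝ N (closure Ω) x τ) := by
    set K : Set (E × E) := (frontier Ω ×ˢ Metric.sphere 0 1) ∩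
      {p | p ∈ closure Ω ×ˢ Set.univ ∧ inner ℝ p.2 (N p.1) = 0} with hK
    have hKc : IsCompact K := by
      have hcl : IsCompact (frontier Ω ×ˢ Metric.sphere (0 : E) 1) :=
        (hScomp.of_isClosed_subset isClosed_frontier hfS).prod (isCompact_sphere 0 1)
      refine hcl.inter_right ?_
      have : ContinuousOn (fun p : E × E => (inner ℝ p.2 (N p.1) : ℝ))
          (closure Ω ×ˢ Set.univ) :=
        continuousOn_snd.inner (𝕜 := ℝ) (hNon.continuousOn.comp continuousOn_fst fun p hp => hp.1)
      exact this.preimage_isClosed_of_isClosed (isClosed_closure.prod isClosed_univ)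
        isClosed_singleton (t := {0})
    have hfc : ContinuousOn (fun p : E × E =>
        (inner ℝ p.2 (fderivWithin ℝ N (closure Ω) p.1 p.2) : ℝ)) K := by
      have h1 : ContinuousOn (fderivWithin ℝ N (closure Ω)) (closure Ω) :=
        hNon.continuousOn_fderivWithin hud (by norm_num)
      have h2 : ContinuousOn (fun p : E × E => fderivWithin ℝ N (closure Ω) p.1 p.2) K :=
        (h1.comp continuousOn_fst fun p hp => hp.2.1.1).clm_apply continuousOn_snd
      exact continuousOn_snd.inner (𝕜 := ℝ) h2
    rcases K.eq_empty_or_nonempty with he | hne'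
    · refine ⟨1, one_pos, fun x hx τ h1 h2 => ?_⟩
      have : (x, τ) ∈ K := ⟨⟨hx, by simpa using h1⟩, ⟨hfS hx, trivial⟩, h2⟩
      rw [he] at this
      exact absurd this (Set.notMem_empty _)
    · obtain ⟨p, hp, hmin⟩ := hKc.exists_isMinOn hne' hfc
      refine ⟨_, hcurv p.1 hp.1.1 p.2 hp.2.2 ?_, fun x hx τ h1 h2 => ?_⟩
      · intro h0
        have := hp.1.2
        rw [h0] at this
        simp at this
      · exact hmin (show (x, τ) ∈ K from ⟨⟨hx, by simpa using h1⟩, ⟨hfS hx, trivial⟩, h2⟩)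
  obtain ⟨κ, hκ0, hκ⟩ := hκ
  refine ⟨N, κ, ho, hc, hne, hb, hNon, hN1, ?_, ?_, htan, hκ0, ?_⟩
  · intro x hx v hv hvΩ
    by_contra hne'
    have h1 : inner ℝ v (N x) < (1 : ℝ) :=
      (inner_lt_one_iff_real_of_norm_eq_one hv (hN1 x hx)).2 hne'
    have h2 : inner ℝ (v - N x) (N x) < 0 := by
      rw [inner_sub_left, real_inner_self_eq_norm_sq, hN1 x hx]; linarith
    obtain ⟨t, ht1, ht2⟩ := ((hmove x hx _ h2).and self_mem_nhdsWithin).exists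
    have h3 := hvΩ _ ht1
    have ht2' : (0 : ℝ) < t := ht2
    rw [add_sub_cancel_left, real_inner_smul_left, inner_sub_left, real_inner_self_eq_norm_sq, hv,
      real_inner_comm] at h3
    nlinarith
  · intro x hx
    have h2 : inner ℝ (-N x) (N x) < 0 := by
      rw [inner_neg_left, real_inner_self_eq_norm_sq, hN1 x hx]; norm_num
    simpa [sub_eq_add_neg] using hmove x hx _ h2
  · intro x hx τ hτ
    by_cases h0 : τ = 0
    · simp [h0]
    have hn : ‖τ‖ ≠ 0 := norm_ne_zero_iff.2 h0
    have h1 := hκ x hx (‖τ‖⁻¹ • τ) (by rw [norm_smul, norm_inv, norm_norm, inv_mul_cancel₀ hn])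
      (by rw [real_inner_smul_left, hτ, mul_zero])
    rw [map_smul, real_inner_smul_left, inner_smul_right] at h1
    have h2 := mul_le_mul_of_nonneg_right h1 (sq_nonneg ‖τ‖)
    calc κ * ‖τ‖ ^ 2 ≤ _ := h2
      _ = _ := by field_simp

end NormalField

/-! ### Calculus of uniform C^m bounds. -/

section CBound

variable {E F G H : Type*} [NormedAddCommGroup E] [NormedSpace ℝ E] [NormedAddCommGroup F]
  [NormedSpace ℝ F] [NormedAddCommGroup G] [NormedSpace ℝ G] [NormedAddCommGroup H]
  [NormedSpace ℝ H] {S : Set E}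

/-- `f ∈ C^m(S)`, with derivatives of order at most `m` bounded by `B`. -/
structure CBound (S : Set E) (m : ℕ) (f : E → F) (B : ℝ) : Prop where
  contDiffOn : ContDiffOn ℝ m f S
  le : ∀ j ≤ m, ∀ x ∈ S, ‖iteratedFDerivWithin ℝ j f S x‖ ≤ B

namespace CBound

variable {m : ℕ} {f g : E → F} {B B' : ℝ}

theorem mono (hf : CBound S m f B) (h : B ≤ B') : CBound S m f B' :=
  ⟨hf.1, fun j hj x hx => (hf.2 j hj x hx).trans h⟩

theorem of_le (hf : CBound S m f B) {m' : ℕ} (h : m' ≤ m) : CBound S m' f B :=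
  ⟨hf.1.of_le (by exact_mod_cast h), fun j hj x hx => hf.2 j (hj.trans h) x hx⟩

theorem norm_le (hf : CBound S m f B) {x : E} (hx : x ∈ S) : ‖f x‖ ≤ B := by
  have := hf.2 0 (Nat.zero_le _) x hx
  rwa [norm_iteratedFDerivWithin_zero] at this

theorem nonneg (hf : CBound S m f B) (hS : S.Nonempty) : 0 ≤ B :=
  (norm_nonneg _).trans (hf.norm_le hS.some_mem)

theorem const (m : ℕ) (c : F) : CBound S m (fun _ : E => c) ‖c‖ := by
  refine ⟨contDiffOn_const, fun j _ x _ => ?_⟩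
  cases j with
  | zero => rw [norm_iteratedFDerivWithin_zero]
  | succ j => rw [iteratedFDerivWithin_succ_const]; simp

theorem add (hS : UniqueDiffOn ℝ S) (hf : CBound S m f B) (hg : CBound S m g B') :
    CBound S m (fun x => f x + g x) (B + B') := by
  refine ⟨hf.1.add hg.1, fun j hj x hx => ?_⟩
  have h1 : ContDiffWithinAt ℝ j f S x := (hf.1 x hx).of_le (by exact_mod_cast hj)
  have h2 : ContDiffWithinAt ℝ j g S x := (hg.1 x hx).of_le (by exact_mod_cast hj)
  have : iteratedFDerivWithin ℝ j (fun x => f x + g x) S x =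
      iteratedFDerivWithin ℝ j f S x + iteratedFDerivWithin ℝ j g S x :=
    iteratedFDerivWithin_add_apply h1 h2 hS hx
  rw [this]
  exact (norm_add_le _ _).trans (add_le_add (hf.2 j hj x hx) (hg.2 j hj x hx))

/-- Leibniz: the binomial coefficients of order j ≤ m sum to 2^j ≤ 2^m. -/
theorem bilin (hS : UniqueDiffOn ℝ S) {g : E → G} (L : F →L[ℝ] G →L[ℝ] H) (hL : ‖L‖ ≤ 1)
    (hf : CBound S m f B) (hg : CBound S m g B') :
    CBound S m (fun x => L (f x) (g x)) (2 ^ m * (B * B')) := by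
  refine ⟨(L.contDiff.comp_contDiffOn hf.1).clm_apply hg.1, fun j hj x hx => ?_⟩
  have hB : 0 ≤ B := hf.nonneg ⟨x, hx⟩
  have hB' : 0 ≤ B' := hg.nonneg ⟨x, hx⟩
  refine (L.norm_iteratedFDerivWithin_le_of_bilinear_of_le_one hf.1 hg.1 hS hx
    (by exact_mod_cast hj) hL).trans ?_
  calc _ ≤ ∑ i ∈ Finset.range (j + 1), (j.choose i : ℝ) * (B * B') := by
        refine Finset.sum_le_sum fun i hi => ?_
        have hi' : i ≤ j := by have := Finset.mem_range.1 hi; omega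
        rw [mul_assoc]
        exact mul_le_mul_of_nonneg_left (mul_le_mul (hf.2 i (by omega) x hx)
          (hg.2 (j - i) (by omega) x hx) (norm_nonneg _) hB) (Nat.cast_nonneg _)
    _ = 2 ^ j * (B * B') := by
        rw [← Finset.sum_mul]
        congr 1
        exact_mod_cast Nat.sum_range_choose j
    _ ≤ _ := mul_le_mul_of_nonneg_right (pow_le_pow_right₀ (by norm_num) hj) (by positivity)

theorem smul (hS : UniqueDiffOn ℝ S) {c : E → ℝ} (hc : CBound S m c B) (hf : CBound S m f B') :
    CBound S m (fun x => c x • f x) (2 ^ m * (B * B')) :=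
  bilin hS (ContinuousLinearMap.lsmul ℝ ℝ) ContinuousLinearMap.opNorm_lsmul_le hc hf

theorem clm_apply (hS : UniqueDiffOn ℝ S) {T : E → F →L[ℝ] G} {v : E → F} (hT : CBound S m T B)
    (hv : CBound S m v B') : CBound S m (fun x => T x (v x)) (2 ^ m * (B * B')) :=
  bilin hS (ContinuousLinearMap.id ℝ (F →L[ℝ] G)) ContinuousLinearMap.norm_id_le hT hv

theorem fderivWithin (hS : UniqueDiffOn ℝ S) (hf : CBound S (m + 1) f B) :
    CBound S m (fderivWithin ℝ f S) B := by
  refine ⟨hf.1.fderivWithin hS (by push_cast; rfl), fun j hj x hx => ?_⟩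
  rw [norm_iteratedFDerivWithin_fderivWithin hS hx]
  exact hf.2 (j + 1) (by omega) x hx

theorem exists_of_isCompact (hS : UniqueDiffOn ℝ S) (hc : IsCompact S) (hf : ContDiffOn ℝ m f S) :
    ∃ B, CBound S m f B := by
  have h : ∀ j ∈ Finset.range (m + 1), ∃ B, ∀ x ∈ S, ‖iteratedFDerivWithin ℝ j f S x‖ ≤ B := by
    intro j hj
    have hj' : j ≤ m := by have := Finset.mem_range.1 hj; omega
    exact hc.exists_bound_of_continuousOn
      (hf.continuousOn_iteratedFDerivWithin (by exact_mod_cast hj') hS)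
  choose! b hb using h
  refine ⟨∑ j ∈ Finset.range (m + 1), |b j|, hf, fun j hj x hx => ?_⟩
  have hj' : j ∈ Finset.range (m + 1) := Finset.mem_range.2 (by omega)
  exact ((hb j hj' x hx).trans (le_abs_self _)).trans
    (Finset.single_le_sum (f := fun j => |b j|) (fun i _ => abs_nonneg _) hj')

theorem norm_fderivWithin_le (hS : UniqueDiffOn ℝ S) (hf : CBound S m f B) (hm : 1 ≤ m) {x : E}
    (hx : x ∈ S) : ‖_root_.fderivWithin ℝ f S x‖ ≤ B := by
  rw [← norm_iteratedFDerivWithin_one f (hS x hx)]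
  exact hf.2 1 hm x hx

theorem dirD_le {Ω : Set E} (hΩ : IsOpen Ω) (hΩS : Ω ⊆ S) (hS : UniqueDiffOn ℝ S) {f : E → ℝ}
    (hf : CBound S m f B) (hm : 1 ≤ m) {x : E} (hx : x ∈ Ω) (e : E) : |dirD e f x| ≤ B * ‖e‖ := by
  have h1 := hf.norm_fderivWithin_le hS hm (hΩS hx)
  rw [fderivWithin_of_mem_nhds (mem_of_superset (hΩ.mem_nhds hx) hΩS)] at h1
  exact ((fderiv ℝ f x).le_opNorm e).trans (mul_le_mul_of_nonneg_right h1 (norm_nonneg _))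

theorem dirD_dirD_le {Ω : Set E} (hΩ : IsOpen Ω) (hΩS : Ω ⊆ S) (hS : UniqueDiffOn ℝ S) {f : E → ℝ}
    (hf : CBound S m f B) (hm : 2 ≤ m) {x : E} (hx : x ∈ Ω) (e : E) :
    |dirD e (dirD e f) x| ≤ B * ‖e‖ ^ 2 := by
  have h1 := hf.2 2 hm x (hΩS hx)
  have h2 : dirD e (dirD e f) x = iteratedFDerivWithin ℝ 2 f S x ![e, e] := by
    rw [dirD_eq_iterated ((hf.1.of_le (by exact_mod_cast hm)).mono hΩS) hΩ hx,
      iteratedFDerivWithin_two_apply' f hS (hΩS hx),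
      fderivWithin_of_mem_nhds (mem_of_superset (hΩ.mem_nhds hx) hΩS)]
    have : _root_.fderivWithin ℝ f S =ᶠ[𝓝 x] fderiv ℝ f := by
      filter_upwards [hΩ.mem_nhds hx] with y hy
      exact fderivWithin_of_mem_nhds (mem_of_superset (hΩ.mem_nhds hy) hΩS)
    rw [this.fderiv_eq]
  rw [h2]
  refine ((iteratedFDerivWithin ℝ 2 f S x).le_opNorm _).trans ?_
  simp only [Fin.prod_univ_two, Matrix.cons_val_zero, Matrix.cons_val_one]
  rw [← sq]
  exact mul_le_mul_of_nonneg_right h1 (sq_nonneg _)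

end CBound

end CBound

/-! ### First derivatives at boundary points. -/

section Boundary

variable {E : Type*} [NormedAddCommGroup E] [InnerProductSpace ℝ E] {Ω : Set E} {N : E → E} {κ : ℝ}

namespace IsNormalField

theorem uniqueDiffOn (h : IsNormalField Ω N κ) : UniqueDiffOn ℝ (closure Ω) :=
  uniqueDiffOn_closure h.isOpen h.convex h.nonempty

theorem closure_interior_closure (h : IsNormalField Ω N κ) {x : E} (hx : x ∈ closure Ω) :
    x ∈ closure (interior (closure Ω)) :=
  closure_mono (h.isOpen.subset_interior_iff.2 subset_closure) hx

/-- At a boundary maximum the outer normal derivative is nonnegative. -/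
theorem normal_deriv_nonneg (h : IsNormalField Ω N κ) {f : E → ℝ} {x : E} (hx : x ∈ frontier Ω)
    {f' : E →L[ℝ] ℝ} (hf : HasFDerivWithinAt f f' (closure Ω) x)
    (hmax : ∀ y ∈ closure Ω, f y ≤ f x) : 0 ≤ f' (N x) := by
  obtain ⟨t, ht1, ht2⟩ := ((h.inward x hx).and self_mem_nhdsWithin).exists
  have ht : (0 : ℝ) < t := ht2
  have hseg : segment ℝ x (x + (-(t • N x))) ⊆ closure Ω :=
    h.convex.closure.segment_subset (frontier_subset_closure hx)
      (subset_closure (by rwa [← sub_eq_add_neg]))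
  have h1 := IsLocalMaxOn.hasFDerivWithinAt_nonpos
    (Filter.eventually_of_mem self_mem_nhdsWithin hmax) hf
    (mem_posTangentConeAt_of_segment_subset hseg)
  rw [map_neg, map_smul, smul_eq_mul] at h1
  by_contra! hc
  nlinarith

/-- The tangential derivatives of a function that vanishes on the boundary are zero. -/
theorem tangential_deriv_eq_zero (h : IsNormalField Ω N κ) {f : E → ℝ} {x : E}
    (hx : x ∈ frontier Ω) {f' : E →L[ℝ] ℝ} (hf : HasFDerivWithinAt f f' (closure Ω) x)
    (h0 : ∀ y ∈ frontier Ω, f y = 0) {τ : E} (hτ : inner ℝ τ (N x) = 0) : f' τ = 0 := by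
  have h1 : HasFDerivWithinAt f f' (frontier Ω) x := hf.mono frontier_subset_closure
  have h2 : HasFDerivWithinAt f (0 : E →L[ℝ] ℝ) (frontier Ω) x :=
    (hasFDerivWithinAt_const (0 : ℝ) x (frontier Ω)).congr h0 (h0 x hx)
  simpa using h1.unique_on h2 (h.tangent x hx τ hτ)

theorem hasFDerivWithinAt_normal (h : IsNormalField Ω N κ) {x : E} (hx : x ∈ closure Ω) :
    HasFDerivWithinAt N (fderivWithin ℝ N (closure Ω) x) (closure Ω) x :=
  (h.contDiffOn.differentiableOn (by norm_num) x hx).hasFDerivWithinAt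

/-- Tangential differentiation of |N|² = 1, which holds on the boundary only. -/
theorem inner_normal_fderivWithin (h : IsNormalField Ω N κ) {x : E} (hx : x ∈ frontier Ω) {τ : E}
    (hτ : inner ℝ τ (N x) = 0) :
    inner ℝ (N x) (fderivWithin ℝ N (closure Ω) x τ) = 0 := by
  have hd := h.hasFDerivWithinAt_normal (frontier_subset_closure hx)
  have h1 := ((hd.inner ℝ hd).sub_const 1)
  have h2 := h.tangential_deriv_eq_zero hx h1 (fun y hy => by
    rw [real_inner_self_eq_norm_sq, h.norm_eq y hy]; norm_num) hτ
  simp only [ContinuousLinearMap.comp_apply, ContinuousLinearMap.prod_apply,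
    fderivInnerCLM_apply] at h2
  rw [real_inner_comm (N x)] at h2
  linarith

end IsNormalField

end Boundary

/-! ### The gradient estimate. -/

section GradientEstimate

variable {E : Type*} [NormedAddCommGroup E] [InnerProductSpace ℝ E]

/-- The operator `L v = ∑ g_i ∂²v/∂e_i²` at `x₀` has nonnegative coefficients with sum at least `c`,
and `|L u|` and `|L (∂u/∂ξ)|` are bounded by `C`. -/
structure IsLinearization {ι : Type} [Fintype ι] (u : E → ℝ) (x₀ : E) (e : ι → E) (g : ι → ℝ)
    (c C : ℝ) : Prop where
  norm_eq : ∀ i, ‖e i‖ = 1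
  nonneg : ∀ i, 0 ≤ g i
  le_sum : c ≤ ∑ i, g i
  apply_self : |∑ i, g i * dirD (e i) (dirD (e i) u) x₀| ≤ C
  apply_dirD : ∀ ξ : E, ‖ξ‖ ≤ 1 → |∑ i, g i * dirD (e i) (dirD (e i) (dirD ξ u)) x₀| ≤ C

theorem hasJet_norm_sq (x e : E) : HasJet (fun t => ‖x + t • e‖ ^ 2) (2 * inner ℝ x e)
    (2 * ‖e‖ ^ 2) := by
  have h := ((HasJet.const (‖x‖ ^ 2)).add (HasJet.id.const_mul (2 * inner ℝ x e))).add
    ((HasJet.id.mul HasJet.id).const_mul (‖e‖ ^ 2))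
  refine (h.congr ?_).congr_val (by ring) (by ring)
  refine Eventually.of_forall fun t => ?_
  simp only [norm_add_sq_real, inner_smul_right, norm_smul, Real.norm_eq_abs, mul_pow, sq_abs]
  ring

variable {Ω : Set E} {u : E → ℝ}

/-- Applied to the test function, L gives a bounded contribution from L(∂_ξ u) and (εβ + ε²u)Lu,
bounded terms from derivatives of β and Φ, and 2K times the total weight. For large K the sum is
positive, which is impossible at a maximum. -/
theorem not_isLocalMax_gradient_test {S : Set E} (hΩ : IsOpen Ω) (hΩS : Ω ⊆ S)
    (hS : UniqueDiffOn ℝ S) (hu : ContDiffOn ℝ 4 u Ω) {x₀ : E} (hx₀ : x₀ ∈ Ω)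
    {ι : Type} [Fintype ι] {e : ι → E} {g : ι → ℝ} {c C : ℝ} (hc : 0 < c)
    (hL : IsLinearization u x₀ e g c C) {β Φ : E → ℝ} {b B B₀ ε K : ℝ} (hβ : CBound S 2 β b)
    (hΦ : CBound S 2 Φ B) (hε0 : 0 < ε) (hε1 : ε < 1) (hB₀ : |ε * u x₀| ≤ B₀)
    (hK : C * (1 + b + B₀) / c + (b * (B₀ + B) + b ^ 2 + 2 * (b * B) + b * B) < 2 * K)
    {ξ : E} (hξ : ‖ξ‖ ≤ 1) :
    ¬ IsLocalMax (fun x => dirD ξ u x - β x * (-ε * u x + Φ x) + ε ^ 2 / 2 * (u x * u x) +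
      K * ‖x‖ ^ 2) x₀ := by
  intro hmax
  have hxS := hΩS hx₀
  have hu2 : ContDiffOn ℝ 2 u Ω := hu.of_le (by norm_num)
  have hb0 : 0 ≤ b := hβ.nonneg ⟨x₀, hxS⟩
  have hBn : 0 ≤ B := hΦ.nonneg ⟨x₀, hxS⟩
  have hB0n : 0 ≤ B₀ := (abs_nonneg _).trans hB₀
  have hCn : 0 ≤ C := (abs_nonneg _).trans hL.apply_self
  have hβx : |β x₀| ≤ b := hβ.norm_le hxS
  have hΦx : |Φ x₀| ≤ B := hΦ.norm_le hxS
  set C' := b * (B₀ + B) + b ^ 2 + 2 * (b * B) + b * B with hC'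
  have key : ∀ i, dirD (e i) (dirD (e i) (dirD ξ u)) x₀ +
      (ε * β x₀ + ε ^ 2 * u x₀) * dirD (e i) (dirD (e i) u) x₀ + (2 * K - C') ≤ 0 := by
    intro i
    have ju := hasJet_of_contDiffOn hΩ hu2 hx₀ (e i)
    have juξ := hasJet_of_contDiffOn hΩ (hu.dirD hΩ (m := 2) (by norm_num) ξ) hx₀ (e i)
    have jβ := hasJet_of_contDiffOn hΩ (hβ.1.mono hΩS) hx₀ (e i)
    have jΦ := hasJet_of_contDiffOn hΩ (hΦ.1.mono hΩS) hx₀ (e i)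
    have j := ((juξ.sub (jβ.mul ((ju.const_mul (-ε)).add jΦ))).add
      ((ju.mul ju).const_mul (ε ^ 2 / 2))).add ((hasJet_norm_sq x₀ (e i)).const_mul K)
    have h1 := (j.of_isLocalMax (isLocalMax_line hmax (e i))).2
    simp only [zero_smul, add_zero, hL.norm_eq i] at h1
    have b1 := hβ.dirD_le hΩ hΩS hS (by norm_num) hx₀ (e i)
    have b2 := hβ.dirD_dirD_le hΩ hΩS hS le_rfl hx₀ (e i)
    have p1 := hΦ.dirD_le hΩ hΩS hS (by norm_num) hx₀ (e i)
    have p2 := hΦ.dirD_dirD_le hΩ hΩS hS le_rfl hx₀ (e i)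
    rw [hL.norm_eq i, mul_one] at b1 p1
    rw [hL.norm_eq i, one_pow, mul_one] at b2 p2
    set u1 := dirD (e i) u x₀
    set u2 := dirD (e i) (dirD (e i) u) x₀
    set β1 := dirD (e i) β x₀
    set β2 := dirD (e i) (dirD (e i) β) x₀
    set Φ1 := dirD (e i) Φ x₀
    set Φ2 := dirD (e i) (dirD (e i) Φ) x₀
    have q1 : β2 * (-ε * u x₀ + Φ x₀) ≤ b * (B₀ + B) := by
      refine (le_abs_self _).trans ?_
      rw [abs_mul]
      refine mul_le_mul b2 ?_ (abs_nonneg _) hb0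
      refine (abs_add_le _ _).trans (add_le_add ?_ hΦx)
      rwa [neg_mul, abs_neg]
    -- The uncontrolled gradient term from the product βεu is absorbed by ε²u₁², which the summand
    -- (ε²/2)u² was added to provide.
    have q2 : -(ε * β1 * u1) * 2 - ε ^ 2 * u1 ^ 2 ≤ b ^ 2 := by
      have : β1 ^ 2 ≤ b ^ 2 := sq_le_sq' (by linarith [neg_abs_le β1]) ((le_abs_self _).trans b1)
      nlinarith [sq_nonneg (ε * u1 + β1)]
    have q3 : β1 * Φ1 ≤ b * B := by
      refine (le_abs_self _).trans ?_
      rw [abs_mul]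
      exact mul_le_mul b1 p1 (abs_nonneg _) hb0
    have q4 : β x₀ * Φ2 ≤ b * B := by
      refine (le_abs_self _).trans ?_
      rw [abs_mul]
      exact mul_le_mul hβx p2 (abs_nonneg _) hb0
    rw [hC']
    linarith
  have hsum := Finset.sum_nonpos fun i (_ : i ∈ Finset.univ) =>
    mul_nonpos_of_nonneg_of_nonpos (hL.nonneg i) (key i)
  have hexp : ∑ i, g i * (dirD (e i) (dirD (e i) (dirD ξ u)) x₀ +
      (ε * β x₀ + ε ^ 2 * u x₀) * dirD (e i) (dirD (e i) u) x₀ + (2 * K - C')) =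
      ∑ i, g i * dirD (e i) (dirD (e i) (dirD ξ u)) x₀ +
      (ε * β x₀ + ε ^ 2 * u x₀) * ∑ i, g i * dirD (e i) (dirD (e i) u) x₀ +
      (2 * K - C') * ∑ i, g i := by
    rw [Finset.mul_sum, Finset.mul_sum, ← Finset.sum_add_distrib, ← Finset.sum_add_distrib]
    exact Finset.sum_congr rfl fun i _ => by ring
  rw [hexp] at hsum
  have h1 := (abs_le.1 (hL.apply_dirD ξ hξ)).1
  have h2 : -((b + B₀) * C) ≤ (ε * β x₀ + ε ^ 2 * u x₀) *
      ∑ i, g i * dirD (e i) (dirD (e i) u) x₀ := by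
    have : |(ε * β x₀ + ε ^ 2 * u x₀) * ∑ i, g i * dirD (e i) (dirD (e i) u) x₀| ≤
        (b + B₀) * C := by
      rw [abs_mul]
      refine mul_le_mul ?_ hL.apply_self (abs_nonneg _) (by positivity)
      refine (abs_add_le _ _).trans (add_le_add ?_ ?_)
      · rw [abs_mul, abs_of_pos hε0]
        nlinarith [abs_nonneg (β x₀)]
      · rw [sq, mul_assoc, abs_mul, abs_of_pos hε0]
        nlinarith [abs_nonneg (ε * u x₀)]
    exact (abs_le.1 this).1
  have h3 : C * (1 + b + B₀) < (2 * K - C') * ∑ i, g i := by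
    have h4 : C * (1 + b + B₀) / c < 2 * K - C' := by linarith
    have h5 : 0 ≤ C * (1 + b + B₀) / c := by positivity
    calc C * (1 + b + B₀) = C * (1 + b + B₀) / c * c := by field_simp
      _ < (2 * K - C') * c := mul_lt_mul_of_pos_right h4 hc
      _ ≤ _ := mul_le_mul_of_nonneg_left hL.le_sum (by linarith)
  linarith

variable {N : E → E} {κ : ℝ}

theorem isSymm_fderivWithin (hN : IsNormalField Ω N κ) {F : Type*} [NormedAddCommGroup F]
    [NormedSpace ℝ F] {f : E → F}
    (hf : ContDiffOn ℝ 2 f (closure Ω)) {x : E} (hx : x ∈ closure Ω) (a b : E) :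
    fderivWithin ℝ (fderivWithin ℝ f (closure Ω)) (closure Ω) x a b =
      fderivWithin ℝ (fderivWithin ℝ f (closure Ω)) (closure Ω) x b a :=
  (hf x hx).isSymmSndFDerivWithinAt (by simp) hN.uniqueDiffOn (hN.closure_interior_closure hx) hx a b

theorem cbound_inner_normal {b : ℝ} {S : Set E} (hS : UniqueDiffOn ℝ S) {m : ℕ}
    (hN : CBound S m N b) (hne : S.Nonempty) {ξ : E} (hξ : ‖ξ‖ ≤ 1) :
    CBound S m (fun x => (inner ℝ ξ (N x) : ℝ)) (2 ^ m * b) := by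
  have h := CBound.clm_apply hS (CBound.const m (innerSL ℝ ξ)) hN
  rw [innerSL_apply_norm] at h
  refine h.mono ?_
  have := hN.nonneg hne
  have h2 : (0 : ℝ) ≤ 2 ^ m := by positivity
  exact mul_le_mul_of_nonneg_left (by nlinarith) h2

/-- `u` satisfies the boundary condition `D_N u = -ε u + Φ` and is regular enough. -/
structure IsNeumannSolution (Ω : Set E) (N : E → E) (Φ : E → ℝ) (ε : ℝ) (u : E → ℝ) : Prop where
  contDiffOn : ContDiffOn ℝ 4 u Ω
  contDiffOn_closure : ContDiffOn ℝ 3 u (closure Ω)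
  boundary : ∀ x ∈ frontier Ω, fderivWithin ℝ u (closure Ω) x (N x) = -ε * u x + Φ x

/-- Tangential derivative of D_N u + εu - Φ, which vanishes on the boundary. It expresses the mixed
second derivative by first derivatives. -/
theorem IsNeumannSolution.tangential_identity {Φ : E → ℝ} {ε : ℝ} (hu : IsNeumannSolution Ω N Φ ε u)
    (hN : IsNormalField Ω N κ) (hΦ : ContDiffOn ℝ 1 Φ (closure Ω)) {x : E} (hx : x ∈ frontier Ω)
    {τ : E} (hτ : inner ℝ τ (N x) = 0) :
    fderivWithin ℝ u (closure Ω) x (fderivWithin ℝ N (closure Ω) x τ) +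
      fderivWithin ℝ (fderivWithin ℝ u (closure Ω)) (closure Ω) x τ (N x) +
      ε * fderivWithin ℝ u (closure Ω) x τ - fderivWithin ℝ Φ (closure Ω) x τ = 0 := by
  have hxS := frontier_subset_closure hx
  have hU1c : ContDiffOn ℝ 2 (fderivWithin ℝ u (closure Ω)) (closure Ω) :=
    hu.contDiffOn_closure.fderivWithin hN.uniqueDiffOn (by norm_num)
  have dU1 := (hU1c.differentiableOn (by norm_num) x hxS).hasFDerivWithinAt
  have du := (hu.contDiffOn_closure.differentiableOn (by norm_num) x hxS).hasFDerivWithinAt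
  have dΦ := (hΦ.differentiableOn (by norm_num) x hxS).hasFDerivWithinAt
  have h := hN.tangential_deriv_eq_zero hx
    (((dU1.clm_apply (hN.hasFDerivWithinAt_normal hxS)).add (du.const_mul ε)).sub dΦ)
    (fun y hy => by
      simp only [Pi.add_apply, Pi.sub_apply]
      rw [hu.boundary y hy]; ring) hτ
  simpa using h

theorem norm_le_of_apply_le {T : E →L[ℝ] ℝ} {C : ℝ} (hC : 0 ≤ C) (h : ∀ ξ, ‖ξ‖ = 1 → T ξ ≤ C) :
    ‖T‖ ≤ C := by
  refine T.opNorm_le_bound hC fun v => ?_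
  by_cases hv : v = 0
  · simp [hv]
  have hn : 0 < ‖v‖ := norm_pos_iff.2 hv
  have h1 := h (‖v‖⁻¹ • v) (by rw [norm_smul, norm_inv, norm_norm, inv_mul_cancel₀ hn.ne'])
  have h2 := h (-(‖v‖⁻¹ • v))
    (by rw [norm_neg, norm_smul, norm_inv, norm_norm, inv_mul_cancel₀ hn.ne'])
  rw [map_neg] at h2
  rw [map_smul, smul_eq_mul] at h1 h2
  rw [Real.norm_eq_abs, abs_le]
  have e : ‖v‖ * (‖v‖⁻¹ * T v) = T v := by field_simp
  constructor
  · have := mul_le_mul_of_nonneg_left h2 hn.le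
    linarith
  · have := mul_le_mul_of_nonneg_left h1 hn.le
    linarith

variable [FiniteDimensional ℝ E]

/-- The solution enters only through εu and the constants of L, so the bound is uniform in ε
although u itself may grow like 1/ε. -/
theorem exists_gradient_bound (hN : IsNormalField Ω N κ) [Nontrivial E] {c : ℝ} (hc : 0 < c)
    (C B B₀ : ℝ) :
    ∃ C₁ : ℝ, ∀ (u Φ : E → ℝ) (ε : ℝ), 0 < ε → ε < 1 → IsNeumannSolution Ω N Φ ε u →
      CBound (closure Ω) 2 Φ B → (∀ x ∈ closure Ω, |ε * u x| ≤ B₀) →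
      (∀ x₀ ∈ Ω, ∃ (ι : Type) (_ : Fintype ι) (e : ι → E) (g : ι → ℝ),
        IsLinearization u x₀ e g c C) →
      ∀ x ∈ closure Ω, ‖fderivWithin ℝ u (closure Ω) x‖ ≤ C₁ := by
  have hS := hN.uniqueDiffOn
  have hcomp : IsCompact (closure Ω) := hN.isBounded.isCompact_closure
  have hSne : (closure Ω).Nonempty := hN.nonempty.closure
  have hfS : frontier Ω ⊆ closure Ω := frontier_subset_closure
  obtain ⟨bN, hbN⟩ := CBound.exists_of_isCompact hS hcomp hN.contDiffOn
  obtain ⟨R, hR⟩ := hcomp.exists_bound_of_continuousOn (f := fun x : E => x) continuousOn_id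
  have hbN0 := hbN.nonneg hSne
  have hR0 : 0 ≤ R := (norm_nonneg _).trans (hR _ hSne.some_mem)
  set b := 2 ^ 2 * bN with hb
  have hb0 : 0 ≤ b := by positivity
  set K := |C * (1 + b + B₀) / c + (b * (B₀ + B) + b ^ 2 + 2 * (b * B) + b * B)| + 1 with hKdef
  have hK0 : 0 ≤ K := by positivity
  set M := (bN * (B₀ + B) + B₀ * (B₀ + B) + 2 * K * R + B) / κ with hM
  refine ⟨|M| + B₀ ^ 2 + K * R ^ 2 + bN * (B₀ + B) + B₀ * (B₀ + B), ?_⟩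
  intro u Φ ε hε0 hε1 hu hΦ hB₀ hlin
  have hB0n : 0 ≤ B₀ := (abs_nonneg _).trans (hB₀ _ hSne.some_mem)
  have hBn : 0 ≤ B := hΦ.nonneg hSne
  have hκ := hN.pos
  set S := closure Ω with hSdef
  set U1 := fderivWithin ℝ u S with hU1
  have hU1c : ContDiffOn ℝ 2 U1 S := hu.contDiffOn_closure.fderivWithin hS (by norm_num)
  have hψ : ∀ x ∈ S, |-ε * u x + Φ x| ≤ B₀ + B := fun x hx =>
    (abs_add_le _ _).trans (add_le_add (by rw [neg_mul, abs_neg]; exact hB₀ x hx) (hΦ.norm_le hx))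
  have hsq : ∀ x ∈ S, ε ^ 2 / 2 * (u x * u x) ≤ B₀ ^ 2 := fun x hx => by
    have h1 : (ε * u x) ^ 2 ≤ B₀ ^ 2 :=
      sq_le_sq' (by linarith [neg_abs_le (ε * u x), hB₀ x hx]) ((le_abs_self _).trans (hB₀ x hx))
    nlinarith [sq_nonneg (ε * u x)]
  set W : E → E → ℝ := fun ξ x => U1 x ξ - inner ℝ ξ (N x) * (-ε * u x + Φ x) +
    ε ^ 2 / 2 * (u x * u x) + K * ‖x‖ ^ 2 with hW
  have hWc : ContinuousOn (fun p : E × E => W p.1 p.2) (Metric.sphere 0 1 ×ˢ S) := by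
    have m2 : Set.MapsTo (Prod.snd : E × E → E) (Metric.sphere 0 1 ×ˢ S) S := fun p hp => hp.2
    have c1 := hU1c.continuousOn.comp continuousOn_snd m2
    have c2 := hN.contDiffOn.continuousOn.comp continuousOn_snd m2
    have c3 := hu.contDiffOn_closure.continuousOn.comp continuousOn_snd m2
    have c4 := hΦ.1.continuousOn.comp continuousOn_snd m2
    have c5 : ContinuousOn (fun p : E × E => (inner ℝ p.1 (N p.2) : ℝ)) (Metric.sphere 0 1 ×ˢ S) :=
      continuousOn_fst.inner (𝕜 := ℝ) c2
    exact (((c1.clm_apply continuousOn_fst).sub (c5.mul ((continuousOn_const.mul c3).add c4))).add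
      (continuousOn_const.mul (c3.mul c3))).add (continuousOn_const.mul (continuousOn_snd.norm.pow 2))
  have hsphere : (Metric.sphere (0 : E) 1).Nonempty := NormedSpace.sphere_nonempty.2 zero_le_one
  obtain ⟨⟨ξ₀, x₀⟩, hp, hmax⟩ := ((isCompact_sphere (0 : E) 1).prod hcomp).exists_isMaxOn
    (hsphere.prod hSne) hWc
  have hmax' : ∀ ξ, ‖ξ‖ = 1 → ∀ x ∈ S, W ξ x ≤ W ξ₀ x₀ := fun ξ hξ x hx =>
    hmax (show (ξ, x) ∈ Metric.sphere (0 : E) 1 ×ˢ S from ⟨by simpa using hξ, hx⟩)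
  have hξ₀ : ‖ξ₀‖ = 1 := by simpa using hp.1
  have hx₀S : x₀ ∈ S := hp.2
  have hx₀ : x₀ ∈ frontier Ω := by
    rw [hN.isOpen.frontier_eq]
    refine ⟨hx₀S, fun hx₀Ω => ?_⟩
    obtain ⟨ι, _, e, g, hL⟩ := hlin x₀ hx₀Ω
    have hβ := cbound_inner_normal hS (hbN.of_le (by norm_num : 2 ≤ 3)) hSne hξ₀.le
    rw [← hb] at hβ
    refine not_isLocalMax_gradient_test hN.isOpen subset_closure hS hu.contDiffOn hx₀Ω hc hL hβ hΦ
      hε0 hε1 (hB₀ x₀ hx₀S) (K := K) ?_ hξ₀.le ?_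
    · have := le_abs_self (C * (1 + b + B₀) / c + (b * (B₀ + B) + b ^ 2 + 2 * (b * B) + b * B))
      rw [hKdef]
      have := abs_nonneg (C * (1 + b + B₀) / c + (b * (B₀ + B) + b ^ 2 + 2 * (b * B) + b * B))
      linarith
    · have heq : ∀ y ∈ Ω, dirD ξ₀ u y = U1 y ξ₀ := fun y hy => by
        rw [hU1, fderivWithin_of_mem_nhds (mem_of_superset (hN.isOpen.mem_nhds hy) subset_closure)]
        rfl
      filter_upwards [hN.isOpen.mem_nhds hx₀Ω] with y hy
      have := hmax' ξ₀ hξ₀ y (subset_closure hy)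
      simp only [hW] at this
      rw [heq y hy, heq x₀ hx₀Ω]
      exact this
  set ν := N x₀ with hν
  have hνν : inner ℝ ν ν = (1 : ℝ) := by
    rw [real_inner_self_eq_norm_sq, hN.norm_eq x₀ hx₀]; norm_num
  -- The tangential gradient at the boundary maximum. There the test function is ⟨ξ, q⟩ plus a term
  -- independent of ξ, so q/|q| is also a maximal direction.
  set q := rieszVec (U1 x₀) - U1 x₀ ν • ν with hq
  have hqi : ∀ ξ, inner ℝ ξ q = U1 x₀ ξ - inner ℝ ξ ν * U1 x₀ ν := by
    intro ξ
    rw [hq, inner_sub_right, inner_rieszVec, inner_smul_right]; ring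
  have hW0 : ∀ ξ, W ξ x₀ = inner ℝ ξ q + ε ^ 2 / 2 * (u x₀ * u x₀) + K * ‖x₀‖ ^ 2 := by
    intro ξ
    rw [hqi, hU1, hν, hu.boundary x₀ hx₀]
  have hKR : K * ‖x₀‖ ^ 2 ≤ K * R ^ 2 :=
    mul_le_mul_of_nonneg_left (pow_le_pow_left₀ (norm_nonneg _) (hR x₀ hx₀S) 2) hK0
  have hqM : ‖q‖ ≤ |M| := by
    by_cases hq0 : q = 0
    · rw [hq0, norm_zero]; exact abs_nonneg _
    have hqn : 0 < ‖q‖ := norm_pos_iff.2 hq0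
    set ξ := ‖q‖⁻¹ • q with hξ
    have hξ1 : ‖ξ‖ = 1 := by rw [hξ, norm_smul, norm_inv, norm_norm, inv_mul_cancel₀ hqn.ne']
    have hξq : inner ℝ ξ q = ‖q‖ := by
      rw [hξ, real_inner_smul_left, real_inner_self_eq_norm_sq]; field_simp
    have hqν : inner ℝ ν q = 0 := by rw [hqi, hνν]; ring
    have hξν : inner ℝ ξ ν = 0 := by
      rw [hξ, real_inner_smul_left, real_inner_comm, hqν, mul_zero]
    have hmaxξ : ∀ y ∈ S, W ξ y ≤ W ξ x₀ := by
      intro y hy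
      refine (hmax' ξ hξ1 y hy).trans ?_
      rw [hW0, hW0, hξq]
      have := real_inner_le_norm ξ₀ q
      rw [hξ₀, one_mul] at this
      linarith
    set U2 := fderivWithin ℝ U1 S x₀ with hU2
    set DN := fderivWithin ℝ N S x₀ with hDN
    have dU1 : HasFDerivWithinAt U1 U2 S x₀ :=
      (hU1c.differentiableOn (by norm_num) x₀ hx₀S).hasFDerivWithinAt
    have du : HasFDerivWithinAt u (U1 x₀) S x₀ :=
      (hu.contDiffOn_closure.differentiableOn (by norm_num) x₀ hx₀S).hasFDerivWithinAt
    have dΦ : HasFDerivWithinAt Φ (fderivWithin ℝ Φ S x₀) S x₀ :=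
      (hΦ.1.differentiableOn (by norm_num) x₀ hx₀S).hasFDerivWithinAt
    have dN : HasFDerivWithinAt N DN S x₀ := hN.hasFDerivWithinAt_normal hx₀S
    have hP0 := hu.tangential_identity hN (hΦ.1.of_le (by norm_num)) hx₀ hξν
    have dβ : HasFDerivWithinAt (fun y => (inner ℝ ξ (N y) : ℝ)) ((innerSL ℝ ξ).comp DN) S x₀ :=
      (innerSL ℝ ξ).hasFDerivAt.comp_hasFDerivWithinAt x₀ dN
    have dW := (((dU1.clm_apply (hasFDerivWithinAt_const ξ x₀ S)).sub
      (dβ.mul ((du.const_mul (-ε)).add dΦ))).add ((du.mul du).const_mul (ε ^ 2 / 2))).add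
      (((hasFDerivAt_id x₀).norm_sq.hasFDerivWithinAt (s := S)).const_mul K)
    have hWν := hN.normal_deriv_nonneg hx₀ dW hmaxξ
    have hsymm : U2 ν ξ = U2 ξ ν :=
      isSymm_fderivWithin hN (hu.contDiffOn_closure.of_le (by norm_num)) hx₀S ν ξ
    simp at hWν
    rw [← hν, hξν] at hWν
    rw [← hν, ← hSdef, ← hU1, ← hU2, ← hDN] at hP0
    have k1 : inner ℝ ν (DN ξ) = 0 := hN.inner_normal_fderivWithin hx₀ hξν
    have k2 := hN.curvature x₀ hx₀ ξ hξν
    rw [hξ1, one_pow, mul_one] at k2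
    have k3 : U1 x₀ (DN ξ) = ‖q‖ * inner ℝ ξ (DN ξ) := by
      have h1 := hqi (DN ξ)
      rw [real_inner_comm ν, k1, zero_mul, sub_zero] at h1
      rw [← h1, show q = ‖q‖ • ξ by rw [hξ, smul_smul, mul_inv_cancel₀ hqn.ne', one_smul],
        inner_smul_right, real_inner_comm ξ, norm_smul, norm_norm, hξ1, mul_one]
    have k4 : U1 x₀ ξ = ‖q‖ := by
      have h1 := hqi ξ
      rw [hξν, zero_mul, sub_zero, hξq] at h1
      exact h1.symm
    -- Strict convexity enters: q is parallel to ξ and DN ξ is tangential, so the term D_{DN ξ} u of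
    -- the tangential identity is |q| times the normal curvature in direction ξ.
    have k5 : κ * ‖q‖ ≤ U1 x₀ (DN ξ) := by rw [k3, mul_comm]; exact mul_le_mul_of_nonneg_left k2 hqn.le
    have k6 : fderivWithin ℝ Φ S x₀ ξ ≤ B := by
      refine (le_abs_self _).trans (((fderivWithin ℝ Φ S x₀).le_opNorm ξ).trans ?_)
      rw [hξ1, mul_one]
      exact hΦ.norm_fderivWithin_le hS (by norm_num) hx₀S
    have k7 : -(bN * (B₀ + B)) ≤ (-(ε * u x₀) + Φ x₀) * inner ℝ ξ (DN ν) := by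
      refine (abs_le.1 ?_).1
      rw [abs_mul, mul_comm]
      refine mul_le_mul ?_ (by simpa using hψ x₀ hx₀S) (abs_nonneg _) hbN0
      refine (abs_real_inner_le_norm _ _).trans ?_
      rw [hξ1, one_mul]
      refine (DN.le_opNorm ν).trans ?_
      rw [hN.norm_eq x₀ hx₀, mul_one]
      exact hbN.norm_fderivWithin_le hS (by norm_num) hx₀S
    have k8 : ε ^ 2 * (u x₀ * U1 x₀ ν) ≤ B₀ * (B₀ + B) := by
      have e1 : |U1 x₀ ν| ≤ B₀ + B := by
        rw [hU1, hν, hu.boundary x₀ hx₀]; exact hψ x₀ hx₀S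
      have e2 : |ε * u x₀ * U1 x₀ ν| ≤ B₀ * (B₀ + B) := by
        rw [abs_mul]; exact mul_le_mul (hB₀ x₀ hx₀S) e1 (abs_nonneg _) hB0n
      have e3 : ε * (ε * u x₀ * U1 x₀ ν) ≤ ε * (B₀ * (B₀ + B)) :=
        mul_le_mul_of_nonneg_left ((le_abs_self _).trans e2) hε0.le
      have e4 : 0 ≤ B₀ * (B₀ + B) := by positivity
      nlinarith
    have k9 : K * (2 * inner ℝ x₀ ν) ≤ 2 * K * R := by
      have e1 := real_inner_le_norm x₀ ν
      rw [hN.norm_eq x₀ hx₀, mul_one] at e1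
      have e2 := mul_le_mul_of_nonneg_left (e1.trans (hR x₀ hx₀S)) hK0
      linarith
    have k10 : 0 ≤ ε * ‖q‖ := by positivity
    have k11 : κ * ‖q‖ ≤ bN * (B₀ + B) + B₀ * (B₀ + B) + 2 * K * R + B := by
      rw [k4] at hP0
      linarith
    refine le_trans ?_ (le_abs_self M)
    rw [hM, le_div_iff₀ hκ]
    linarith
  intro x hx
  refine norm_le_of_apply_le (by positivity) fun ξ hξ => ?_
  have h1 := hmax' ξ hξ x hx
  rw [hW0] at h1
  have h2 := real_inner_le_norm ξ₀ q
  rw [hξ₀, one_mul] at h2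
  have h3 : inner ℝ ξ (N x) * (-ε * u x + Φ x) ≤ bN * (B₀ + B) := by
    refine (le_abs_self _).trans ?_
    rw [abs_mul]
    refine mul_le_mul ?_ (hψ x hx) (abs_nonneg _) hbN0
    refine (abs_real_inner_le_norm _ _).trans ?_
    rw [hξ, one_mul]
    exact hbN.norm_le hx
  have h4 : 0 ≤ ε ^ 2 / 2 * (u x * u x) := by
    have := mul_self_nonneg (u x)
    positivity
  have h5 : 0 ≤ K * ‖x‖ ^ 2 := by positivity
  have h6 := hsq x₀ hx₀S
  have h7 : 0 ≤ B₀ * (B₀ + B) := by positivity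
  simp only [hW] at h1
  linarith

end GradientEstimate

/-! ### Exclusion of interior maxima for the Hessian test function. -/

section HessianEstimate

variable {E : Type*} [NormedAddCommGroup E] [InnerProductSpace ℝ E]
  {Ω : Set E} {u : E → ℝ}

/-- Differentiating Σ X_a ∂_a u twice produces second derivatives of u with no a priori bound. The
squares produced by |Du|² absorb them, and 2K times the total weight dominates the rest. -/
theorem not_isLocalMax_hessian_test {S : Set E} (hΩ : IsOpen Ω) (hΩS : Ω ⊆ S)
    (hS : UniqueDiffOn ℝ S) (hu : ContDiffOn ℝ 4 u Ω) {x₀ : E} (hx₀ : x₀ ∈ Ω)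
    {ι : Type} [Fintype ι] {e : ι → E} {g : ι → ℝ} {c C : ℝ} (hc : 0 < c)
    (hL : IsLinearization u x₀ e g c C) {ξ : E}
    (hL2 : -C ≤ ∑ i, g i * dirD (e i) (dirD (e i) (dirD ξ (dirD ξ u))) x₀)
    {d : ℕ} (bas : OrthonormalBasis (Fin d) ℝ E) {X : Fin d → E → ℝ} {γ : E → ℝ} {b C₁ K : ℝ}
    (hX : ∀ a, CBound S 2 (X a) b) (hγ : CBound S 2 γ b)
    (hC₁ : ∀ a, |dirD (bas a) u x₀| ≤ C₁) (hb0 : 0 ≤ b) (hC₁0 : 0 ≤ C₁)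
    (hK : C * (1 + d * (2 * C₁ + b)) / c + (d * (b * C₁ + b ^ 2) + b) < 2 * K) :
    ¬ IsLocalMax (fun x => dirD ξ (dirD ξ u) x - ∑ a, X a x * dirD (bas a) u x - γ x +
      ∑ a, dirD (bas a) u x * dirD (bas a) u x + K * ‖x‖ ^ 2) x₀ := by
  intro hmax
  have hxS := hΩS hx₀
  have hCn : 0 ≤ C := (abs_nonneg _).trans hL.apply_self
  set C' := d * (b * C₁ + b ^ 2) + b with hC'
  have key : ∀ i, dirD (e i) (dirD (e i) (dirD ξ (dirD ξ u))) x₀ +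
      ∑ a, (2 * dirD (bas a) u x₀ - X a x₀) * dirD (e i) (dirD (e i) (dirD (bas a) u)) x₀ +
      (2 * K - C') ≤ 0 := by
    intro i
    have ja : ∀ a, _ := fun a =>
      hasJet_of_contDiffOn hΩ (hu.dirD hΩ (m := 2) (by norm_num) (bas a)) hx₀ (e i)
    have jξ := hasJet_of_contDiffOn hΩ ((hu.dirD hΩ (m := 3) (by norm_num) ξ).dirD hΩ (m := 2)
      (by norm_num) ξ) hx₀ (e i)
    have jX : ∀ a, _ := fun a => hasJet_of_contDiffOn hΩ ((hX a).1.mono hΩS) hx₀ (e i)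
    have jγ := hasJet_of_contDiffOn hΩ (hγ.1.mono hΩS) hx₀ (e i)
    have j := (((jξ.sub (HasJet.sum (s := Finset.univ) fun a _ => (jX a).mul (ja a))).sub jγ).add
      (HasJet.sum (s := Finset.univ) fun a _ => (ja a).mul (ja a))).add
      ((hasJet_norm_sq x₀ (e i)).const_mul K)
    have h1 := (j.of_isLocalMax (isLocalMax_line hmax (e i))).2
    simp only [zero_smul, add_zero, hL.norm_eq i] at h1
    have γ2 := hγ.dirD_dirD_le hΩ hΩS hS le_rfl hx₀ (e i)
    rw [hL.norm_eq i, one_pow, mul_one] at γ2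
    have hterm : ∀ a, (2 * dirD (bas a) u x₀ - X a x₀) *
          dirD (e i) (dirD (e i) (dirD (bas a) u)) x₀ - (b * C₁ + b ^ 2) ≤
        (dirD (e i) (dirD (e i) (dirD (bas a) u)) x₀ * dirD (bas a) u x₀ +
          2 * (dirD (e i) (dirD (bas a) u) x₀ * dirD (e i) (dirD (bas a) u) x₀) +
          dirD (bas a) u x₀ * dirD (e i) (dirD (e i) (dirD (bas a) u)) x₀) -
        (dirD (e i) (dirD (e i) (X a)) x₀ * dirD (bas a) u x₀ +
          2 * (dirD (e i) (X a) x₀ * dirD (e i) (dirD (bas a) u) x₀) +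
          X a x₀ * dirD (e i) (dirD (e i) (dirD (bas a) u)) x₀) := by
      intro a
      have b1 := (hX a).dirD_le hΩ hΩS hS (by norm_num) hx₀ (e i)
      have b2 := (hX a).dirD_dirD_le hΩ hΩS hS le_rfl hx₀ (e i)
      rw [hL.norm_eq i, mul_one] at b1
      rw [hL.norm_eq i, one_pow, mul_one] at b2
      set X1 := dirD (e i) (X a) x₀
      set X2 := dirD (e i) (dirD (e i) (X a)) x₀
      set ua := dirD (bas a) u x₀
      set uai := dirD (e i) (dirD (bas a) u) x₀
      have q1 : X2 * ua ≤ b * C₁ := by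
        refine (le_abs_self _).trans ?_
        rw [abs_mul]
        exact mul_le_mul b2 (hC₁ a) (abs_nonneg _) hb0
      have q2 : X1 ^ 2 ≤ b ^ 2 := sq_le_sq' (by linarith [neg_abs_le X1]) ((le_abs_self _).trans b1)
      nlinarith [sq_nonneg (X1 - uai), sq_nonneg uai]
    have hs := Finset.sum_le_sum fun a (_ : a ∈ Finset.univ) => hterm a
    rw [Finset.sum_sub_distrib, Finset.sum_sub_distrib] at hs
    simp only [Finset.sum_const, Finset.card_univ, Fintype.card_fin, nsmul_eq_mul] at hs
    have := le_abs_self (dirD (e i) (dirD (e i) γ) x₀)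
    rw [hC']
    linarith
  have hsum := Finset.sum_nonpos fun i (_ : i ∈ Finset.univ) =>
    mul_nonpos_of_nonneg_of_nonpos (hL.nonneg i) (key i)
  have hexp : ∑ i, g i * (dirD (e i) (dirD (e i) (dirD ξ (dirD ξ u))) x₀ +
      ∑ a, (2 * dirD (bas a) u x₀ - X a x₀) * dirD (e i) (dirD (e i) (dirD (bas a) u)) x₀ +
      (2 * K - C')) =
      ∑ i, g i * dirD (e i) (dirD (e i) (dirD ξ (dirD ξ u))) x₀ +
      ∑ a, (2 * dirD (bas a) u x₀ - X a x₀) *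
        (∑ i, g i * dirD (e i) (dirD (e i) (dirD (bas a) u)) x₀) +
      (2 * K - C') * ∑ i, g i := by
    simp only [Finset.mul_sum, mul_add, Finset.sum_add_distrib]
    congr 1
    · congr 1
      rw [Finset.sum_comm]
      exact Finset.sum_congr rfl fun a _ => Finset.sum_congr rfl fun i _ => by ring
    · exact Finset.sum_congr rfl fun i _ => by ring
  rw [hexp] at hsum
  have h2 : -(d * ((2 * C₁ + b) * C)) ≤ ∑ a, (2 * dirD (bas a) u x₀ - X a x₀) *
        (∑ i, g i * dirD (e i) (dirD (e i) (dirD (bas a) u)) x₀) := by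
    have : -(d * ((2 * C₁ + b) * C)) = ∑ _a : Fin d, -((2 * C₁ + b) * C) := by simp
    rw [this]
    refine Finset.sum_le_sum fun a _ => ?_
    refine (abs_le.1 ?_).1
    rw [abs_mul]
    refine mul_le_mul ?_ (hL.apply_dirD _ (by simp)) (abs_nonneg _) (by positivity)
    refine (abs_sub _ _).trans (add_le_add ?_ ((hX a).norm_le hxS))
    rw [abs_mul, abs_two]
    linarith [hC₁ a]
  have h3 : C * (1 + d * (2 * C₁ + b)) < (2 * K - C') * ∑ i, g i := by
    have h4 : C * (1 + d * (2 * C₁ + b)) / c < 2 * K - C' := by linarith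
    have h5 : 0 ≤ C * (1 + d * (2 * C₁ + b)) / c := by positivity
    calc C * (1 + d * (2 * C₁ + b)) = C * (1 + d * (2 * C₁ + b)) / c * c := by field_simp
      _ < (2 * K - C') * c := mul_lt_mul_of_pos_right h4 hc
      _ ≤ _ := mul_le_mul_of_nonneg_left hL.le_sum (by linarith)
  linarith

end HessianEstimate

/-! ### Tangential fields and the twice differentiated boundary condition. -/

section HessianBound

variable {E : Type*} [NormedAddCommGroup E] [InnerProductSpace ℝ E] {Ω : Set E} {u : E → ℝ}
  {N : E → E} {κ : ℝ}

/-- The tangential part of the constant vector field `ξ`. -/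
noncomputable def tanPart (N : E → E) (ξ x : E) : E := ξ + (-1 : ℝ) • ((inner ℝ ξ (N x) : ℝ) • N x)

theorem tanPart_of_inner_eq_zero {ξ x : E} (h : inner ℝ ξ (N x) = 0) : tanPart N ξ x = ξ := by
  simp [tanPart, h]

theorem inner_tanPart {ξ x : E} (h : ‖N x‖ = 1) : inner ℝ (tanPart N ξ x) (N x) = 0 := by
  rw [tanPart, inner_add_left, real_inner_smul_left, real_inner_smul_left,
    real_inner_self_eq_norm_sq, h]
  ring

theorem cbound_tanPart {S : Set E} (hS : UniqueDiffOn ℝ S) (hne : S.Nonempty) {b : ℝ}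
    (hN : CBound S 2 N b) {ξ : E} (hξ : ‖ξ‖ = 1) :
    CBound S 2 (tanPart N ξ) (1 + 2 ^ 2 * (1 * (2 ^ 2 * (2 ^ 2 * b * b)))) := by
  have h := (CBound.const 2 ξ).add hS ((CBound.const 2 (-1 : ℝ)).smul hS
    ((cbound_inner_normal hS hN hne hξ.le).smul hS hN))
  rw [hξ, norm_neg, norm_one] at h
  exact h

/-- The first order part of the boundary expression for the mixed second derivative. -/
noncomputable def mixedField (S : Set E) (N : E → E) (ε : ℝ) (ξ x : E) : E :=
  fderivWithin ℝ N S x (tanPart N ξ x) + ε • tanPart N ξ x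

theorem cbound_mixedField {S : Set E} (hS : UniqueDiffOn ℝ S) (hne : S.Nonempty) {b : ℝ}
    (hN : CBound S 3 N b) {ε : ℝ} (hε0 : 0 < ε) (hε1 : ε < 1) {ξ : E} {bT : ℝ}
    (hT : CBound S 2 (tanPart N ξ) bT) :
    CBound S 2 (mixedField S N ε ξ) (2 ^ 2 * (b * bT) + 2 ^ 2 * (1 * bT)) := by
  have h := ((hN.fderivWithin hS).clm_apply hS hT).add hS ((CBound.const 2 ε).smul hS hT)
  refine h.mono ?_
  have := hT.nonneg hne
  rw [Real.norm_eq_abs, abs_of_pos hε0]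
  have : ε * bT ≤ 1 * bT := mul_le_mul_of_nonneg_right hε1.le this
  linarith

/-- First-order condition for a maximal direction: perturbing ξ by s times an orthogonal tangential
v gives 2sB(ξ,v) ≤ s²D for every s, which forces B(ξ,v) = 0. -/
theorem apply_eq_of_maximal {B : E →L[ℝ] E →L[ℝ] ℝ} (hB : ∀ a b, B a b = B b a) {ν ξ : E}
    {m : ℝ} (hξ : ‖ξ‖ = 1) (hξν : inner ℝ ξ ν = 0) (hm : B ξ ξ = m)
    (hmax : ∀ v, inner ℝ v ν = 0 → B v v ≤ m * ‖v‖ ^ 2) {w : E} (hw : inner ℝ w ν = 0) :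
    B ξ w = inner ℝ ξ w * m := by
  set k : ℝ := inner ℝ ξ w with hk
  set v := w - k • ξ with hv
  have hvν : inner ℝ v ν = 0 := by
    rw [hv, inner_sub_left, real_inner_smul_left, hw, hξν]; ring
  have hξv : inner ℝ ξ v = 0 := by
    rw [hv, inner_sub_right, inner_smul_right, real_inner_self_eq_norm_sq, hξ, ← hk]; ring
  have hD := hmax v hvν
  set D := m * ‖v‖ ^ 2 - B v v with hDdef
  have hs : ∀ s : ℝ, 2 * s * B ξ v ≤ s ^ 2 * D := by
    intro s
    have h1 := hmax (ξ + s • v) (by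
      rw [inner_add_left, real_inner_smul_left, hξν, hvν]; ring)
    rw [norm_add_sq_real, inner_smul_right, hξv, norm_smul, hξ, mul_pow, Real.norm_eq_abs,
      sq_abs] at h1
    simp only [map_add, map_smul, _root_.add_apply, _root_.smul_apply, smul_eq_mul, hm,
      hB v ξ] at h1
    rw [hDdef]
    linarith
  have hb : B ξ v = 0 := by
    set β := B ξ v
    have hD0 : 0 ≤ D := by linarith
    -- With D + 1 in the denominator the choice also works for D = 0; it yields 2β²(D+1) ≤ β²D,
    -- hence β = 0.
    have h1 := hs (β / (D + 1))
    have hD1 : 0 < D + 1 := by linarith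
    have h2 : (β / (D + 1)) ^ 2 * (D + 1) ^ 2 = β ^ 2 := by field_simp
    have h3 : 2 * (β / (D + 1)) * β * (D + 1) ^ 2 = 2 * β ^ 2 * (D + 1) := by field_simp
    have h4 := mul_le_mul_of_nonneg_right h1 (sq_nonneg (D + 1))
    have h5 : 2 * β ^ 2 * (D + 1) ≤ β ^ 2 * D := by
      calc 2 * β ^ 2 * (D + 1) = 2 * (β / (D + 1)) * β * (D + 1) ^ 2 := h3.symm
        _ ≤ (β / (D + 1)) ^ 2 * D * (D + 1) ^ 2 := h4
        _ = (β / (D + 1)) ^ 2 * (D + 1) ^ 2 * D := by ring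
        _ = _ := by rw [h2]
    have h6 : β ^ 2 ≤ 0 := by nlinarith [sq_nonneg β]
    exact pow_eq_zero_iff (two_ne_zero) |>.1 (le_antisymm h6 (sq_nonneg β))
  have : w = v + k • ξ := by rw [hv]; abel
  conv_lhs => rw [this]
  rw [map_add, map_smul, hb, hm, smul_eq_mul, zero_add]

/-- The first tangential identity holds along the whole boundary for the field `tanPart N ξ`, so its
left side vanishes there and can be differentiated again along ξ. At x the field equals ξ and its
derivative along ξ is -⟨ξ, DN ξ⟩N, the source of the double normal terms. -/
theorem IsNeumannSolution.third_order_identity {Φ : E → ℝ} {ε : ℝ}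
    (hu : IsNeumannSolution Ω N Φ ε u)
    (hN : IsNormalField Ω N κ) (hΦ : ContDiffOn ℝ 2 Φ (closure Ω)) {x : E} (hx : x ∈ frontier Ω)
    {ξ : E} (hξ : inner ℝ ξ (N x) = 0) {U1 : E → E →L[ℝ] ℝ} {U2 : E → E →L[ℝ] E →L[ℝ] ℝ}
    {DN : E → E →L[ℝ] E} {DΦ : E → E →L[ℝ] ℝ}
    (hU1 : U1 = fderivWithin ℝ u (closure Ω)) (hU2 : U2 = fderivWithin ℝ U1 (closure Ω))
    (hDN : DN = fderivWithin ℝ N (closure Ω)) (hDΦ : DΦ = fderivWithin ℝ Φ (closure Ω)) :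
    fderivWithin ℝ U2 (closure Ω) x ξ ξ (N x) + 2 * U2 x ξ (DN x ξ) -
      inner ℝ ξ (DN x ξ) * U2 x (N x) (N x) + ε * U2 x ξ ξ +
      U1 x (fderivWithin ℝ DN (closure Ω) x ξ ξ) - inner ℝ ξ (DN x ξ) * U1 x (DN x (N x)) -
      inner ℝ ξ (DN x ξ) * (ε * U1 x (N x)) - fderivWithin ℝ DΦ (closure Ω) x ξ ξ +
      inner ℝ ξ (DN x ξ) * DΦ x (N x) = 0 := by
  have hxS := frontier_subset_closure hx
  have hS := hN.uniqueDiffOn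
  have hU1c : ContDiffOn ℝ 2 U1 (closure Ω) := by
    rw [hU1]; exact hu.contDiffOn_closure.fderivWithin hS (by norm_num)
  have hU2c : ContDiffOn ℝ 1 U2 (closure Ω) := by
    rw [hU2]; exact hU1c.fderivWithin hS (by norm_num)
  have hDNc : ContDiffOn ℝ 2 DN (closure Ω) := by
    rw [hDN]; exact hN.contDiffOn.fderivWithin hS (by norm_num)
  have hDΦc : ContDiffOn ℝ 1 DΦ (closure Ω) := by
    rw [hDΦ]; exact hΦ.fderivWithin hS (by norm_num)
  have dU1 : HasFDerivWithinAt U1 (U2 x) (closure Ω) x := by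
    rw [hU2]; exact (hU1c.differentiableOn (by norm_num) x hxS).hasFDerivWithinAt
  have dU2 := (hU2c.differentiableOn (by norm_num) x hxS).hasFDerivWithinAt
  have dDN := (hDNc.differentiableOn (by norm_num) x hxS).hasFDerivWithinAt
  have dDΦ := (hDΦc.differentiableOn (by norm_num) x hxS).hasFDerivWithinAt
  have dN : HasFDerivWithinAt N (DN x) (closure Ω) x := by
    rw [hDN]; exact hN.hasFDerivWithinAt_normal hxS
  have dβ : HasFDerivWithinAt (fun y => (inner ℝ ξ (N y) : ℝ)) ((innerSL ℝ ξ).comp (DN x))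
      (closure Ω) x := (innerSL ℝ ξ).hasFDerivAt.comp_hasFDerivWithinAt x dN
  have dT : HasFDerivWithinAt (tanPart N ξ) _ (closure Ω) x :=
    ((dβ.smul dN).const_smul (-1 : ℝ)).const_add ξ
  have dQ := (((dU1.clm_apply (dDN.clm_apply dT)).add ((dU2.clm_apply dT).clm_apply dN)).add
    ((dU1.clm_apply dT).const_mul ε)).sub (dDΦ.clm_apply dT)
  have h := hN.tangential_deriv_eq_zero hx dQ (fun y hy => by
    simp only [Pi.add_apply, Pi.sub_apply]
    have := hu.tangential_identity hN (hΦ.of_le (by norm_num)) hy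
      (inner_tanPart (ξ := ξ) (hN.norm_eq y hy))
    rw [← hU1, ← hU2, ← hDN, ← hDΦ] at this
    exact this) hξ
  simp [tanPart_of_inner_eq_zero hξ, hξ] at h
  linarith

end HessianBound

/-! ### The Hessian at a tangential boundary maximum. -/

section HessianBoundary

variable {E : Type*} [NormedAddCommGroup E] [InnerProductSpace ℝ E] {Ω : Set E} {u : E → ℝ}
  {N : E → E} {κ : ℝ}

theorem fderivWithin_fderivWithin_eq_dirD {S : Set E} (hΩ : IsOpen Ω) (hΩS : Ω ⊆ S)
    (hu : ContDiffOn ℝ 2 u Ω) {x : E} (hx : x ∈ Ω) (a b : E) :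
    fderivWithin ℝ (fderivWithin ℝ u S) S x a b = dirD a (dirD b u) x := by
  rw [dirD_eq_iterated hu hΩ hx,
    fderivWithin_of_mem_nhds (mem_of_superset (hΩ.mem_nhds hx) hΩS)]
  have : fderivWithin ℝ u S =ᶠ[𝓝 x] fderiv ℝ u := by
    filter_upwards [hΩ.mem_nhds hx] with y hy
    exact fderivWithin_of_mem_nhds (mem_of_superset (hΩ.mem_nhds hy) hΩS)
  rw [this.fderiv_eq]

theorem third_fderivWithin_comm (hN : IsNormalField Ω N κ) (hu : ContDiffOn ℝ 3 u (closure Ω))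
    {x : E} (hx : x ∈ closure Ω) {U2 : E → E →L[ℝ] E →L[ℝ] ℝ}
    (hU2 : U2 = fderivWithin ℝ (fderivWithin ℝ u (closure Ω)) (closure Ω)) (a b : E) :
    fderivWithin ℝ U2 (closure Ω) x a b b = fderivWithin ℝ U2 (closure Ω) x b b a := by
  have hS := hN.uniqueDiffOn
  have hU1c : ContDiffOn ℝ 2 (fderivWithin ℝ u (closure Ω)) (closure Ω) :=
    hu.fderivWithin hS (by norm_num)
  have hU2c : ContDiffOn ℝ 1 U2 (closure Ω) := by
    rw [hU2]; exact hU1c.fderivWithin hS (by norm_num)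
  have dU2 := (hU2c.differentiableOn (by norm_num) x hx).hasFDerivWithinAt
  have h1 : fderivWithin ℝ U2 (closure Ω) x a b = fderivWithin ℝ U2 (closure Ω) x b a := by
    rw [hU2]; exact isSymm_fderivWithin hN hU1c hx a b
  have d1 : ∀ p q : E, HasFDerivWithinAt (fun y => U2 y p q) _ (closure Ω) x := fun p q =>
    (dU2.clm_apply (hasFDerivWithinAt_const p x (closure Ω))).clm_apply
      (hasFDerivWithinAt_const q x (closure Ω))
  have h2 := (d1 a b).congr (f₁ := fun y => U2 y b a) (fun y hy => by
    rw [hU2]; exact isSymm_fderivWithin hN (hu.of_le (by norm_num)) hy b a) (by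
    rw [hU2]; exact isSymm_fderivWithin hN (hu.of_le (by norm_num)) hx b a)
  have h3 := congrArg (fun T : E →L[ℝ] ℝ => T b) ((hS x hx).eq h2 (d1 b a))
  simp at h3
  rw [h1, h3]

variable [FiniteDimensional ℝ E]

theorem norm_rieszVec_le (T : E →L[ℝ] ℝ) : ‖rieszVec T‖ ≤ ‖T‖ := by
  have h1 : ‖rieszVec T‖ ^ 2 = T (rieszVec T) := by
    rw [← real_inner_self_eq_norm_sq, inner_rieszVec]
  have h2 := (le_abs_self _).trans (T.le_opNorm (rieszVec T))
  by_contra! hc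
  have := norm_nonneg T
  nlinarith

/-- The third derivative D³u(ν,ξ,ξ) is bounded below by the maximum condition and is computed by the
third-order identity. Maximality of ξ turns 2D²u(ξ, DN ξ) into 2m times the normal curvature, at
least 2κm. The other terms involve first derivatives, known mixed derivatives, D_{νν}u, or εm with a
favourable sign. -/
theorem IsNeumannSolution.curvature_mul_le {Φ : E → ℝ} {ε : ℝ}
    (hu : IsNeumannSolution Ω N Φ ε u) (hN : IsNormalField Ω N κ) (hε0 : 0 < ε) (hε1 : ε < 1)
    {b B C₁ K M R Zb : ℝ} (hb : CBound (closure Ω) 3 N b) (hΦ : CBound (closure Ω) 3 Φ B) {x : E}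
    (hx : x ∈ frontier Ω) (hR : ‖x‖ ≤ R) (hK : 0 ≤ K) {ξ : E} (hξ : ‖ξ‖ = 1)
    (hξν : inner ℝ ξ (N x) = 0)
    {U1 : E → E →L[ℝ] ℝ} {U2 : E → E →L[ℝ] E →L[ℝ] ℝ}
    (hU1 : U1 = fderivWithin ℝ u (closure Ω)) (hU2 : U2 = fderivWithin ℝ U1 (closure Ω))
    (hC₁ : ‖U1 x‖ ≤ C₁) (hM : |U2 x (N x) (N x)| ≤ M) {Z : E → ℝ}
    (hZ : DifferentiableWithinAt ℝ Z (closure Ω) x) (hZb : |Z x| ≤ Zb) {m : ℝ} (hm0 : 0 ≤ m)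
    (hm : U2 x ξ ξ = m) (hmax : ∀ v, inner ℝ v (N x) = 0 → U2 x v v ≤ m * ‖v‖ ^ 2)
    (hW : ∀ y ∈ closure Ω, U2 y ξ ξ - 2 * (inner ℝ ξ (N y) * Z y) +
        ∑ i, U1 y (stdOrthonormalBasis ℝ E i) * U1 y (stdOrthonormalBasis ℝ E i) + K * ‖y‖ ^ 2 ≤
      U2 x ξ ξ - 2 * (inner ℝ ξ (N x) * Z x) +
        ∑ i, U1 x (stdOrthonormalBasis ℝ E i) * U1 x (stdOrthonormalBasis ℝ E i) + K * ‖x‖ ^ 2) :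
    2 * (κ * m) ≤ (b * M + C₁ * b + b * (C₁ * b) + b * C₁ + B + b * B) + 2 * (b * Zb) +
      2 * ((C₁ * b + C₁ + B) * (2 * C₁) + C₁ * M) + 2 * (K * R) := by
  have hxS := frontier_subset_closure hx
  have hS := hN.uniqueDiffOn
  set S := closure Ω with hSdef
  have hb0 : 0 ≤ b := hb.nonneg ⟨x, hxS⟩
  have hB0 : 0 ≤ B := hΦ.nonneg ⟨x, hxS⟩
  have hC0 : 0 ≤ C₁ := (norm_nonneg _).trans hC₁
  set ν := N x with hν
  have hν1 : ‖ν‖ = 1 := hN.norm_eq x hx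
  have hU1c : ContDiffOn ℝ 2 U1 S := by
    rw [hU1]; exact hu.contDiffOn_closure.fderivWithin hS (by norm_num)
  have hU2c : ContDiffOn ℝ 1 U2 S := by
    rw [hU2]; exact hU1c.fderivWithin hS (by norm_num)
  have hsymm : ∀ p q, U2 x p q = U2 x q p := fun p q => by
    rw [hU2, hU1]
    exact isSymm_fderivWithin hN (hu.contDiffOn_closure.of_le (by norm_num)) hxS p q
  have hU1le : ∀ {v : E} {r : ℝ}, ‖v‖ ≤ r → |U1 x v| ≤ C₁ * r := fun {v r} hv =>
    ((U1 x).le_opNorm v).trans (mul_le_mul hC₁ hv (norm_nonneg _) hC0)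
  set DN := fderivWithin ℝ N S with hDN
  set DΦ := fderivWithin ℝ Φ S with hDΦ
  have bDN := hb.fderivWithin hS
  have bDΦ := hΦ.fderivWithin hS
  have hDNle : ∀ v, ‖DN x v‖ ≤ b * ‖v‖ := fun v =>
    ((DN x).le_opNorm v).trans (mul_le_mul_of_nonneg_right (bDN.norm_le hxS) (norm_nonneg _))
  have hDΦle : ∀ v, |DΦ x v| ≤ B * ‖v‖ := fun v =>
    ((DΦ x).le_opNorm v).trans (mul_le_mul_of_nonneg_right (bDΦ.norm_le hxS) (norm_nonneg _))
  have third := hu.third_order_identity hN (hΦ.1.of_le (by norm_num)) hx hξν hU1 hU2 hDN hDΦ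
  rw [← hSdef, ← hν] at third
  have k1 : inner ℝ ν (DN x ξ) = 0 := hN.inner_normal_fderivWithin hx hξν
  have k2 := hN.curvature x hx ξ hξν
  rw [hξ, one_pow, mul_one, ← hSdef, ← hDN] at k2
  have k3 : U2 x ξ (DN x ξ) = inner ℝ ξ (DN x ξ) * m :=
    apply_eq_of_maximal hsymm hξ hξν hm hmax (by rw [real_inner_comm]; exact k1)
  set h := (inner ℝ ξ (DN x ξ) : ℝ) with hh
  have hhb : |h| ≤ b := by
    refine (abs_real_inner_le_norm _ _).trans ?_
    rw [hξ, one_mul]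
    simpa [hξ] using hDNle ξ
  have dU1 : HasFDerivWithinAt U1 (U2 x) S x := by
    rw [hU2]; exact (hU1c.differentiableOn (by norm_num) x hxS).hasFDerivWithinAt
  have dU2 := (hU2c.differentiableOn (by norm_num) x hxS).hasFDerivWithinAt
  have dN : HasFDerivWithinAt N (DN x) S x := hN.hasFDerivWithinAt_normal hxS
  have dβ : HasFDerivWithinAt (fun y => (inner ℝ ξ (N y) : ℝ)) ((innerSL ℝ ξ).comp (DN x)) S x :=
    (innerSL ℝ ξ).hasFDerivAt.comp_hasFDerivWithinAt x dN
  have dc : ∀ v : E, HasFDerivWithinAt (fun _ : E => v) (0 : E →L[ℝ] E) S x := fun v =>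
    hasFDerivWithinAt_const v x S
  have dsum : HasFDerivWithinAt (fun y => ∑ i, U1 y (stdOrthonormalBasis ℝ E i) *
      U1 y (stdOrthonormalBasis ℝ E i)) _ S x :=
    HasFDerivWithinAt.fun_sum fun i _ => (dU1.clm_apply (dc (stdOrthonormalBasis ℝ E i))).mul
      (dU1.clm_apply (dc (stdOrthonormalBasis ℝ E i)))
  have dW := ((((dU2.clm_apply (dc ξ)).clm_apply (dc ξ)).sub
    ((dβ.mul hZ.hasFDerivWithinAt).const_mul 2)).add dsum).add
    (((hasFDerivAt_id x).norm_sq.hasFDerivWithinAt (s := S)).const_mul K)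
  have hWν := hN.normal_deriv_nonneg hx dW hW
  simp [hξν, ← hν] at hWν
  set p := rieszVec (U1 x) with hp
  have hsum : ∑ i, (U1 x (stdOrthonormalBasis ℝ E i) * U2 x ν (stdOrthonormalBasis ℝ E i) +
      U1 x (stdOrthonormalBasis ℝ E i) * U2 x ν (stdOrthonormalBasis ℝ E i)) = 2 * U2 x ν p := by
    rw [hp, rieszVec, map_sum, Finset.mul_sum]
    refine Finset.sum_congr rfl fun i _ => ?_
    rw [map_smul, smul_eq_mul]; ring
  rw [hsum] at hWν
  have hp1 : ‖p‖ ≤ C₁ := (norm_rieszVec_le _).trans hC₁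
  have hpν : |(inner ℝ p ν : ℝ)| ≤ C₁ := by
    refine (abs_real_inner_le_norm _ _).trans ?_
    rwa [hν1, mul_one]
  -- The normal derivative of |Du|² is 2D²u(ν, Du). Splitting Du into tangential and normal parts
  -- leaves a mixed derivative, known from the boundary condition, and D_{νν}u, bounded by M.
  set q := tanPart N p x with hq
  have hqν : inner ℝ q ν = 0 := inner_tanPart hν1
  have hqn : ‖q‖ ≤ 2 * C₁ := by
    rw [hq, tanPart]
    refine (norm_add_le _ _).trans ?_
    rw [norm_smul, norm_smul, ← hν, hν1, Real.norm_eq_abs, Real.norm_eq_abs, abs_neg, abs_one]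
    linarith
  have hpq : U2 x ν p = U2 x q ν + inner ℝ p ν * U2 x ν ν := by
    rw [← hsymm ν q, hq, tanPart, ← hν]
    simp
  have hq1 := hu.tangential_identity hN (hΦ.1.of_le (by norm_num)) hx hqν
  rw [← hSdef, ← hU1, ← hU2, ← hDN, ← hDΦ, ← hν] at hq1
  have l1 : |U1 x (DN x q)| ≤ C₁ * (b * (2 * C₁)) :=
    hU1le ((hDNle q).trans (mul_le_mul_of_nonneg_left hqn hb0))
  have l2 : |ε * U1 x q| ≤ 1 * (C₁ * (2 * C₁)) := by
    rw [abs_mul, abs_of_pos hε0]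
    exact mul_le_mul hε1.le (hU1le hqn) (abs_nonneg _) zero_le_one
  have l3 : |DΦ x q| ≤ B * (2 * C₁) := (hDΦle q).trans (mul_le_mul_of_nonneg_left hqn hB0)
  have l4 : |inner ℝ p ν * U2 x ν ν| ≤ C₁ * M := by
    rw [abs_mul]; exact mul_le_mul hpν hM (abs_nonneg _) hC0
  have l5 : |Z x * inner ℝ ξ (DN x ν)| ≤ Zb * b := by
    rw [abs_mul]
    refine mul_le_mul hZb ?_ (abs_nonneg _) ((abs_nonneg _).trans hZb)
    refine (abs_real_inner_le_norm _ _).trans ?_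
    rw [hξ, one_mul]
    simpa [hν1] using hDNle ν
  have l6 : K * (2 * inner ℝ x ν) ≤ 2 * (K * R) := by
    have e1 := real_inner_le_norm x ν
    rw [hν1, mul_one] at e1
    have e2 := mul_le_mul_of_nonneg_left (e1.trans hR) hK
    linarith
  have l7 : |h * U2 x ν ν| ≤ b * M := by
    rw [abs_mul]; exact mul_le_mul hhb hM (abs_nonneg _) hb0
  have l8 : |U1 x (fderivWithin ℝ DN S x ξ ξ)| ≤ C₁ * b := by
    refine hU1le (((fderivWithin ℝ DN S x).le_opNorm₂ ξ ξ).trans ?_)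
    rw [hξ, mul_one, mul_one]
    exact bDN.norm_fderivWithin_le hS (by norm_num) hxS
  have l9 : |h * U1 x (DN x ν)| ≤ b * (C₁ * b) := by
    rw [abs_mul]
    exact mul_le_mul hhb (hU1le (by simpa [hν1] using hDNle ν)) (abs_nonneg _) hb0
  have l10 : |h * (ε * U1 x ν)| ≤ b * C₁ := by
    rw [abs_mul]
    refine mul_le_mul hhb ?_ (abs_nonneg _) hb0
    rw [abs_mul, abs_of_pos hε0]
    have e1 := mul_le_mul hε1.le (hU1le hν1.le) (abs_nonneg _) zero_le_one
    rwa [one_mul, mul_one] at e1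
  have l11 : |fderivWithin ℝ DΦ S x ξ ξ| ≤ B := by
    refine ((fderivWithin ℝ DΦ S x).le_opNorm₂ ξ ξ).trans ?_
    rw [hξ, mul_one, mul_one]
    exact bDΦ.norm_fderivWithin_le hS (by norm_num) hxS
  have l12 : |h * DΦ x ν| ≤ b * B := by
    rw [abs_mul]
    exact mul_le_mul hhb (by simpa [hν1] using hDΦle ν) (abs_nonneg _) hb0
  have l13 : κ * m ≤ h * m := mul_le_mul_of_nonneg_right k2 hm0
  have l14 : 0 ≤ ε * m := by positivity
  rw [k3, hm] at third
  rw [third_fderivWithin_comm hN hu.contDiffOn_closure hxS (by rw [hU2, hU1]) ν ξ, ← hSdef,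
    hpq] at hWν
  linarith only [third, hWν, hq1, l6, l13, l14, (abs_le.1 l1).1, (abs_le.1 l2).1, (abs_le.1 l3).2,
    (abs_le.1 l4).2, (abs_le.1 l5).1, (abs_le.1 l7).2, (abs_le.1 l8).1, (abs_le.1 l9).2,
    (abs_le.1 l10).2, (abs_le.1 l11).2, (abs_le.1 l12).1]

end HessianBoundary

/-! ### The one-sided Hessian bound on the closure. -/

section HessianEstimate

variable {E : Type*} [NormedAddCommGroup E] [InnerProductSpace ℝ E] {Ω : Set E}
  {N : E → E} {κ : ℝ}

theorem apply_le_mul_norm_sq {B : E →L[ℝ] E →L[ℝ] ℝ} {ν : E} {m : ℝ}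
    (h : ∀ v, ‖v‖ = 1 → inner ℝ v ν = 0 → B v v ≤ m) {v : E} (hv : inner ℝ v ν = 0) :
    B v v ≤ m * ‖v‖ ^ 2 := by
  by_cases hv0 : v = 0
  · simp [hv0]
  have hn : 0 < ‖v‖ := norm_pos_iff.2 hv0
  have h1 := h (‖v‖⁻¹ • v) (by rw [norm_smul, norm_inv, norm_norm, inv_mul_cancel₀ hn.ne'])
    (by rw [real_inner_smul_left, hv, mul_zero])
  simp only [map_smul, _root_.smul_apply, smul_eq_mul] at h1
  have h2 := mul_le_mul_of_nonneg_right h1 (sq_nonneg ‖v‖)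
  calc B v v = ‖v‖⁻¹ * (‖v‖⁻¹ * B v v) * ‖v‖ ^ 2 := by field_simp
    _ ≤ _ := h2

theorem norm_tanPart_sq {ξ x : E} (h : ‖N x‖ = 1) (hξ : ‖ξ‖ = 1) :
    ‖tanPart N ξ x‖ ^ 2 = 1 - inner ℝ ξ (N x) ^ 2 := by
  rw [tanPart, norm_add_sq_real, inner_smul_right, inner_smul_right, norm_smul, norm_smul, h, hξ]
  simp
  ring

variable [FiniteDimensional ℝ E]

theorem sum_inner_mul_apply (T : E →L[ℝ] ℝ) (v : E) :
    ∑ i, inner ℝ (stdOrthonormalBasis ℝ E i) v * T (stdOrthonormalBasis ℝ E i) = T v := by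
  conv_rhs => rw [← (stdOrthonormalBasis ℝ E).sum_repr' v]
  rw [map_sum]
  exact Finset.sum_congr rfl fun i _ => by rw [map_smul, smul_eq_mul]

-- The correction by Z removes the mixed part of D²u(ξ,ξ) on the boundary, so only purely tangential
-- and double normal terms compete at a boundary maximum. All constants depend on b, κ, R and the a
-- priori bounds, and are affine in M.
set_option maxHeartbeats 1000000 in
theorem exists_hessian_bound (hN : IsNormalField Ω N κ) [Nontrivial E] {c : ℝ} (hc : 0 < c)
    (C B C₁ : ℝ) :
    ∃ C₂ : ℝ, 0 ≤ C₂ ∧ ∀ (u Φ : E → ℝ) (ε M : ℝ), 0 < ε → ε < 1 → IsNeumannSolution Ω N Φ ε u →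
      CBound (closure Ω) 3 Φ B → (∀ x ∈ closure Ω, ‖fderivWithin ℝ u (closure Ω) x‖ ≤ C₁) →
      (∀ x ∈ frontier Ω, |fderivWithin ℝ (fderivWithin ℝ u (closure Ω)) (closure Ω) x (N x) (N x)|
        ≤ M) →
      (∀ x₀ ∈ Ω, ∃ (ι : Type) (_ : Fintype ι) (e : ι → E) (g : ι → ℝ),
        IsLinearization u x₀ e g c C ∧ ∀ ξ, ‖ξ‖ = 1 →
          -C ≤ ∑ i, g i * dirD (e i) (dirD (e i) (dirD ξ (dirD ξ u))) x₀) →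
      ∀ x ∈ closure Ω, ∀ ξ, ‖ξ‖ = 1 →
        fderivWithin ℝ (fderivWithin ℝ u (closure Ω)) (closure Ω) x ξ ξ ≤ C₂ * (1 + M) := by
  have hS := hN.uniqueDiffOn
  have hcomp : IsCompact (closure Ω) := hN.isBounded.isCompact_closure
  have hSne : (closure Ω).Nonempty := hN.nonempty.closure
  obtain ⟨b, hb⟩ := CBound.exists_of_isCompact hS hcomp hN.contDiffOn
  obtain ⟨R, hR⟩ := hcomp.exists_bound_of_continuousOn (f := fun x : E => x) continuousOn_id
  have hb0 := hb.nonneg hSne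
  have hR0 : 0 ≤ R := (norm_nonneg _).trans (hR _ hSne.some_mem)
  set bT : ℝ := 1 + 2 ^ 2 * (1 * (2 ^ 2 * (2 ^ 2 * b * b))) with hbT
  set bM : ℝ := 2 ^ 2 * (b * bT) + 2 ^ 2 * (1 * bT) with hbM
  set bX : ℝ := 2 ^ 2 * (1 * (2 ^ 2 * (2 * (2 ^ 2 * (2 ^ 2 * b * bM))))) with hbX
  set bγ : ℝ := 2 ^ 2 * (2 * (2 ^ 2 * (2 ^ 2 * b * (2 ^ 2 * (|B| * bT))))) with hbγ
  have hbT0 : 0 ≤ bT := by positivity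
  have hbM0 : 0 ≤ bM := by positivity
  have hbX0 : 0 ≤ bX := by positivity
  have hbγ0 : 0 ≤ bγ := by positivity
  set d := Module.finrank ℝ E with hd
  set K := |C * (1 + d * (2 * |C₁| + (bX + bγ))) / c +
    (d * ((bX + bγ) * |C₁| + (bX + bγ) ^ 2) + (bX + bγ))| + 1 with hKdef
  have hK0 : 0 ≤ K := by positivity
  set Zb := |C₁| * bM + |B| * bT with hZb
  have hZb0 : 0 ≤ Zb := by positivity
  have hκ := hN.pos
  set D₁ := (|C₁| * b + b * (|C₁| * b) + b * |C₁| + |B| + b * |B|) + 2 * (b * Zb) +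
      2 * ((|C₁| * b + |C₁| + |B|) * (2 * |C₁|)) + 2 * (K * R) with hD₁
  set D₂ := b + 2 * |C₁| with hD₂
  have hD₁0 : 0 ≤ D₁ := by positivity
  have hD₂0 : 0 ≤ D₂ := by positivity
  set R₀ := d * |C₁| ^ 2 + K * R ^ 2 + 2 * (b * Zb) with hR₀
  have hR₀0 : 0 ≤ R₀ := by positivity
  refine ⟨1 + (D₁ + D₂) / (2 * κ) + R₀, by positivity, ?_⟩
  intro u Φ ε M hε0 hε1 hu hΦ' hC₁' hM hlin
  have hΦ : CBound (closure Ω) 3 Φ |B| := hΦ'.mono (le_abs_self _)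
  have hC₁ : ∀ x ∈ closure Ω, ‖fderivWithin ℝ u (closure Ω) x‖ ≤ |C₁| := fun x hx =>
    (hC₁' x hx).trans (le_abs_self _)
  set S := closure Ω with hSdef
  set U1 := fderivWithin ℝ u S with hU1
  set U2 := fderivWithin ℝ U1 S with hU2
  set DΦ := fderivWithin ℝ Φ S with hDΦ
  have hU1c : ContDiffOn ℝ 2 U1 S := hu.contDiffOn_closure.fderivWithin hS (by norm_num)
  have hU2c : ContDiffOn ℝ 1 U2 S := hU1c.fderivWithin hS (by norm_num)
  have hb2 : CBound S 2 N b := hb.of_le (by norm_num)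
  have bDΦ : CBound S 2 DΦ |B| := hΦ.fderivWithin hS
  have hT : ∀ ξ, ‖ξ‖ = 1 → CBound S 2 (tanPart N ξ) bT := fun ξ hξ => cbound_tanPart hS hSne hb2 hξ
  have hY : ∀ ξ, ‖ξ‖ = 1 → CBound S 2 (mixedField S N ε ξ) bM := fun ξ hξ =>
    cbound_mixedField hS hSne hb hε0 hε1 (hT ξ hξ)
  -- Defined on the whole closure; on the boundary the tangential identity makes it the mixed
  -- derivative D²u(T, N) with T the tangential part of ξ.
  set Z : E → E → ℝ := fun ξ x => -U1 x (mixedField S N ε ξ x) + DΦ x (tanPart N ξ x) with hZ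
  have hZle : ∀ ξ, ‖ξ‖ = 1 → ∀ x ∈ S, |Z ξ x| ≤ Zb := fun ξ hξ x hx => by
    refine (abs_add_le _ _).trans (add_le_add ?_ ?_)
    · rw [abs_neg]
      exact ((U1 x).le_opNorm _).trans (mul_le_mul (hC₁ x hx) ((hY ξ hξ).norm_le hx)
        (norm_nonneg _) (abs_nonneg _))
    · exact ((DΦ x).le_opNorm _).trans (mul_le_mul (bDΦ.norm_le hx) ((hT ξ hξ).norm_le hx)
        (norm_nonneg _) (abs_nonneg _))
  have hβle : ∀ ξ, ‖ξ‖ = 1 → ∀ x ∈ S, |(inner ℝ ξ (N x) : ℝ)| ≤ b := fun ξ hξ x hx => by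
    refine (abs_real_inner_le_norm _ _).trans ?_
    rw [hξ, one_mul]
    exact hb.norm_le hx
  set G : E → ℝ := fun x =>
    ∑ i, U1 x (stdOrthonormalBasis ℝ E i) * U1 x (stdOrthonormalBasis ℝ E i) with hG
  have hU1bas : ∀ x ∈ S, ∀ i, |U1 x (stdOrthonormalBasis ℝ E i)| ≤ |C₁| := fun x hx i => by
    have := (U1 x).le_opNorm (stdOrthonormalBasis ℝ E i)
    rw [OrthonormalBasis.norm_eq_one, mul_one] at this
    exact this.trans (hC₁ x hx)
  have hG0 : ∀ x, 0 ≤ G x := fun x => Finset.sum_nonneg fun i _ => mul_self_nonneg _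
  have hGle : ∀ x ∈ S, G x ≤ d * |C₁| ^ 2 := fun x hx => by
    have : ∑ _i : Fin d, |C₁| ^ 2 = d * |C₁| ^ 2 := by simp
    rw [← this]
    refine Finset.sum_le_sum fun i _ => ?_
    rw [← sq, ← sq_abs]
    exact pow_le_pow_left₀ (abs_nonneg _) (hU1bas x hx i) 2
  set W : E → E → ℝ := fun ξ x => U2 x ξ ξ - 2 * (inner ℝ ξ (N x) * Z ξ x) + G x + K * ‖x‖ ^ 2
    with hW
  have hWc : ContinuousOn (fun p : E × E => W p.1 p.2) (Metric.sphere 0 1 ×ˢ S) := by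
    have m2 : Set.MapsTo (Prod.snd : E × E → E) (Metric.sphere 0 1 ×ˢ S) S := fun p hp => hp.2
    have c1 := hU1c.continuousOn.comp continuousOn_snd m2
    have c2 := hN.contDiffOn.continuousOn.comp continuousOn_snd m2
    have c3 := hU2c.continuousOn.comp continuousOn_snd m2
    have c4 := bDΦ.1.continuousOn.comp continuousOn_snd m2
    have c6 := (hb.fderivWithin hS).1.continuousOn.comp continuousOn_snd m2
    have c5 : ContinuousOn (fun p : E × E => (inner ℝ p.1 (N p.2) : ℝ)) (Metric.sphere 0 1 ×ˢ S) :=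
      continuousOn_fst.inner (𝕜 := ℝ) c2
    have cT : ContinuousOn (fun p : E × E => tanPart N p.1 p.2) (Metric.sphere 0 1 ×ˢ S) :=
      continuousOn_fst.add (continuousOn_const.smul (c5.smul c2))
    have cY : ContinuousOn (fun p : E × E => mixedField S N ε p.1 p.2) (Metric.sphere 0 1 ×ˢ S) :=
      (c6.clm_apply cT).add (continuousOn_const.smul cT)
    have cG : ContinuousOn (fun p : E × E => G p.2) (Metric.sphere 0 1 ×ˢ S) :=
      continuousOn_finsetSum _ fun i _ => (c1.clm_apply continuousOn_const).mul
        (c1.clm_apply continuousOn_const)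
    exact ((((c3.clm_apply continuousOn_fst).clm_apply continuousOn_fst).sub
      (continuousOn_const.mul (c5.mul ((c1.clm_apply cY).neg.add (c4.clm_apply cT))))).add cG).add
      (continuousOn_const.mul (continuousOn_snd.norm.pow 2))
  have hsphere : (Metric.sphere (0 : E) 1).Nonempty := NormedSpace.sphere_nonempty.2 zero_le_one
  obtain ⟨⟨ξ₀, x₀⟩, hp, hmax⟩ := ((isCompact_sphere (0 : E) 1).prod hcomp).exists_isMaxOn
    (hsphere.prod hSne) hWc
  have hmax' : ∀ ξ, ‖ξ‖ = 1 → ∀ x ∈ S, W ξ x ≤ W ξ₀ x₀ := fun ξ hξ x hx =>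
    hmax (show (ξ, x) ∈ Metric.sphere (0 : E) 1 ×ˢ S from ⟨by simpa using hξ, hx⟩)
  have hξ₀ : ‖ξ₀‖ = 1 := by simpa using hp.1
  have hx₀S : x₀ ∈ S := hp.2
  have hx₀ : x₀ ∈ frontier Ω := by
    rw [hN.isOpen.frontier_eq]
    refine ⟨hx₀S, fun hx₀Ω => ?_⟩
    obtain ⟨ι, _, e, g, hL, hL2⟩ := hlin x₀ hx₀Ω
    have hβ := cbound_inner_normal hS hb2 hSne hξ₀.le
    set X : Fin d → E → ℝ := fun a x => innerSL ℝ (stdOrthonormalBasis ℝ E a)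
      ((-2 : ℝ) • ((inner ℝ ξ₀ (N x) : ℝ) • mixedField S N ε ξ₀ x)) with hX
    set γ : E → ℝ := fun x => (2 : ℝ) • ((inner ℝ ξ₀ (N x) : ℝ) • DΦ x (tanPart N ξ₀ x)) with hγ
    have cX : ∀ a, CBound S 2 (X a) (bX + bγ) := fun a => by
      have h1 := CBound.clm_apply hS (CBound.const 2 (innerSL ℝ (stdOrthonormalBasis ℝ E a)))
        ((CBound.const 2 (-2 : ℝ)).smul hS (hβ.smul hS (hY ξ₀ hξ₀)))
      rw [innerSL_apply_norm, OrthonormalBasis.norm_eq_one, norm_neg, Real.norm_two] at h1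
      exact h1.mono (by rw [hbX]; linarith)
    have cγ : CBound S 2 γ (bX + bγ) := by
      have h1 := (CBound.const 2 (2 : ℝ)).smul hS (hβ.smul hS (bDΦ.clm_apply hS (hT ξ₀ hξ₀)))
      rw [Real.norm_two] at h1
      exact h1.mono (by rw [hbγ]; linarith)
    have heq1 : ∀ y ∈ Ω, ∀ ξ, dirD ξ u y = U1 y ξ := fun y hy ξ => by
      rw [hU1, fderivWithin_of_mem_nhds (mem_of_superset (hN.isOpen.mem_nhds hy) subset_closure)]
      rfl
    refine not_isLocalMax_hessian_test hN.isOpen subset_closure hS hu.contDiffOn hx₀Ω hc hL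
      (hL2 ξ₀ hξ₀) (stdOrthonormalBasis ℝ E) cX cγ (C₁ := |C₁|) (K := K) (fun a => ?_)
      (by positivity) (abs_nonneg _) ?_ ?_
    · rw [heq1 x₀ hx₀Ω]; exact hU1bas x₀ hx₀S a
    · have := le_abs_self (C * (1 + d * (2 * |C₁| + (bX + bγ))) / c +
        (d * ((bX + bγ) * |C₁| + (bX + bγ) ^ 2) + (bX + bγ)))
      have := abs_nonneg (C * (1 + d * (2 * |C₁| + (bX + bγ))) / c +
        (d * ((bX + bγ) * |C₁| + (bX + bγ) ^ 2) + (bX + bγ)))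
      rw [hKdef]
      linarith
    · have heq : ∀ y ∈ Ω, dirD ξ₀ (dirD ξ₀ u) y -
          ∑ a, X a y * dirD (stdOrthonormalBasis ℝ E a) u y - γ y +
          ∑ a, dirD (stdOrthonormalBasis ℝ E a) u y * dirD (stdOrthonormalBasis ℝ E a) u y +
          K * ‖y‖ ^ 2 = W ξ₀ y := fun y hy => by
        have e1 : ∑ a, X a y * dirD (stdOrthonormalBasis ℝ E a) u y =
            U1 y ((-2 : ℝ) • ((inner ℝ ξ₀ (N y) : ℝ) • mixedField S N ε ξ₀ y)) := by
          rw [← sum_inner_mul_apply]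
          exact Finset.sum_congr rfl fun a _ => by rw [heq1 y hy]; rfl
        rw [e1, ← fderivWithin_fderivWithin_eq_dirD hN.isOpen (subset_closure (s := Ω))
          (hu.contDiffOn.of_le (by norm_num)) hy]
        simp only [heq1 y hy, hW, hZ, hG, hγ, map_smul, smul_eq_mul, ← hSdef, ← hU1, ← hU2]
        ring
      filter_upwards [hN.isOpen.mem_nhds hx₀Ω] with y hy
      rw [heq y hy, heq x₀ hx₀Ω]
      exact hmax' ξ₀ hξ₀ y (subset_closure hy)
  have hM0 : 0 ≤ M := (abs_nonneg _).trans (hM x₀ hx₀)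
  set ν := N x₀ with hν
  have hν1 : ‖ν‖ = 1 := hN.norm_eq x₀ hx₀
  have hsymm : ∀ p q, U2 x₀ p q = U2 x₀ q p := fun p q =>
    isSymm_fderivWithin hN (hu.contDiffOn_closure.of_le (by norm_num)) hx₀S p q
  have hW0 : ∀ ξ, W ξ x₀ = U2 x₀ (tanPart N ξ x₀) (tanPart N ξ x₀) +
      inner ℝ ξ ν ^ 2 * U2 x₀ ν ν + (G x₀ + K * ‖x₀‖ ^ 2) := by
    intro ξ
    have h1 := hu.tangential_identity hN (hΦ.1.of_le (by norm_num)) hx₀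
      (inner_tanPart (ξ := ξ) (hN.norm_eq x₀ hx₀))
    rw [← hSdef, ← hU1, ← hU2, ← hDΦ, ← hν] at h1
    have h2 : Z ξ x₀ = U2 x₀ (tanPart N ξ x₀) ν := by
      simp only [hZ, mixedField, map_add, map_smul, smul_eq_mul]
      linarith
    have h3 : ξ = tanPart N ξ x₀ + (inner ℝ ξ ν : ℝ) • ν := by
      rw [tanPart, ← hν]; module
    have h4 : U2 x₀ ξ ξ = U2 x₀ (tanPart N ξ x₀) (tanPart N ξ x₀) +
        2 * (inner ℝ ξ ν * U2 x₀ (tanPart N ξ x₀) ν) + inner ℝ ξ ν ^ 2 * U2 x₀ ν ν := by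
      conv_lhs => rw [h3]
      simp only [map_add, map_smul, _root_.add_apply, _root_.smul_apply, smul_eq_mul,
        hsymm ν (tanPart N ξ x₀)]
      ring
    simp only [hW]
    rw [h2, h4]
    ring
  have hKR : K * ‖x₀‖ ^ 2 ≤ K * R ^ 2 :=
    mul_le_mul_of_nonneg_left (pow_le_pow_left₀ (norm_nonneg _) (hR x₀ hx₀S) 2) hK0
  set T := tanPart N ξ₀ x₀ with hTdef
  set m := U2 x₀ T T + inner ℝ ξ₀ ν ^ 2 * U2 x₀ ν ν with hm
  have hTν : inner ℝ T ν = 0 := inner_tanPart hν1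
  have hTn : ‖T‖ ^ 2 = 1 - inner ℝ ξ₀ ν ^ 2 := norm_tanPart_sq hν1 hξ₀
  have hmtan : ∀ v, ‖v‖ = 1 → inner ℝ v ν = 0 → U2 x₀ v v ≤ m := fun v hv hvν => by
    have h1 := hmax' v hv x₀ hx₀S
    rw [hW0, hW0, tanPart_of_inner_eq_zero hvν, hvν] at h1
    linarith
  have hνM := (le_abs_self _).trans (hM x₀ hx₀)
  -- If m > M then D_{νν}u < m, so the tangential part of ξ₀ is nonzero and must itself attain m
  -- after normalisation. This reduces to a tangential maximal direction.
  have hmle : m ≤ M + (D₁ + D₂ * M) / (2 * κ) := by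
    have hpos : 0 ≤ (D₁ + D₂ * M) / (2 * κ) := by positivity
    rcases le_or_gt m M with hmM | hmM
    · linarith
    have hTm := apply_le_mul_norm_sq hmtan hTν
    have hTpos : 0 < ‖T‖ ^ 2 := by
      by_contra! h0
      nlinarith [sq_nonneg ‖T‖, sq_nonneg (inner ℝ ξ₀ ν)]
    have hTpos' : 0 < ‖T‖ := by
      by_contra! h0
      have := le_antisymm h0 (norm_nonneg T)
      rw [this] at hTpos
      norm_num at hTpos
    set η := ‖T‖⁻¹ • T with hη
    have hη1 : ‖η‖ = 1 := by rw [hη, norm_smul, norm_inv, norm_norm, inv_mul_cancel₀ hTpos'.ne']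
    have hην : inner ℝ η ν = 0 := by rw [hη, real_inner_smul_left, hTν, mul_zero]
    have hηm : U2 x₀ η η = m := by
      refine le_antisymm (hmtan η hη1 hην) ?_
      have h1 : U2 x₀ η η * ‖T‖ ^ 2 = U2 x₀ T T := by
        simp only [hη, map_smul, _root_.smul_apply, smul_eq_mul]; field_simp
      have h2 : inner ℝ ξ₀ ν ^ 2 * U2 x₀ ν ν ≤ inner ℝ ξ₀ ν ^ 2 * m :=
        mul_le_mul_of_nonneg_left (hνM.trans hmM.le) (sq_nonneg _)
      have h3 : m * ‖T‖ ^ 2 ≤ U2 x₀ η η * ‖T‖ ^ 2 := by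
        rw [h1, hTn]; linarith
      exact le_of_mul_le_mul_right h3 hTpos
    have hWη : ∀ y ∈ S, W η y ≤ W η x₀ := fun y hy => by
      refine (hmax' η hη1 y hy).trans (le_of_eq ?_)
      rw [hW0, hW0, tanPart_of_inner_eq_zero hην, hην, hηm]
      ring
    have hZd : DifferentiableWithinAt ℝ (Z η) S x₀ :=
      ((((hU1c.clm_apply ((hY η hη1).1)).neg.add (bDΦ.1.clm_apply (hT η hη1).1)).differentiableOn
        (by norm_num)) x₀ hx₀S)
    have hfin := hu.curvature_mul_le hN hε0 hε1 hb hΦ hx₀ (hR x₀ hx₀S) hK0 hη1 hην hU1 hU2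
      (hC₁ x₀ hx₀S) (hM x₀ hx₀) hZd (hZle η hη1 x₀ hx₀S) (hM0.trans hmM.le) hηm
      (fun v hv => apply_le_mul_norm_sq hmtan hv) hWη
    have : m ≤ (D₁ + D₂ * M) / (2 * κ) := by
      rw [le_div_iff₀ (by positivity), hD₁, hD₂]
      linarith
    linarith
  intro x hx ξ hξ
  have h1 := hmax' ξ hξ x hx
  rw [hW0, ← hTdef, ← hm] at h1
  have h2 : inner ℝ ξ (N x) * Z ξ x ≤ b * Zb := by
    refine (le_abs_self _).trans ?_
    rw [abs_mul]
    exact mul_le_mul (hβle ξ hξ x hx) (hZle ξ hξ x hx) (abs_nonneg _) hb0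
  have h3 : 0 ≤ K * ‖x‖ ^ 2 := by positivity
  have h4 := hGle x₀ hx₀S
  have h5 := hG0 x
  simp only [hW] at h1
  have h6 : U2 x ξ ξ ≤ M + (D₁ + D₂ * M) / (2 * κ) + R₀ := by rw [hR₀]; linarith
  have h7 : (D₁ + D₂ * M) / (2 * κ) ≤ (D₁ + D₂) / (2 * κ) * (1 + M) := by
    rw [div_mul_eq_mul_div]
    refine div_le_div_of_nonneg_right ?_ (by positivity)
    have := mul_nonneg hD₁0 hM0
    linarith
  have h8 := mul_nonneg hR₀0 hM0
  linarith

end HessianEstimate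

/-! ### The supremum bound. -/

section SupBound

variable {n k : ℕ} {Ω : Set (CSpace n)} {N : CSpace n → CSpace n} {κ ε : ℝ}
  {u φ : CSpace n → ℝ} {α : Fin k → CSpace n → ℝ}

theorem norm_I_smul (w : CSpace n) : ‖Complex.I • w‖ = ‖w‖ := by
  rw [norm_smul, Complex.norm_I, one_mul]

/-- σ_1 > 0 makes u strictly subharmonic, so the maximum is on the boundary; there D_ν u ≥ 0 reads
εu ≤ φ. -/
theorem IsNeumannSolution.mul_le (hk : 1 ≤ k) (hN : IsNormalField Ω N κ)
    (hu : IsNeumannSolution Ω N φ ε u) (hadm : IsAdmissible k Ω u) (hε : 0 < ε) {B : ℝ}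
    (hB : ∀ z ∈ frontier Ω, |φ z| ≤ B) {z : CSpace n} (hz : z ∈ closure Ω) : ε * u z ≤ B := by
  have hcomp : IsCompact (closure Ω) := hN.isBounded.isCompact_closure
  obtain ⟨x, hxS, hmax⟩ := hcomp.exists_isMaxOn hN.nonempty.closure
    hu.contDiffOn_closure.continuousOn
  have hmax' : ∀ y ∈ closure Ω, u y ≤ u x := fun y hy => hmax hy
  have hu2 : ContDiffOn ℝ 2 u Ω := hu.contDiffOn.of_le (by norm_num)
  have hx : x ∈ frontier Ω := by
    rw [hN.isOpen.frontier_eq]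
    refine ⟨hxS, fun hxΩ => ?_⟩
    have hloc : IsLocalMax u x := by
      filter_upwards [hN.isOpen.mem_nhds hxΩ] with y hy
      exact hmax' y (subset_closure hy)
    have hnp : ∀ e : CSpace n, dirD e (dirD e u) x ≤ 0 := fun e =>
      ((hasJet_of_contDiffOn hN.isOpen hu2 hxΩ e).of_isLocalMax (isLocalMax_line hloc e)).2
    have h1 := hadm x hxΩ 1 le_rfl hk
    rw [hessianSigma_one hN.isOpen hu2 hxΩ] at h1
    refine absurd h1 (not_lt.2 (Finset.sum_nonpos fun a _ => ?_))
    rw [leviD]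
    linarith [hnp (coordVec a), hnp (Complex.I • coordVec a)]
  have h := hN.normal_deriv_nonneg hx
    (hu.contDiffOn_closure.differentiableOn (by norm_num) x hxS).hasFDerivWithinAt hmax'
  rw [hu.boundary x hx] at h
  have h1 := (le_abs_self _).trans (hB x hx)
  have h2 := mul_le_mul_of_nonneg_left (hmax' z hz) hε.le
  linarith

/-- At an interior minimum of u - K|x - z₁|² every real second derivative of u in a unit direction
would be at least 2K, so every Levi value at least K > n max(1, A), which the equation excludes. At
a boundary minimum the sign of the normal derivative bounds εu below. -/
theorem IsNeumannSolution.le_mul (hk : 1 ≤ k) (hkn : k ≤ n) (hN : IsNormalField Ω N κ)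
    (hu : IsNeumannSolution Ω N φ ε u) (hadm : IsAdmissible k Ω u)
    (hα : ∀ l, ∀ z ∈ Ω, 0 ≤ α l z)
    (heq : ∀ z ∈ Ω, hessianSigma k u z = ∑ l : Fin k, α l z * hessianSigma (l : ℕ) u z)
    (hε : 0 < ε) (hε1 : ε < 1) {A B d K : ℝ} (hA : ∀ z ∈ Ω, ∑ l, α l z ≤ A)
    (hB : ∀ z ∈ frontier Ω, |φ z| ≤ B) (hd : Metric.diam Ω ≤ d) (hK : K = n * max 1 A + 1)
    {z : CSpace n} (hz : z ∈ closure Ω) : -(B + 2 * (K * d) + K * d ^ 2) ≤ ε * u z := by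
  have hcomp : IsCompact (closure Ω) := hN.isBounded.isCompact_closure
  obtain ⟨z₁, hz₁⟩ := hN.nonempty
  have hK0 : 0 ≤ K := by rw [hK]; positivity
  have hu2 : ContDiffOn ℝ 2 u Ω := hu.contDiffOn.of_le (by norm_num)
  have hc : ContinuousOn (fun x => u x - K * ‖x - z₁‖ ^ 2) (closure Ω) :=
    hu.contDiffOn_closure.continuousOn.sub (by fun_prop)
  obtain ⟨x, hxS, hmin⟩ := hcomp.exists_isMinOn ⟨z₁, subset_closure hz₁⟩ hc
  have hmin' : ∀ y ∈ closure Ω, u x - K * ‖x - z₁‖ ^ 2 ≤ u y - K * ‖y - z₁‖ ^ 2 :=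
    fun y hy => hmin hy
  have hdist : ‖x - z₁‖ ≤ d := by
    rw [← dist_eq_norm]
    refine le_trans ?_ hd
    rw [← Metric.diam_closure]
    exact Metric.dist_le_diam_of_mem hN.isBounded.closure hxS (subset_closure hz₁)
  have hx : x ∈ frontier Ω := by
    rw [hN.isOpen.frontier_eq]
    refine ⟨hxS, fun hxΩ => ?_⟩
    have hloc : IsLocalMin (fun x => u x - K * ‖x - z₁‖ ^ 2) x := by
      filter_upwards [hN.isOpen.mem_nhds hxΩ] with y hy
      exact hmin' y (subset_closure hy)
    have hge : ∀ e : CSpace n, ‖e‖ = 1 → 2 * K ≤ dirD e (dirD e u) x := fun e he => by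
      have j := (hasJet_of_contDiffOn hN.isOpen hu2 hxΩ e).sub
        ((hasJet_norm_sq (x - z₁) e).const_mul K)
      have j' := j.congr (g := fun t : ℝ => u (x + t • e) - K * ‖x + t • e - z₁‖ ^ 2)
        (Eventually.of_forall fun t => by
          simp only [show x + t • e - z₁ = x - z₁ + t • e by abel])
      have h1 := (j'.of_isLocalMin (isLocalMin_line hloc e)).2
      rw [he] at h1
      linarith
    obtain ⟨w, hw, hle⟩ := exists_leviD_le hk hkn hN.isOpen hu2 hadm hxΩ (fun l => hα l x hxΩ)
      (heq x hxΩ)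
    have h1 := hge w hw
    have h2 := hge (Complex.I • w) (by rw [norm_I_smul, hw])
    have h3 : (n : ℝ) * max 1 (∑ l, α l x) ≤ n * max 1 A :=
      mul_le_mul_of_nonneg_left (max_le_max le_rfl (hA x hxΩ)) (Nat.cast_nonneg _)
    rw [leviD] at hle
    linarith
  have du := (hu.contDiffOn_closure.differentiableOn (by norm_num) x hxS).hasFDerivWithinAt
  have dW := (((hasFDerivAt_id x).sub_const z₁).norm_sq.hasFDerivWithinAt
    (s := closure Ω)).const_mul K |>.sub du
  have h := hN.normal_deriv_nonneg hx dW (fun y hy => by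
    have := hmin' y hy
    simp
    linarith)
  simp at h
  rw [hu.boundary x hx] at h
  have h1 := neg_le_of_abs_le (hB x hx)
  have h2 : inner ℝ (x - z₁) (N x) ≤ d := by
    have := real_inner_le_norm (x - z₁) (N x)
    rw [hN.norm_eq x hx, mul_one] at this
    exact this.trans hdist
  rw [inner_sub_left] at h2
  have h3 := mul_le_mul_of_nonneg_left h2 hK0
  have h4 : ‖x - z₁‖ ^ 2 ≤ d ^ 2 := pow_le_pow_left₀ (norm_nonneg _) hdist 2
  have h5 := mul_le_mul_of_nonneg_left h4 hK0
  have h6 := hmin' z hz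
  have h7 : 0 ≤ K * ‖z - z₁‖ ^ 2 := by positivity
  have h8 : ε * (u x - K * d ^ 2) ≤ ε * u z := mul_le_mul_of_nonneg_left (by linarith) hε.le
  have h9 : ε * (K * d ^ 2) ≤ 1 * (K * d ^ 2) := mul_le_mul_of_nonneg_right hε1.le (by positivity)
  linarith

end SupBound

/-! ### From a one-sided bound to the operator norm. -/

section HessianNorm

variable {E : Type*} [NormedAddCommGroup E] [InnerProductSpace ℝ E]

/-- A nonnegative trace turns the upper bound Q on diagonal entries into the lower bound -dQ, where
d is the number of basis vectors. Polarisation with b_i ± b_j then bounds the remaining entries by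
(d + 2)Q. -/
theorem norm_le_of_apply_self_le {ι : Type*} [Fintype ι] {b : ι → E} (hb : ∀ i, ‖b i‖ = 1)
    {x : E → ι → ℝ} (hx : ∀ v i, |x v i| ≤ ‖v‖) (hsum : ∀ v, ∑ i, x v i • b i = v)
    {B : E →L[ℝ] E →L[ℝ] ℝ} (hB : ∀ v w, B v w = B w v) {Q : ℝ} (hQ : 0 ≤ Q)
    (hle : ∀ v, ‖v‖ = 1 → B v v ≤ Q) (htr : 0 ≤ ∑ i, B (b i) (b i)) :
    ‖B‖ ≤ Fintype.card ι ^ 2 * (Fintype.card ι + 2) * Q := by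
  set d := (Fintype.card ι : ℝ)
  have hle' : ∀ v, B v v ≤ Q * ‖v‖ ^ 2 := fun v =>
    apply_le_mul_norm_sq (ν := 0) (fun v hv _ => hle v hv) (by simp)
  have hdiag : ∀ i, -(d * Q) ≤ B (b i) (b i) := fun i => by
    have h1 := Finset.single_le_sum (f := fun j => Q - B (b j) (b j))
      (fun j _ => sub_nonneg.2 (hle _ (hb j))) (Finset.mem_univ i)
    rw [Finset.sum_sub_distrib, Finset.sum_const, Finset.card_univ, nsmul_eq_mul] at h1
    change _ ≤ d * Q - _ at h1
    linarith
  have hcomp : ∀ i j, |B (b i) (b j)| ≤ (d + 2) * Q := fun i j => by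
    have h1 := hle' (b i + b j)
    have h2 := hle' (b i - b j)
    have n1 : ‖b i + b j‖ ^ 2 ≤ 4 := by
      have := norm_add_le (b i) (b j)
      rw [hb, hb] at this
      nlinarith [norm_nonneg (b i + b j)]
    have n2 : ‖b i - b j‖ ^ 2 ≤ 4 := by
      have := norm_sub_le (b i) (b j)
      rw [hb, hb] at this
      nlinarith [norm_nonneg (b i - b j)]
    have m1 := mul_le_mul_of_nonneg_left n1 hQ
    have m2 := mul_le_mul_of_nonneg_left n2 hQ
    simp only [map_add, map_sub, _root_.add_apply, _root_.sub_apply, hB (b j) (b i)] at h1 h2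
    have := hdiag i
    have := hdiag j
    rw [abs_le]
    constructor <;> linarith
  have hd0 : (0 : ℝ) ≤ d := Nat.cast_nonneg _
  refine B.opNorm_le_bound₂ (by positivity) fun v w => ?_
  have hexp : B v w = ∑ i, ∑ j, x v i * (x w j * B (b i) (b j)) := by
    conv_lhs => rw [← hsum v, ← hsum w]
    simp only [map_sum, map_smul, _root_.sum_apply, _root_.smul_apply, smul_eq_mul,
      Finset.mul_sum]
    rw [Finset.sum_comm]
    exact Finset.sum_congr rfl fun i _ => Finset.sum_congr rfl fun j _ => by ring
  rw [hexp]
  refine (norm_sum_le _ _).trans ((Finset.sum_le_sum fun i _ => norm_sum_le _ _).trans ?_)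
  have hterm : ∀ i j, ‖x v i * (x w j * B (b i) (b j))‖ ≤ ‖v‖ * (‖w‖ * ((d + 2) * Q)) := fun i j => by
    rw [norm_mul, norm_mul]
    exact mul_le_mul (hx v i) (mul_le_mul (hx w j) (hcomp i j) (norm_nonneg _) (norm_nonneg _))
      (by positivity) (norm_nonneg _)
  refine (Finset.sum_le_sum fun i _ => Finset.sum_le_sum fun j _ => hterm i j).trans (le_of_eq ?_)
  simp only [Finset.sum_const, Finset.card_univ, nsmul_eq_mul]
  ring

end HessianNorm

/-! ### Translation between the data of the problem and the estimates. -/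

section Bridge

variable {n k : ℕ} {Ω : Set (CSpace n)} {ν N : CSpace n → CSpace n} {κ ε : ℝ}
  {u φ : CSpace n → ℝ} {α : Fin k → CSpace n → ℝ}

theorem norm_coordVec (a : Fin n) : ‖coordVec a‖ = 1 := by simp [coordVec]

theorem norm_fderiv_fderiv_le (hΩ : IsOpen Ω) (hu : ContDiffOn ℝ 2 u Ω) {z : CSpace n}
    (hz : z ∈ Ω) (hpos : 0 < hessianSigma 1 u z) {Q : ℝ} (hQ : 0 ≤ Q)
    (hle : ∀ ξ, ‖ξ‖ = 1 → fderiv ℝ (fderiv ℝ u) z ξ ξ ≤ Q) :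
    ‖iteratedFDeriv ℝ 2 u z‖ ≤ (2 * n) ^ 2 * (2 * n + 2) * Q := by
  have h := norm_le_of_apply_self_le (ι := Fin n ⊕ Fin n)
    (b := Sum.elim coordVec fun a => Complex.I • coordVec a)
    (x := fun v => Sum.elim (fun a => (v a).re) fun a => (v a).im)
    (B := fderiv ℝ (fderiv ℝ u) z) (Q := Q) ?_ ?_ ?_ ?_ hQ hle ?_
  · rw [show (2 : ℕ) = 1 + 1 from rfl, ← norm_iteratedFDeriv_fderiv, norm_iteratedFDeriv_one]
    refine h.trans (le_of_eq ?_)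
    simp only [Fintype.card_sum, Fintype.card_fin]
    push_cast
    ring
  · rintro (a | a)
    · exact norm_coordVec a
    · simp only [Sum.elim_inr]; rw [norm_I_smul]; exact norm_coordVec a
  · rintro v (a | a)
    · exact (Complex.abs_re_le_norm _).trans (PiLp.norm_apply_le v a)
    · exact (Complex.abs_im_le_norm _).trans (PiLp.norm_apply_le v a)
  · intro v
    rw [Fintype.sum_sum_type]
    conv_rhs => rw [← sum_smul_coordVec v]
    simp only [Sum.elim_inl, Sum.elim_inr, complex_smul_eq (v _), Finset.sum_add_distrib]
  · intro v w
    rw [← dirD_eq_iterated hu hΩ hz, ← dirD_eq_iterated hu hΩ hz]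
    exact dirD_comm hu hΩ v w hz
  · rw [hessianSigma_one hΩ hu hz] at hpos
    rw [Fintype.sum_sum_type, ← Finset.sum_add_distrib]
    simp only [Sum.elim_inl, Sum.elim_inr, ← dirD_eq_iterated hu hΩ hz]
    have : ∑ a, leviD u (coordVec a) z = (1 / 4) * ∑ a : Fin n, (dirD (coordVec a)
        (dirD (coordVec a) u) z + dirD (Complex.I • coordVec a)
        (dirD (Complex.I • coordVec a) u) z) := by
      rw [Finset.mul_sum]; rfl
    linarith

theorem IsC4StrictlyConvexDomain.exists_isNormalField (h : IsC4StrictlyConvexDomain Ω) :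
    ∃ N κ, IsNormalField Ω N κ := by
  obtain ⟨r, hr, hΩ, hr1, hr2⟩ := h.exists_defining
  refine _root_.exists_isNormalField h.isOpen h.convex h.nonempty h.isBounded hr hΩ hr1
    fun z hz ξ hξ h0 => ?_
  simpa [iteratedFDeriv_two_apply] using hr2 z hz ξ hξ h0

theorem IsNormalField.eq_of_isOuterUnitNormal (hN : IsNormalField Ω N κ) {z : CSpace n}
    (hz : z ∈ frontier Ω) {v : CSpace n} (hv : IsOuterUnitNormal Ω z v) : v = N z :=
  hN.unique z hz v hv.1 hv.2

theorem IsAdmissibleSolution.isNeumannSolution (hu : IsAdmissibleSolution k Ω ν α φ ε u)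
    (hN : IsNormalField Ω N κ) (hν : ∀ z ∈ frontier Ω, IsOuterUnitNormal Ω z (ν z))
    {Φ : CSpace n → ℝ} (hΦ : Set.EqOn Φ φ (frontier Ω)) : IsNeumannSolution Ω N Φ ε u where
  contDiffOn := hu.contDiffOn
  contDiffOn_closure := hu.contDiffOn_closure
  boundary z hz := by
    rw [← hN.eq_of_isOuterUnitNormal hz (hν z hz), hu.boundary z hz, hΦ hz]

theorem cbound_of_closureCNorm_le (hN : IsNormalField Ω N κ) {m : ℕ} {f : CSpace n → ℝ}
    (hf : ContDiffOn ℝ m f (closure Ω)) {A : ℝ} (h : closureCNorm Ω m f ≤ A) :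
    CBound (closure Ω) m f A := by
  obtain ⟨B, hB⟩ := CBound.exists_of_isCompact hN.uniqueDiffOn hN.isBounded.isCompact_closure hf
  refine ⟨hf, fun j hj x hx => ?_⟩
  have hbdd : BddAbove ((fun z => ‖iteratedFDerivWithin ℝ j f (closure Ω) z‖) '' closure Ω) := by
    refine ⟨B, ?_⟩
    rintro _ ⟨y, hy, rfl⟩
    exact hB.2 j hj y hy
  refine (le_csSup hbdd ⟨x, hx, rfl⟩).trans (le_trans ?_ h)
  refine Finset.single_le_sum (f := fun j =>
    sSup ((fun z => ‖iteratedFDerivWithin ℝ j f (closure Ω) z‖) '' closure Ω)) (fun i _ => ?_)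
    (Finset.mem_range.2 (Nat.lt_succ_of_le hj))
  refine Real.sSup_nonneg ?_
  rintro _ ⟨y, -, rfl⟩
  exact norm_nonneg _

/-- The infimum defining the boundary norm need not be attained; the extra 1 leaves room for a
near-optimal extension. -/
theorem exists_extension_of_boundaryCNorm_le (hN : IsNormalField Ω N κ) {m : ℕ}
    (hφ : ∃ Φ, IsBoundaryExtension Ω m φ Φ) {B : ℝ} (h : boundaryCNorm Ω m φ ≤ B) :
    ∃ Φ, Set.EqOn Φ φ (frontier Ω) ∧ CBound (closure Ω) m Φ (B + 1) := by
  obtain ⟨Φ₀, hΦ₀⟩ := hφ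
  obtain ⟨b, ⟨Φ, hΦ, rfl⟩, hb⟩ := exists_lt_of_csInf_lt
    (s := {b | ∃ Φ, IsBoundaryExtension Ω m φ Φ ∧ b = closureCNorm Ω m Φ}) ⟨_, Φ₀, hΦ₀, rfl⟩
    (show _ < B + 1 from lt_of_le_of_lt h (lt_add_one B))
  exact ⟨Φ, hΦ.2, cbound_of_closureCNorm_le hN hΦ.1 hb.le⟩

theorem IsLinearization.mono {ι : Type} [Fintype ι] {E : Type*} [NormedAddCommGroup E]
    [InnerProductSpace ℝ E] {f : E → ℝ} {x₀ : E} {e : ι → E} {g : ι → ℝ} {c C C' : ℝ}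
    (h : IsLinearization f x₀ e g c C) (hC : C ≤ C') : IsLinearization f x₀ e g c C' where
  norm_eq := h.norm_eq
  nonneg := h.nonneg
  le_sum := h.le_sum
  apply_self := h.apply_self.trans hC
  apply_dirD ξ hξ := (h.apply_dirD ξ hξ).trans hC

theorem sum_levi_weights (w : Fin n → CSpace n) (g : Fin n → ℝ) (v : CSpace n → ℝ) (z : CSpace n) :
    ∑ i, Sum.elim (fun i => g i / 4) (fun i => g i / 4) i *
      dirD (Sum.elim w (fun i => Complex.I • w i) i)
        (dirD (Sum.elim w (fun i => Complex.I • w i) i) v) z = ∑ i, g i * leviD v (w i) z := by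
  rw [Fintype.sum_sum_type, ← Finset.sum_add_distrib]
  refine Finset.sum_congr rfl fun i _ => ?_
  simp only [Sum.elim_inl, Sum.elim_inr, leviD]
  ring

theorem IsAdmissibleSolution.exists_isLinearization (hk : 1 ≤ k) (hkn : k ≤ n)
    (hN : IsNormalField Ω N κ) (hdata : IsNeumannData k Ω ν α φ)
    (hu : IsAdmissibleSolution k Ω ν α φ ε u) {a A : ℝ} (ha : 0 < a)
    (hαa : ∀ l, ∀ z ∈ Ω, a ≤ α l z) (hαA : ∀ l, CBound (closure Ω) 1 (α l) A)
    {z₀ : CSpace n} (hz₀ : z₀ ∈ Ω) :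
    ∃ (ι : Type) (_ : Fintype ι) (e : ι → CSpace n) (g : ι → ℝ),
      IsLinearization u z₀ e g (1 / (2 * n)) ((k + 1) * (k * A * max 1 (1 / a))) ∧
      ∀ ξ A₂, (∀ l, |dirD ξ (dirD ξ (α l)) z₀| ≤ A₂) →
        -(k * (max 1 (1 / a) * (A₂ + A ^ 2 * ‖ξ‖ ^ 2 / a))) ≤
          ∑ i, g i * dirD (e i) (dirD (e i) (dirD ξ (dirD ξ u))) z₀ := by
  have hA : ∀ l, α l z₀ ≤ A := fun l =>
    (le_abs_self _).trans ((hαA l).norm_le (subset_closure hz₀))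
  obtain ⟨w, g, hw, hg, hsum, h0, h1, h2, h3⟩ := exists_linearization hk hkn hN.isOpen
    hu.contDiffOn hu.admissible (fun l => (hdata.coeff_contDiffOn l).mono subset_closure)
    (fun l z hz => (hdata.coeff_pos l z (subset_closure hz)).le) hu.equation hz₀ ha
    (fun l => hαa l z₀ hz₀) hA
    (fun l ξ => (hαA l).dirD_le hN.isOpen subset_closure hN.uniqueDiffOn le_rfl hz₀ ξ)
  have hA0 : 0 ≤ A := ha.le.trans ((hαa ⟨0, hk⟩ z₀ hz₀).trans (hA _))
  have hD : 0 ≤ k * A * max 1 (1 / a) := by positivity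
  -- A Levi value is a quarter of the sum of the second derivatives along w and √-1 w. The total
  -- weight is thus halved, whence 1/(2n).
  refine ⟨Fin n ⊕ Fin n, inferInstance, Sum.elim w fun i => Complex.I • w i,
    Sum.elim (fun i => g i / 4) fun i => g i / 4, ⟨?_, ?_, ?_, ?_, ?_⟩, ?_⟩
  · rintro (i | i)
    · exact hw i
    · simp only [Sum.elim_inr]; rw [norm_I_smul]; exact hw i
  · rintro (i | i) <;> exact div_nonneg (hg i) (by norm_num)
  · rw [Fintype.sum_sum_type]
    simp only [Sum.elim_inl, Sum.elim_inr, ← Finset.sum_div]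
    have : (1 : ℝ) / (2 * n) = 1 / n / 2 := by rw [div_div, mul_comm]
    rw [this]
    linarith
  · rw [sum_levi_weights, abs_of_nonneg h0]
    exact h1
  · intro ξ hξ
    rw [sum_levi_weights]
    refine (h2 ξ).trans ?_
    have e1 : k * A * max 1 (1 / a) * ‖ξ‖ ≤ k * A * max 1 (1 / a) * 1 :=
      mul_le_mul_of_nonneg_left hξ hD
    have e2 : 0 ≤ (k : ℝ) * (k * A * max 1 (1 / a)) := by positivity
    linarith
  · intro ξ A₂ hA₂
    rw [sum_levi_weights]
    exact h3 ξ A₂ hA₂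

end Bridge

/-! ### The three estimates. -/

section Main

variable {n k : ℕ} {Ω : Set (CSpace n)} {ν N : CSpace n → CSpace n} {κ ε : ℝ}
  {u φ : CSpace n → ℝ} {α : Fin k → CSpace n → ℝ}

theorem IsAdmissibleSolution.abs_mul_le (hk : 1 ≤ k) (hkn : k ≤ n) (hN : IsNormalField Ω N κ)
    (hdata : IsNeumannData k Ω ν α φ) (hu : IsAdmissibleSolution k Ω ν α φ ε u)
    (hε0 : 0 < ε) (hε1 : ε < 1) {A B d : ℝ} (hA : ∀ z ∈ Ω, ∑ l, α l z ≤ A)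
    (hB : ∀ z ∈ frontier Ω, |φ z| ≤ B) (hd : Metric.diam Ω ≤ d)
    {z : CSpace n} (hz : z ∈ closure Ω) :
    |ε * u z| ≤ B + 2 * ((n * max 1 A + 1) * d) + (n * max 1 A + 1) * d ^ 2 := by
  have hu' := hu.isNeumannSolution hN hdata.normal (Set.eqOn_refl φ _)
  have h1 := hu'.mul_le hk hN hu.admissible hε0 hB hz
  have h2 := hu'.le_mul hk hkn hN hu.admissible
    (fun l z hz => (hdata.coeff_pos l z (subset_closure hz)).le) hu.equation hε0 hε1 hA hB hd rfl hz
  have hd0 : 0 ≤ d := Metric.diam_nonneg.trans hd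
  rw [abs_le]
  refine ⟨h2, h1.trans ?_⟩
  have h3 : 0 ≤ 2 * ((n * max 1 A + 1) * d) := by positivity
  have h4 : 0 ≤ (n * max 1 A + 1) * d ^ 2 := by positivity
  linarith

theorem nontrivial_cSpace (hn : 1 ≤ n) : Nontrivial (CSpace n) :=
  ⟨coordVec ⟨0, hn⟩, 0, fun h => by simpa [h] using norm_coordVec (⟨0, hn⟩ : Fin n)⟩

theorem exists_gradient_estimate (hk : 1 ≤ k) (hkn : k ≤ n) (hN : IsNormalField Ω N κ) {a : ℝ}
    (ha : 0 < a) (A B : ℝ) :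
    ∃ C₁ : ℝ, ∀ (ν : CSpace n → CSpace n) (α : Fin k → CSpace n → ℝ) (φ Φ : CSpace n → ℝ) (ε : ℝ)
      (u : CSpace n → ℝ), 0 < ε → ε < 1 → IsNeumannData k Ω ν α φ →
      IsAdmissibleSolution k Ω ν α φ ε u → Set.EqOn Φ φ (frontier Ω) →
      CBound (closure Ω) 2 Φ B → (∀ l, ∀ z ∈ Ω, a ≤ α l z) →
      (∀ l, CBound (closure Ω) 1 (α l) A) →
      ∀ z ∈ closure Ω, ‖fderivWithin ℝ u (closure Ω) z‖ ≤ C₁ := by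
  have := nontrivial_cSpace (hk.trans hkn)
  have hn : (0 : ℝ) < n := by exact_mod_cast hk.trans hkn
  obtain ⟨C₁, hC₁⟩ := exists_gradient_bound hN (c := 1 / (2 * n)) (by positivity)
    ((k + 1) * (k * A * max 1 (1 / a))) B
    (B + 2 * ((n * max 1 (k * A) + 1) * Metric.diam Ω) +
      (n * max 1 (k * A) + 1) * Metric.diam Ω ^ 2)
  refine ⟨C₁, fun ν α φ Φ ε u hε0 hε1 hdata hu hΦφ hΦ hαa hαA => ?_⟩
  refine hC₁ u Φ ε hε0 hε1 (hu.isNeumannSolution hN hdata.normal hΦφ) hΦ (fun z hz => ?_)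
    fun z₀ hz₀ => ?_
  · refine hu.abs_mul_le hk hkn hN hdata hε0 hε1 (fun y hy => ?_) (fun y hy => ?_) le_rfl hz
    · have : ∑ l, α l y ≤ ∑ _l : Fin k, A := Finset.sum_le_sum fun l _ =>
        (le_abs_self _).trans ((hαA l).norm_le (subset_closure hy))
      simpa using this
    · rw [← hΦφ hy]
      exact hΦ.norm_le (frontier_subset_closure hy)
  · obtain ⟨ι, hι, e, g, hL, -⟩ := hu.exists_isLinearization hk hkn hN hdata ha hαa hαA hz₀
    exact ⟨ι, hι, e, g, hL⟩

theorem le_of_le_sInf_image {f : CSpace n → ℝ} {S : Set (CSpace n)} (hf : ∀ z ∈ S, 0 < f z) {a : ℝ}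
    (h : a ≤ sInf (f '' S)) {z : CSpace n} (hz : z ∈ S) : a ≤ f z := by
  refine h.trans (csInf_le ⟨0, ?_⟩ ⟨z, hz, rfl⟩)
  rintro _ ⟨y, hy, rfl⟩
  exact (hf y hy).le

theorem abs_fderivWithin_normal_le_maxDoubleNormal (hN : IsNormalField Ω N κ)
    (hν : ∀ z ∈ frontier Ω, IsOuterUnitNormal Ω z (ν z)) (hu : ContDiffOn ℝ 2 u (closure Ω))
    {z : CSpace n} (hz : z ∈ frontier Ω) :
    |fderivWithin ℝ (fderivWithin ℝ u (closure Ω)) (closure Ω) z (N z) (N z)| ≤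
      maxDoubleNormal Ω ν u := by
  obtain ⟨b, hb⟩ := CBound.exists_of_isCompact (m := 2) hN.uniqueDiffOn
    hN.isBounded.isCompact_closure hu
  have hbdd : BddAbove ((fun z => |iteratedFDerivWithin ℝ 2 u (closure Ω) z ![ν z, ν z]|) ''
      frontier Ω) := by
    refine ⟨b, ?_⟩
    rintro _ ⟨y, hy, rfl⟩
    refine ((iteratedFDerivWithin ℝ 2 u (closure Ω) y).le_opNorm _).trans ?_
    simp only [Fin.prod_univ_two, Matrix.cons_val_zero, Matrix.cons_val_one, (hν y hy).1, mul_one]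
    exact hb.2 2 le_rfl y (frontier_subset_closure hy)
  refine le_trans (le_of_eq ?_) (le_csSup hbdd ⟨z, hz, rfl⟩)
  simp only
  rw [iteratedFDerivWithin_two_apply' u hN.uniqueDiffOn (frontier_subset_closure hz),
    hN.eq_of_isOuterUnitNormal hz (hν z hz)]

theorem maxDoubleNormal_nonneg (Ω : Set (CSpace n)) (ν : CSpace n → CSpace n) (u : CSpace n → ℝ) :
    0 ≤ maxDoubleNormal Ω ν u := by
  refine Real.sSup_nonneg ?_
  rintro _ ⟨y, -, rfl⟩
  exact abs_nonneg _

theorem exists_hessian_estimate (hk : 1 ≤ k) (hkn : k ≤ n) (hN : IsNormalField Ω N κ) {a : ℝ}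
    (ha : 0 < a) (A B : ℝ) :
    ∃ C₂ : ℝ, ∀ (ν : CSpace n → CSpace n) (α : Fin k → CSpace n → ℝ) (φ Φ : CSpace n → ℝ) (ε : ℝ)
      (u : CSpace n → ℝ), 0 < ε → ε < 1 → IsNeumannData k Ω ν α φ →
      IsAdmissibleSolution k Ω ν α φ ε u → Set.EqOn Φ φ (frontier Ω) →
      CBound (closure Ω) 3 Φ B → (∀ l, ∀ z ∈ Ω, a ≤ α l z) →
      (∀ l, CBound (closure Ω) 2 (α l) A) →
      ∀ z ∈ Ω, ‖iteratedFDeriv ℝ 2 u z‖ ≤ C₂ * (1 + maxDoubleNormal Ω ν u) := by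
  have := nontrivial_cSpace (hk.trans hkn)
  have hn : (0 : ℝ) < n := by exact_mod_cast hk.trans hkn
  obtain ⟨C₁, hC₁⟩ := exists_gradient_estimate (Ω := Ω) hk hkn hN ha A B
  obtain ⟨C₂, hC₂0, hC₂⟩ := exists_hessian_bound hN (c := 1 / (2 * n)) (by positivity)
    -- One constant for both requirements: the bounds on Lu and L(∂_ξ u), and the lower bound on
    -- L(∂_ξ∂_ξ u) for unit ξ, where the second derivatives of α_l are at most A.
    (max ((k + 1) * (k * A * max 1 (1 / a))) (k * (max 1 (1 / a) * (A + A ^ 2 * 1 ^ 2 / a)))) B C₁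
  refine ⟨(2 * n) ^ 2 * (2 * n + 2) * C₂,
    fun ν α φ Φ ε u hε0 hε1 hdata hu hΦφ hΦ hαa hαA z hz => ?_⟩
  have hαA1 : ∀ l, CBound (closure Ω) 1 (α l) A := fun l => (hαA l).of_le (by norm_num)
  have hu2 : ContDiffOn ℝ 2 u Ω := hu.contDiffOn.of_le (by norm_num)
  have h1 := hC₂ u Φ ε (maxDoubleNormal Ω ν u) hε0 hε1
    (hu.isNeumannSolution hN hdata.normal hΦφ) hΦ
    (hC₁ ν α φ Φ ε u hε0 hε1 hdata hu hΦφ (hΦ.of_le (by norm_num)) hαa hαA1)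
    (fun x hx => abs_fderivWithin_normal_le_maxDoubleNormal hN hdata.normal
      (hu.contDiffOn_closure.of_le (by norm_num)) hx) (fun z₀ hz₀ => by
      obtain ⟨ι, hι, e, g, hL, hL2⟩ := hu.exists_isLinearization hk hkn hN hdata ha hαa hαA1 hz₀
      refine ⟨ι, hι, e, g, hL.mono (le_max_left _ _), fun ξ hξ => ?_⟩
      have h3 := hL2 ξ A fun l => by
        have := (hαA l).dirD_dirD_le hN.isOpen subset_closure hN.uniqueDiffOn le_rfl hz₀ ξ
        rwa [hξ, one_pow, mul_one] at this
      rw [hξ] at h3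
      exact (neg_le_neg (le_max_right _ _)).trans h3) z (subset_closure hz)
  rw [mul_assoc]
  refine norm_fderiv_fderiv_le hN.isOpen hu2 hz (hu.admissible z hz 1 le_rfl hk)
    (mul_nonneg hC₂0 (by linarith [maxDoubleNormal_nonneg Ω ν u])) fun ξ hξ => ?_
  have h2 := h1 ξ hξ
  rwa [fderivWithin_fderivWithin_eq_dirD hN.isOpen subset_closure hu2 hz,
    dirD_eq_iterated hu2 hN.isOpen hz] at h2

end Main

theorem theorem1p1 (n k : ℕ) (hk : 2 ≤ k) (hkn : k ≤ n) :
    -- `C₀` depends on `n`, `k`, `ε`, `diam Ω`, `max |φ|` and `∑ sup α_l`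
    (∀ ε d B A : ℝ, 0 < ε → ε < 1 → ∃ C₀ : ℝ,
      ∀ (Ω : Set (CSpace n)) (ν : CSpace n → CSpace n) (α : Fin k → CSpace n → ℝ)
        (φ u : CSpace n → ℝ),
        IsNeumannData k Ω ν α φ →
        IsAdmissibleSolution k Ω ν α φ ε u →
        Metric.diam Ω ≤ d →
        sSup ((fun z => |φ z|) '' frontier Ω) ≤ B →
        ∑ l : Fin k, sSup (α l '' Ω) ≤ A →
        ∀ z ∈ Ω, |u z| ≤ C₀) ∧
    -- `C₁` depends on `n`, `k`, `Ω`, `|φ|_{C²}`, `inf α_l` and `|α_l|_{C¹}`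
    (∀ Ω : Set (CSpace n), ∀ a A B : ℝ, 0 < a → ∃ C₁ : ℝ,
      ∀ (ν : CSpace n → CSpace n) (α : Fin k → CSpace n → ℝ) (φ : CSpace n → ℝ)
        (ε : ℝ) (u : CSpace n → ℝ),
        0 < ε → ε < 1 →
        IsNeumannData k Ω ν α φ →
        IsAdmissibleSolution k Ω ν α φ ε u →
        boundaryCNorm Ω 2 φ ≤ B →
        (∀ l, a ≤ sInf (α l '' Ω)) →
        (∀ l, closureCNorm Ω 1 (α l) ≤ A) →
        ∀ z ∈ Ω, ‖fderiv ℝ u z‖ ≤ C₁) ∧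
    -- `C₂` depends on `n`, `k`, `Ω`, `|φ|_{C³}`, `inf α_l` and `|α_l|_{C²}`
    (∀ Ω : Set (CSpace n), ∀ a A B : ℝ, 0 < a → ∃ C₂ : ℝ,
      ∀ (ν : CSpace n → CSpace n) (α : Fin k → CSpace n → ℝ) (φ : CSpace n → ℝ)
        (ε : ℝ) (u : CSpace n → ℝ),
        0 < ε → ε < 1 →
        IsNeumannData k Ω ν α φ →
        IsAdmissibleSolution k Ω ν α φ ε u →
        boundaryCNorm Ω 3 φ ≤ B →
        (∀ l, a ≤ sInf (α l '' Ω)) →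
        (∀ l, closureCNorm Ω 2 (α l) ≤ A) →
        ∀ z ∈ Ω, ‖iteratedFDeriv ℝ 2 u z‖ ≤ C₂ * (1 + maxDoubleNormal Ω ν u)) := by
  have hk1 : 1 ≤ k := by omega
  refine ⟨fun ε d B A hε0 hε1 => ?_, fun Ω a A B ha => ?_, fun Ω a A B ha => ?_⟩
  -- The bound on εu divided by ε. It does not involve κ or the extension N, so it is uniform over
  -- all domains of diameter at most d.
  · refine ⟨(B + 2 * ((n * max 1 A + 1) * d) + (n * max 1 A + 1) * d ^ 2) / ε,
      fun Ω ν α φ u hdata hu hd hB hA z hz => ?_⟩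
    obtain ⟨N, κ, hN⟩ := hdata.domain.exists_isNormalField
    have hcomp : IsCompact (closure Ω) := hN.isBounded.isCompact_closure
    obtain ⟨Φ, hΦ, hΦφ⟩ := hdata.boundary_contDiff
    obtain ⟨b, hb⟩ := hcomp.exists_bound_of_continuousOn hΦ.continuousOn
    have h1 : ∀ y ∈ frontier Ω, |φ y| ≤ B := fun y hy => by
      have hbdd : BddAbove ((fun z => |φ z|) '' frontier Ω) := by
        refine ⟨b, ?_⟩
        rintro _ ⟨x, hx, rfl⟩
        simp only
        rw [← hΦφ hx]
        exact hb x (frontier_subset_closure hx)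
      exact (le_csSup hbdd ⟨y, hy, rfl⟩).trans hB
    have h2 : ∀ y ∈ Ω, ∑ l, α l y ≤ A := fun y hy => by
      refine (Finset.sum_le_sum fun l _ => ?_).trans hA
      obtain ⟨b', hb'⟩ := hcomp.exists_bound_of_continuousOn (hdata.coeff_contDiffOn l).continuousOn
      refine le_csSup ⟨b', ?_⟩ ⟨y, hy, rfl⟩
      rintro _ ⟨x, hx, rfl⟩
      exact (le_abs_self _).trans (hb' x (subset_closure hx))
    have h3 := hu.abs_mul_le hk1 hkn hN hdata hε0 hε1 h2 h1 hd (subset_closure hz)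
    rw [abs_mul, abs_of_pos hε0] at h3
    rw [le_div_iff₀ hε0, mul_comm]
    exact h3
  · by_cases hΩ : IsC4StrictlyConvexDomain Ω
    · obtain ⟨N, κ, hN⟩ := hΩ.exists_isNormalField
      obtain ⟨C₁, hC₁⟩ := exists_gradient_estimate (Ω := Ω) hk1 hkn hN ha A (B + 1)
      refine ⟨C₁, fun ν α φ ε u hε0 hε1 hdata hu hφ hαa hαA z hz => ?_⟩
      obtain ⟨Φ₀, hΦ₀⟩ := hdata.boundary_contDiff
      obtain ⟨Φ, hΦφ, hΦ⟩ := exists_extension_of_boundaryCNorm_le hN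
        ⟨Φ₀, hΦ₀.1.of_le (by norm_num), hΦ₀.2⟩ hφ
      have h := hC₁ ν α φ Φ ε u hε0 hε1 hdata hu hΦφ hΦ
        (fun l z hz => le_of_le_sInf_image
          (fun y hy => hdata.coeff_pos l y (subset_closure hy)) (hαa l) hz)
        (fun l => cbound_of_closureCNorm_le hN ((hdata.coeff_contDiffOn l).of_le (by norm_num))
          (hαA l)) z (subset_closure hz)
      rwa [fderivWithin_of_mem_nhds (mem_of_superset (hN.isOpen.mem_nhds hz) subset_closure)] at h
    -- For a set Ω that is not an admissible domain there are no data, so any constant serves.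
    · exact ⟨0, fun ν α φ ε u _ _ hdata => absurd hdata.domain hΩ⟩
  · by_cases hΩ : IsC4StrictlyConvexDomain Ω
    · obtain ⟨N, κ, hN⟩ := hΩ.exists_isNormalField
      obtain ⟨C₂, hC₂⟩ := exists_hessian_estimate (Ω := Ω) hk1 hkn hN ha A (B + 1)
      refine ⟨C₂, fun ν α φ ε u hε0 hε1 hdata hu hφ hαa hαA z hz => ?_⟩
      obtain ⟨Φ, hΦφ, hΦ⟩ := exists_extension_of_boundaryCNorm_le hN hdata.boundary_contDiff hφ
      exact hC₂ ν α φ Φ ε u hε0 hε1 hdata hu hΦφ hΦ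
        (fun l z hz => le_of_le_sInf_image
          (fun y hy => hdata.coeff_pos l y (subset_closure hy)) (hαa l) hz)
        (fun l => cbound_of_closureCNorm_le hN (hdata.coeff_contDiffOn l) (hαA l)) z hz
    · exact ⟨0, fun ν α φ ε u _ _ hdata => absurd hdata.domain hΩ⟩
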